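/- Conventions. An alphabet $X$ with a map $x\mapsto \overline{x}$ to a group $G$ is a finite symmetric generating set if $X$ is finite, the image is closed under inversion, and the image generates $G$; $\overline{w}$ is the element represented by a word $w\in X^*$, and $\lambda$ is the empty word. A function between sets of words is logspace computable if it is computed by a deterministic transducer with a read-only input tape, a work tape of which only $O(\log n)$ squares are used on inputs of length $n$, and a write-only output tape. A normal form is a set $L\subseteq X^*$ that $w\mapsto\overline{w}$ maps bijectively onto $G$. A logspace normal form function for $(G,X)$ is a logspace computable $f:X^*\to X^*$ such that, for some normal form $L$, $f(w)$ is the word of $L$ with $\overline{f(w)}=\overline{w}$ for all $w$. A group has a logspace normal form if such a function exists for some finite symmetric generating set $X\subseteq G$. The restricted wreath product $G\wr H$ is $\bigl(\bigoplus_{h\in H}G\bigr)\rtimes H$, with $H$ permuting the factors by left translation; $G$ is embedded as the factor at $1\in H$. Theorem. (1) Let $f_X$ and $f_Y$ be logspace normal form functions for $G$ and $H$ over finite symmetric generating sets $X$ and $Y$, with $f_X(\lambda)=\lambda$ and $f_Y(\lambda)=\lambda$, and fix a linear order on $Y$. Then the disjoint union $X\sqcup Y$ is a finite symmetric generating set of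 $G\wr H$. For every $w\in (X\sqcup Y)^*$ there is exactly one word $f(w)\in(X\sqcup Y)^*$ that represents the same element of $G\wr H$ as $w$ and has the form $$u_1^{v_1}u_2^{v_2}\cdots u_k^{v_k}\,f_Y(Y(w)),\qquad k\ge 0,$$ where $v_i\in f_Y(Y^*)$, $v_1<\dots<v_k$ in the shortlex order, $u_i\in f_X(X^*)$ and $u_i\ne\lambda$. Here $u^{v}$ denotes the word $v\,u\,v'$ with $v'\in f_Y(Y^*)$ the normal form word of $\overline{v}^{-1}$, and $Y(w)$ is obtained from $w$ by deleting all letters not in $Y$. The function $f$ is a logspace normal form function for $(G\wr H, X\sqcup Y)$. (2) If $G$ and $H$ have logspace normal forms, then so does $G\wr H$. (3) The lamplighter groups $(\mathbb Z/m\mathbb Z)\wr\mathbb Z$, $m\ge 2$, and the group $\mathbb Z\wr\mathbb Z^2$ have logspace normal forms. -/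

import Mathlib

/-! ### Deterministic logspace transducers -/

/-- What the input head can read: a letter of the input word, or one of the two blank squares that
delimit the word. -/
inductive InputSymbol (X : Type*) where
  | leftEnd : InputSymbol X
  | letter (x : X) : InputSymbol X
  | rightEnd : InputSymbol X

/-- Possible motions of a head. -/
inductive HeadMove where
  | left : HeadMove
  | stay : HeadMove
  | right : HeadMove

/-- New position of a head on a one-sided tape with squares `0, 1, 2, …`;
at square `0` the motion `left` has no effect. -/
def HeadMove.apply : HeadMove → ℕ → ℕ
  | .left, p => p - 1
  | .stay, p => p
  | .right, p => p + 1

/-- What a transducer does in one transition: change state, overwrite the scanned work square,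
move the input head and the work head, and append a word to the output. -/
structure TransducerAction (State Work : Type) (Y : Type*) where
  state : State
  write : Work
  inputMove : HeadMove
  workMove : HeadMove
  emit : List Y

/-- A deterministic transducer with a finite state control, a read-only input tape, a read-write
work tape and a write-only output tape.  A transition depends on the state and the two scanned
symbols; the machine halts when `trans` returns `none`. -/
structure Transducer (X Y : Type*) where
  State : Type
  Work : Type
  finiteState : Finite State
  finiteWork : Finite Work
  start : State
  blank : Work
  trans : State → InputSymbol X → Work → Option (TransducerAction State Work Y)

namespace Transducer

variable {X Y : Type*}

/-- A configuration: state, input head position, work tape, work head position, and the word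
written on the output tape so far. -/
structure Config (M : Transducer X Y) where
  state : M.State
  inputPos : ℕ
  work : ℕ → M.Work
  workPos : ℕ
  output : List Y

/-- The content of the input tape holding `w`: the letters of `w` are on the squares
`1, …, w.length`, between two end squares. -/
def inputSymbol (w : List X) : ℕ → InputSymbol X
  | 0 => .leftEnd
  | p + 1 =>
    match w[p]? with
    | some x => .letter x
    | none => .rightEnd

/-- The initial configuration: blank work tape, empty output, both heads on square `0`. -/
def init (M : Transducer X Y) : M.Config where
  state := M.start
  inputPos := 0
  work := fun _ => M.blank
  workPos := 0
  output := []

/-- One transition on the input `w`.  The input head stays within the squares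
`0, …, w.length + 1`. -/
def step (M : Transducer X Y) (w : List X) (c : M.Config) : Option M.Config :=
  (M.trans c.state (inputSymbol w c.inputPos) (c.work c.workPos)).map fun a =>
    { state := a.state
      inputPos := min (a.inputMove.apply c.inputPos) (w.length + 1)
      work := Function.update c.work c.workPos a.write
      workPos := a.workMove.apply c.workPos
      output := c.output ++ a.emit }

/-- The configuration `c` occurs in the computation on input `w`. -/
def Reachable (M : Transducer X Y) (w : List X) (c : M.Config) : Prop :=
  StateTransition.Reaches (M.step w) M.init c

/-- On input `w` the machine halts with output `z`. -/
def Outputs (M : Transducer X Y) (w : List X) (z : List Y) : Prop :=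
  ∃ c, M.Reachable w c ∧ M.step w c = none ∧ c.output = z

/-- On input `w` the machine visits only the first `s` squares of its work tape. -/
def UsesSpace (M : Transducer X Y) (w : List X) (s : ℕ) : Prop :=
  ∀ c, M.Reachable w c → c.workPos < s

end Transducer

/-- `f` is computed by a deterministic transducer that uses at most `c * (⌊log₂ n⌋ + 1)` squares of
its work tape on inputs of length `n` (the `+ 1` only matters for `n ≤ 1`). -/
def LogspaceComputable {X Y : Type*} (f : List X → List Y) : Prop :=
  ∃ (M : Transducer X Y) (c : ℕ), ∀ w : List X,
    M.Outputs w (f w) ∧ M.UsesSpace w (c * (Nat.log 2 w.length + 1))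

/-! ### Normal forms

A generating set is given as an alphabet `X` with a map `π : X → G`; for a subset of `G` this map is
the inclusion. -/

/-- The group element represented by a word. -/
def evalWord {X G : Type*} [Group G] (π : X → G) (w : List X) : G :=
  (w.map π).prod

/-- The letters represent a symmetric generating set of `G`. -/
def IsSymmetricGenerating {X G : Type*} [Group G] (π : X → G) : Prop :=
  (∀ x, ∃ y, π y = (π x)⁻¹) ∧ Subgroup.closure (Set.range π) = ⊤

/-- A set of words in bijection with `G` under evaluation. -/
def IsNormalForm {X G : Type*} [Group G] (π : X → G) (L : Set (List X)) : Prop :=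
  Set.BijOn (evalWord π) L Set.univ

/-- `f` sends each word to the word of some normal form that represents the same element. -/
def IsNormalFormFunction {X G : Type*} [Group G] (π : X → G) (f : List X → List X) : Prop :=
  ∃ L : Set (List X), IsNormalForm π L ∧ ∀ w, f w ∈ L ∧ evalWord π (f w) = evalWord π w

/-- `f` is a logspace normal form function for `G` with respect to the finite symmetric generating
set given by `π`. -/
structure IsLogspaceNormalFormFunction {X G : Type*} [Group G] (π : X → G)
    (f : List X → List X) : Prop where
  finite : Finite X
  generating : IsSymmetricGenerating π
  normalForm : IsNormalFormFunction π f
  logspace : LogspaceComputable f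

/-- `G` has a logspace normal form with respect to some finite symmetric generating set
`X ⊆ G`. -/
def HasLogspaceNormalForm (G : Type*) [Group G] : Prop :=
  ∃ (X : Finset G) (f : List X → List X),
    IsLogspaceNormalFormFunction (Subtype.val : X → G) f

/-! ### Restricted wreath products -/

/-- The restricted wreath product `G ≀ H`: the elements of the unrestricted regular wreath product
whose function `H → G` has finite support. -/
def RestrictedWreathProduct (G H : Type*) [Group G] [Group H] :
    Subgroup (RegularWreathProduct G H) where
  carrier := {a | (Function.mulSupport a.left).Finite}
  one_mem' := by simp [Function.mulSupport]
  mul_mem' := by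
    intro a b ha hb
    have hb' : (Function.mulSupport fun x => b.left (a.right⁻¹ * x)).Finite :=
      Set.Finite.preimage (f := fun x => a.right⁻¹ * x) (mul_right_injective a.right⁻¹).injOn hb
    exact (ha.union hb').subset (Function.mulSupport_mul _ _)
  inv_mem' := by
    intro a ha
    have h : (Function.mulSupport fun x => a.left (a.right * x)).Finite :=
      Set.Finite.preimage (f := fun x => a.right * x) (mul_right_injective a.right).injOn ha
    refine h.subset fun x hx hx' => hx ?_
    simpa using hx'

namespace RestrictedWreathProduct

variable {X Y G H : Type*} [Group G] [Group H]

open Classical in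
/-- The copy of `g : G` at the position `1 : H`. -/
noncomputable def base (g : G) : RestrictedWreathProduct G H :=
  ⟨⟨Pi.mulSingle 1 g, 1⟩, (Set.finite_singleton (1 : H)).subset Pi.mulSupport_mulSingle_subset⟩

/-- The copy of `h : H` in `G ≀ H`. -/
def top (h : H) : RestrictedWreathProduct G H :=
  ⟨⟨1, h⟩, (RestrictedWreathProduct G H).one_mem⟩

/-- The letters of the disjoint union of `X` and `Y` as elements of `G ≀ H`. -/
noncomputable def letters (π : X → G) (ρ : Y → H) : X ⊕ Y → RestrictedWreathProduct G H :=
  Sum.elim (fun x => base (π x)) (fun y => top (ρ y))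

/-- A block `u ^ v`, that is, the word `v u v'` where `v'` is the normal form of the inverse
of `v`. -/
structure Block (X Y : Type*) where
  v : List Y
  u : List X
  v' : List Y

/-- The word `v u v'` over the disjoint union of the alphabets. -/
def Block.word (b : Block X Y) : List (X ⊕ Y) :=
  b.v.map Sum.inr ++ b.u.map Sum.inl ++ b.v'.map Sum.inr

/-- `v` is a normal form word over `Y`, `u` is a non-empty normal form word over `X`, and `v'` is
the normal form word over `Y` of the inverse of `v`. -/
structure Block.IsNormal (ρ : Y → H) (fX : List X → List X) (fY : List Y → List Y)
    (b : Block X Y) : Prop where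
  v_mem : b.v ∈ Set.range fY
  u_mem : b.u ∈ Set.range fX
  u_ne : b.u ≠ []
  v'_mem : b.v' ∈ Set.range fY
  v'_inv : evalWord ρ b.v' = (evalWord ρ b.v)⁻¹

/-- The word `z` has the shape `u₁ ^ v₁ ⋯ uₖ ^ vₖ f_Y(Y(w))`, where all `uᵢ`, `vᵢ` are normal form
words, no `uᵢ` is empty, and `v₁ < ⋯ < vₖ` in the shortlex order. Here `Y(w)` is obtained from `w`
by deleting all letters that are not in `Y`. -/
def HasShape [LinearOrder Y] (ρ : Y → H) (fX : List X → List X) (fY : List Y → List Y)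
    (w z : List (X ⊕ Y)) : Prop :=
  ∃ l : List (Block X Y), (∀ b ∈ l, b.IsNormal ρ fX fY) ∧
    (l.map Block.v).Pairwise (List.Shortlex (· < ·)) ∧
    z = l.flatMap Block.word ++ (fY (w.filterMap Sum.getRight?)).map Sum.inr

end RestrictedWreathProduct

/-!
The word `f w` lists the support of the function `H → G` represented by `w`. The letters of `w` are
read from left to right; a letter `x : X` multiplies the value at `h` from the right by `x`, where
`h` is the element of `H` represented by the letters in `Y` read before. Hence the value at `h` is
represented by the subword `lampWord` of those letters of `X` that occur at `h`, and only the
elements `h` represented by the `Y`-part of a prefix of `w` can be in the support. For each of them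
the first such prefix is kept if the value there is not trivial, and it gives the block
`f_X(lampWord) ^ v`, where `v` is the normal form of the `Y`-part of the prefix. The number of
blocks with a smaller `v` (`rank`) sorts the blocks without any memory for a list of them. A word of
the required shape is unique, because its blocks correspond to the elements of the support
(`blocks_unique`).

For the space bound no machine is written down for this function. The class `LS` consists of the
number functions of a word `w` and of finitely many number variables that are computed by programs
with finitely many counters, the values of the counters being polynomially bounded in the length of
`w`. A transducer keeps such counters in binary on its work tape, in space `O(log n)`, and compares,
copies and increments them by sweeps over the tape (`Control.exists_realizes`,
`LogspaceComputable.of_exec`). The class is closed under substitution and bounded primitive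
recursion (`LS.comp`, `LS.primrec`), hence contains the arithmetic functions and is closed under
bounded sums and quantifiers.

A word-valued function is given by its length and by the tests for a letter at a given place
(`LSList`). Such functions are logspace computable (`LSList.logspaceComputable`), since the letters
can be computed and written one after the other. Conversely a logspace computable function may be
applied to a word given in this way (`LogspaceComputable.comp_LSList`): the configurations of the
transducer are coded by polynomially bounded numbers, the transition function acts on the codes by
arithmetic, and the number of transitions is bounded by the number of codes; so the run is a bounded
primitive recursion and the output is the concatenation of the emitted words. As the word that is
fed to the transducer is never stored, this includes the usual composition of logspace functions.

For the closure under wreath products the normal form function of `G` is first changed so that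
`λ` is a normal form, which only needs a comparison with the normal form of `λ`. For the examples it
remains to treat cyclic groups, by counting letters, and the product `ℤ × ℤ`.
-/

/-! ### Controls over a work tape that holds binary counters -/

/-- The content of a work square: blank, the marker on square `0`, or one binary digit of each of
`k` registers. -/
abbrev Cell (k : ℕ) : Type := Option (Option (Fin k → Bool))

/-- The finite control of a transducer whose work tape holds `k` binary registers. -/
structure Control (k : ℕ) (X Y : Type*) where
  State : Type
  finite : Finite State
  start : State
  trans : State → InputSymbol X → Cell k → Option (TransducerAction State (Cell k) Y)

namespace Control

variable {k : ℕ} {X Y : Type*}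

/-- The transducer with the given control; the marker on square `0` is not yet written. -/
@[reducible] def toTransducer (A : Control k X Y) : Transducer X Y where
  State := A.State
  Work := Cell k
  finiteState := A.finite
  finiteWork := inferInstance
  start := A.start
  blank := none
  trans := A.trans

/-- A single transition that starts within the first `S` work squares. -/
def Step (A : Control k X Y) (w : List X) (S : ℕ) (c c' : A.toTransducer.Config) : Prop :=
  c.workPos < S ∧ A.toTransducer.step w c = some c'

/-- The computation leads from `c` to `c'`, all configurations before `c'` having their head within
the first `S` work squares. -/
def Leads (A : Control k X Y) (w : List X) (S : ℕ) (c c' : A.toTransducer.Config) : Prop :=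
  Relation.ReflTransGen (A.Step w S) c c'

theorem Leads.trans {A : Control k X Y} {w : List X} {S : ℕ} {c₁ c₂ c₃ : A.toTransducer.Config}
    (h : A.Leads w S c₁ c₂) (h' : A.Leads w S c₂ c₃) : A.Leads w S c₁ c₃ :=
  Relation.ReflTransGen.trans h h'

theorem Leads.of_step {A : Control k X Y} {w : List X} {S : ℕ} {c c' : A.toTransducer.Config}
    (hS : c.workPos < S) (t : TransducerAction A.State (Cell k) Y)
    (ht : A.trans c.state (Transducer.inputSymbol w c.inputPos) (c.work c.workPos) = some t)
    (hc : c' = { state := t.state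
                 inputPos := min (t.inputMove.apply c.inputPos) (w.length + 1)
                 work := Function.update c.work c.workPos t.write
                 workPos := t.workMove.apply c.workPos
                 output := c.output ++ t.emit }) : A.Leads w S c c' := by
  refine Relation.ReflTransGen.single ⟨hS, ?_⟩
  subst hc
  simp only [Transducer.step, ht, Option.map_some]

/-- The control that runs `A` and `B`, where a halt of `A` in state `q` is replaced by a jump to
`nA q`, if defined, and likewise for `B`. -/
def link (A B : Control k X Y) (nA : A.State → Option (A.State ⊕ B.State))
    (nB : B.State → Option (A.State ⊕ B.State)) : Control k X Y where
  State := A.State ⊕ B.State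
  finite := by
    have := A.finite
    have := B.finite
    infer_instance
  start := .inl A.start
  trans
    | .inl q, s, a =>
      match A.trans q s a with
      | some t => some ⟨.inl t.state, t.write, t.inputMove, t.workMove, t.emit⟩
      | none => (nA q).map fun q' => ⟨q', a, .stay, .stay, []⟩
    | .inr q, s, a =>
      match B.trans q s a with
      | some t => some ⟨.inr t.state, t.write, t.inputMove, t.workMove, t.emit⟩
      | none => (nB q).map fun q' => ⟨q', a, .stay, .stay, []⟩

variable {A B : Control k X Y} {nA : A.State → Option (A.State ⊕ B.State)}
  {nB : B.State → Option (A.State ⊕ B.State)} {w : List X} {S : ℕ}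

theorem Leads.link_inl {c c' : A.toTransducer.Config} (h : A.Leads w S c c') :
    (link A B nA nB).Leads w S ⟨.inl c.state, c.inputPos, c.work, c.workPos, c.output⟩
      ⟨.inl c'.state, c'.inputPos, c'.work, c'.workPos, c'.output⟩ := by
  refine Relation.ReflTransGen.lift (p := (link A B nA nB).Step w S)
    (fun c : A.toTransducer.Config =>
      (⟨.inl c.state, c.inputPos, c.work, c.workPos, c.output⟩ :
        (link A B nA nB).toTransducer.Config)) ?_ _ _ h
  rintro a b ⟨h1, h2⟩
  refine ⟨h1, ?_⟩
  simp only [Transducer.step, Option.map_eq_some_iff] at h2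
  obtain ⟨t, ht, rfl⟩ := h2
  simp only [Transducer.step, link, ht, Option.map_some]

theorem Leads.link_inr {c c' : B.toTransducer.Config} (h : B.Leads w S c c') :
    (link A B nA nB).Leads w S ⟨.inr c.state, c.inputPos, c.work, c.workPos, c.output⟩
      ⟨.inr c'.state, c'.inputPos, c'.work, c'.workPos, c'.output⟩ := by
  refine Relation.ReflTransGen.lift (p := (link A B nA nB).Step w S)
    (fun c : B.toTransducer.Config =>
      (⟨.inr c.state, c.inputPos, c.work, c.workPos, c.output⟩ :
        (link A B nA nB).toTransducer.Config)) ?_ _ _ h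
  rintro a b ⟨h1, h2⟩
  refine ⟨h1, ?_⟩
  simp only [Transducer.step, Option.map_eq_some_iff] at h2
  obtain ⟨t, ht, rfl⟩ := h2
  simp only [Transducer.step, link, ht, Option.map_some]

theorem Leads.link_jump {q q' : A.State ⊕ B.State} {h p : ℕ} {T : ℕ → Cell k} {o : List Y}
    (hp : p < S) (hh : h ≤ w.length + 1)
    (hq : (∃ a, q = .inl a ∧ A.trans a (Transducer.inputSymbol w h) (T p) = none ∧
        nA a = some q') ∨
      (∃ b, q = .inr b ∧ B.trans b (Transducer.inputSymbol w h) (T p) = none ∧ nB b = some q')) :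
    (link A B nA nB).Leads w S ⟨q, h, T, p, o⟩ ⟨q', h, T, p, o⟩ := by
  refine Leads.of_step hp ⟨q', T p, .stay, .stay, []⟩ ?_ ?_
  · rcases hq with ⟨a, rfl, h1, h2⟩ | ⟨a, rfl, h1, h2⟩ <;> simp [link, h1, h2]
  · simp [HeadMove.apply, hh]

/-! ### Sweeps over the work tape -/

/-- The work tape with marker on square `0` and the digit vectors `d 0, …, d (L - 1)` on the
squares `1, …, L`. -/
def tape (L : ℕ) (d : ℕ → Fin k → Bool) : ℕ → Cell k
  | 0 => some none
  | i + 1 => if i < L then some (some (d i)) else none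

/-- The control that goes once over the digits from the lowest to the highest, rewriting them by
the finite automaton `δ`, possibly adds a digit vector at the high end, and goes back to
square `0`.  It halts in state `(true, a)`, where `a` is the last state of `δ`. -/
def sweep {a : Type} [Finite a] (a₀ : a) (δ : a → (Fin k → Bool) → a × (Fin k → Bool))
    (ext : a → Option (Fin k → Bool)) : Control k X Y where
  State := Bool × a
  finite := inferInstance
  start := (false, a₀)
  trans
    | (false, q), _, some none => some ⟨(false, q), some none, .stay, .right, []⟩
    | (false, q), _, some (some v) =>
      some ⟨(false, (δ q v).1), some (some (δ q v).2), .stay, .right, []⟩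
    | (false, q), _, none => some ⟨(true, q), (ext q).map some, .stay, .left, []⟩
    | (true, q), _, some (some v) => some ⟨(true, q), some (some v), .stay, .left, []⟩
    | (true, _), _, none => none
    | (true, _), _, some none => none

section

variable {a : Type} [Finite a] (a₀ : a) (δ : a → (Fin k → Bool) → a × (Fin k → Bool))
    (ext : a → Option (Fin k → Bool))

/-- The state of the automaton `δ` after reading the lowest `i` digits. -/
def sweepState (d : ℕ → Fin k → Bool) : ℕ → a
  | 0 => a₀
  | i + 1 => (δ (sweepState d i) (d i)).1

/-- The digit vectors written by the automaton `δ`. -/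
def sweepOut (d : ℕ → Fin k → Bool) (i : ℕ) : Fin k → Bool :=
  (δ (sweepState a₀ δ d i) (d i)).2

theorem sweep_back {h L : ℕ} (d : ℕ → Fin k → Bool) (q : a) (o : List Y) (hh : h ≤ w.length + 1)
    (i : ℕ) (hi : i ≤ L) (hS : L < S) :
    (sweep (X := X) (Y := Y) a₀ δ ext).Leads w S ⟨(true, q), h, tape L d, i, o⟩
      ⟨(true, q), h, tape L d, 0, o⟩ := by
  induction i with
  | zero => exact Relation.ReflTransGen.refl
  | succ i ih =>
    refine Leads.trans (Leads.of_step (by simp; omega)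
      ⟨(true, q), some (some (d i)), .stay, .left, []⟩ ?_ ?_) (ih (by omega))
    · simp [sweep, tape, show i < L by omega]
    · have : (some (some (d i)) : Cell k) = tape L d (i + 1) := by
        simp [tape, show i < L by omega]
      simp [HeadMove.apply, hh, this]

theorem sweep_forward {h L : ℕ} (d : ℕ → Fin k → Bool) (o : List Y) (hh : h ≤ w.length + 1)
    (i : ℕ) (hi : i ≤ L) (hS : L + 1 < S) :
    (sweep (X := X) (Y := Y) a₀ δ ext).Leads w S ⟨(false, a₀), h, tape L d, 0, o⟩
      ⟨(false, sweepState a₀ δ d i), h,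
        tape L (fun j => if j < i then sweepOut a₀ δ d j else d j), i + 1, o⟩ := by
  induction i with
  | zero =>
    refine Leads.of_step (by simp; omega) ⟨(false, a₀), some none, .stay, .right, []⟩ ?_ ?_
    · simp [sweep, tape]
    · have : (some none : Cell k) = tape L d 0 := rfl
      simp [HeadMove.apply, hh, this, sweepState]
  | succ i ih =>
    refine (ih (by omega)).trans (Leads.of_step (by simp; omega)
      ⟨(false, sweepState a₀ δ d (i + 1)), some (some (sweepOut a₀ δ d i)), .stay, .right, []⟩
      ?_ ?_)
    · simp [sweep, tape, show i < L by omega, sweepOut, sweepState]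
    · simp only [HeadMove.apply, hh, inf_of_le_left, List.append_nil]
      congr 1
      funext j
      rcases j with _ | j
      · simp [tape]
      · by_cases hj : j = i
        · subst hj; simp [tape, show j < L by omega]
        · rw [Function.update_of_ne (by simpa using hj)]
          simp only [tape, show j < i + 1 ↔ j < i by omega]

/-- The sweep leaves the new digits on the tape; the number of digits grows by one if `ext` asks
for it. -/
theorem sweep_spec {h L : ℕ} (d d' : ℕ → Fin k → Bool) (L' : ℕ) (o : List Y)
    (hh : h ≤ w.length + 1) (hS : L + 1 < S) (hS' : L' < S)
    (hd : ∀ i < L, d' i = sweepOut a₀ δ d i)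
    (hL : (ext (sweepState a₀ δ d L) = none ∧ L' = L) ∨
      (ext (sweepState a₀ δ d L) = some (d' L) ∧ L' = L + 1)) :
    (sweep (X := X) (Y := Y) a₀ δ ext).Leads w S ⟨(false, a₀), h, tape L d, 0, o⟩
      ⟨(true, sweepState a₀ δ d L), h, tape L' d', 0, o⟩ := by
  refine (sweep_forward a₀ δ ext d o hh L le_rfl hS).trans ?_
  refine Leads.trans ?_ (sweep_back a₀ δ ext d' (sweepState a₀ δ d L) o hh L
    (by rcases hL with h | h <;> omega) hS')
  refine Leads.of_step (by simp; omega)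
    ⟨(true, sweepState a₀ δ d L), (ext (sweepState a₀ δ d L)).map some, .stay, .left, []⟩ ?_ ?_
  · simp [sweep, tape]
  · simp only [HeadMove.apply, hh, inf_of_le_left, List.append_nil, Nat.add_sub_cancel]
    congr 1
    funext j
    rcases j with _ | j
    · simp [tape]
    · by_cases hj : j = L
      · subst hj
        rcases hL with ⟨h1, rfl⟩ | ⟨h1, rfl⟩ <;> simp [tape, h1]
      · rw [Function.update_of_ne (by simpa using hj)]
        by_cases hj' : j < L
        · have : j < L' := by rcases hL with h | h <;> omega
          simp [tape, hj', this, hd j hj']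
        · have : ¬ j < L' := by rcases hL with h | h <;> omega
          simp [tape, hj', this]

end

end Control

/-! ### Programs with bounded counters -/

/-- Conditions of a program: two registers agree, or the input symbol under the head has a given
property. -/
inductive Cond (X : Type*) where
  | eq (r s : ℕ) : Cond X
  | sym (P : InputSymbol X → Bool) : Cond X

/-- Programs acting on registers numbered by `ℕ` and on one input head. -/
inductive Prog (X : Type*) where
  | skip : Prog X
  | zero (r : ℕ) : Prog X
  | inc (r : ℕ) : Prog X
  | copy (r s : ℕ) : Prog X
  | left : Prog X
  | right : Prog X
  | emit (c : ℕ) : Prog X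
  | seq (p q : Prog X) : Prog X
  | ite (c : Cond X) (p q : Prog X) : Prog X
  | whileNot (c : Cond X) (p : Prog X) : Prog X

/-- The condition holds for the input `w`, the register values `σ` and the head position `h`. -/
def Cond.Holds {X : Type*} (w : List X) (σ : ℕ → ℕ) (h : ℕ) : Cond X → Prop
  | .eq r s => σ r = σ s
  | .sym P => P (Transducer.inputSymbol w h) = true

/-- Big-step semantics: on input `w` the program leads from register values `σ` and head position
`h` to register values `σ'` and head position `h'`, emits the codes `out`, and never increments a
register beyond `B`. -/
inductive Exec {X : Type*} (w : List X) (B : ℕ) :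
    Prog X → (ℕ → ℕ) → ℕ → (ℕ → ℕ) → ℕ → List ℕ → Prop where
  | skip {σ h} : Exec w B .skip σ h σ h []
  | zero {σ h r} : Exec w B (.zero r) σ h (Function.update σ r 0) h []
  | inc {σ h r} : σ r + 1 ≤ B → Exec w B (.inc r) σ h (Function.update σ r (σ r + 1)) h []
  | copy {σ h r s} : Exec w B (.copy r s) σ h (Function.update σ s (σ r)) h []
  | left {σ h} : Exec w B .left σ h σ (h - 1) []
  | right {σ h} : Exec w B .right σ h σ (min (h + 1) (w.length + 1)) []
  | emit {σ h c} : Exec w B (.emit c) σ h σ h [c]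
  | seq {p q σ h σ₁ h₁ o₁ σ₂ h₂ o₂} : Exec w B p σ h σ₁ h₁ o₁ → Exec w B q σ₁ h₁ σ₂ h₂ o₂ →
      Exec w B (.seq p q) σ h σ₂ h₂ (o₁ ++ o₂)
  | iteTrue {c p q σ h σ' h' o} : c.Holds w σ h → Exec w B p σ h σ' h' o →
      Exec w B (.ite c p q) σ h σ' h' o
  | iteFalse {c p q σ h σ' h' o} : ¬ c.Holds w σ h → Exec w B q σ h σ' h' o →
      Exec w B (.ite c p q) σ h σ' h' o
  | whileDone {c p σ h} : c.Holds w σ h → Exec w B (.whileNot c p) σ h σ h []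
  | whileStep {c p σ h σ₁ h₁ o₁ σ₂ h₂ o₂} : ¬ c.Holds w σ h → Exec w B p σ h σ₁ h₁ o₁ →
      Exec w B (.whileNot c p) σ₁ h₁ σ₂ h₂ o₂ → Exec w B (.whileNot c p) σ h σ₂ h₂ (o₁ ++ o₂)

theorem Exec.mono {X : Type*} {w : List X} {B B' : ℕ} (hB : B ≤ B') {p : Prog X} {σ σ' : ℕ → ℕ}
    {h h' : ℕ} {o : List ℕ} (hE : Exec w B p σ h σ' h' o) : Exec w B' p σ h σ' h' o := by
  induction hE with
  | skip => exact .skip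
  | zero => exact .zero
  | inc h => exact .inc (h.trans hB)
  | copy => exact .copy
  | left => exact .left
  | right => exact .right
  | emit => exact .emit
  | seq _ _ h1 h2 => exact .seq h1 h2
  | iteTrue h _ h1 => exact .iteTrue h h1
  | iteFalse h _ h1 => exact .iteFalse h h1
  | whileDone h => exact .whileDone h
  | whileStep h _ _ h1 h2 => exact .whileStep h h1 h2

/-! ### Compilation of programs -/

namespace Control

variable {k : ℕ} {X Y : Type*}

/-- The binary digits of the first `k` registers. -/
def digits (σ : ℕ → ℕ) (i : ℕ) (r : Fin k) : Bool := (σ r).testBit i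

/-- The register values are at most `B` and have at most `L` binary digits, and `L` digits are not
more than numbers up to `B` need. -/
def Fits (B L : ℕ) (σ : ℕ → ℕ) : Prop :=
  L ≤ Nat.log 2 B + 1 ∧ ∀ r, σ r ≤ B ∧ σ r < 2 ^ L

/-- The control carries out the program, on work tapes that hold the binary registers, and halts
with its work head on square `0`; a code `c` is emitted as the word `dec c`. -/
def Realizes (dec : ℕ → List Y) (A : Control k X Y) (p : Prog X) : Prop :=
  ∀ (w : List X) (B : ℕ) (σ : ℕ → ℕ) (h : ℕ) (σ' : ℕ → ℕ) (h' : ℕ) (out : List ℕ),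
    Exec w B p σ h σ' h' out → h ≤ w.length + 1 → ∀ L, Fits B L σ →
    ∃ L' q, Fits B L' σ' ∧ h' ≤ w.length + 1 ∧
      A.trans q (Transducer.inputSymbol w h') (some none) = none ∧
      ∀ o, A.Leads w (Nat.log 2 B + 3) ⟨A.start, h, tape L (digits σ), 0, o⟩
        ⟨q, h', tape L' (digits σ'), 0, o ++ out.flatMap dec⟩

/-- The control evaluates the condition: it restores the configuration and halts in a state `q`
for which `res q` tells whether the condition holds. -/
def Tests (A : Control k X Y) (res : A.State → Bool) (c : Cond X) : Prop :=
  ∀ (w : List X) (B : ℕ) (σ : ℕ → ℕ) (h : ℕ), h ≤ w.length + 1 → ∀ L, Fits B L σ →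
    ∃ q, A.trans q (Transducer.inputSymbol w h) (some none) = none ∧
      (res q = true ↔ c.Holds w σ h) ∧
      ∀ o, A.Leads w (Nat.log 2 B + 3) ⟨A.start, h, tape L (digits σ), 0, o⟩
        ⟨q, h, tape L (digits σ), 0, o⟩

/-- The control that makes a single transition on square `0`. -/
def single (m : HeadMove) (e : List Y) : Control k X Y where
  State := Bool
  finite := inferInstance
  start := false
  trans
    | false, _, a => some ⟨true, a, m, .stay, e⟩
    | true, _, _ => none

/-- A program without effect on the registers is carried out by a single transition. -/
theorem realizes_single {dec : ℕ → List Y} {p : Prog X} (m : HeadMove) (c : List ℕ)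
    (hp : ∀ w B σ h σ' h' out, Exec w B p σ h σ' h' out → h ≤ w.length + 1 →
      σ' = σ ∧ h' = min (m.apply h) (w.length + 1) ∧ out = c) :
    Realizes (k := k) dec (single m (c.flatMap dec)) p := by
  intro w B σ h σ' h' out hE hh L hL
  obtain ⟨rfl, rfl, rfl⟩ := hp _ _ _ _ _ _ _ hE hh
  refine ⟨L, true, hL, min_le_right _ _, rfl, fun o => ?_⟩
  refine Leads.of_step (by simp) ⟨true, some none, m, .stay, out.flatMap dec⟩ rfl ?_
  have : (some none : Cell k) = tape L (digits σ') 0 := rfl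
  simp only [HeadMove.apply, this, Function.update_eq_self]

theorem realizes_zero (dec : ℕ → List Y) (r : Fin k) :
    Realizes dec (sweep (X := X) () (fun _ v => ((), Function.update v r false)) (fun _ => none))
      (.zero r) := by
  intro w B σ h σ' h' out hE hh L hL
  cases hE
  obtain ⟨hL1, hL2⟩ := hL
  refine ⟨L, (true, ()), ⟨hL1, fun s => ?_⟩, hh, rfl, fun o => ?_⟩
  · by_cases hs : s = r
    · subst hs; simp
    · simpa [Function.update_of_ne hs] using hL2 s
  · simp only [List.flatMap_nil, List.append_nil]
    refine sweep_spec () _ _ (digits σ) _ L o hh (by omega) (by omega) ?_ (Or.inl ⟨rfl, rfl⟩)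
    intro i _
    funext s
    by_cases hs : s = r
    · subst hs; simp [sweepOut, digits]
    · have : (s : ℕ) ≠ r := fun h => hs (Fin.ext h)
      simp [sweepOut, digits, Function.update_of_ne hs, Function.update_of_ne this]

theorem realizes_copy (dec : ℕ → List Y) (r s : Fin k) :
    Realizes dec (sweep (X := X) () (fun _ v => ((), Function.update v s (v r))) (fun _ => none))
      (.copy r s) := by
  intro w B σ h σ' h' out hE hh L hL
  cases hE
  obtain ⟨hL1, hL2⟩ := hL
  refine ⟨L, (true, ()), ⟨hL1, fun t => ?_⟩, hh, rfl, fun o => ?_⟩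
  · by_cases hs : t = s
    · subst hs; simpa using hL2 r
    · simpa [Function.update_of_ne hs] using hL2 t
  · simp only [List.flatMap_nil, List.append_nil]
    refine sweep_spec () _ _ (digits σ) _ L o hh (by omega) (by omega) ?_ (Or.inl ⟨rfl, rfl⟩)
    intro i _
    funext t
    by_cases hs : t = s
    · subst hs; simp [sweepOut, digits]
    · have : (t : ℕ) ≠ s := fun h => hs (Fin.ext h)
      simp [sweepOut, digits, Function.update_of_ne hs, Function.update_of_ne this]

/-- In binary, adding `1` flips the digit `i` exactly if all lower digits are `1`. -/
theorem testBit_succ_eq_xor (n i : ℕ) :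
    (n + 1).testBit i = (decide (∀ j < i, n.testBit j = true) ^^ n.testBit i) := by
  induction i generalizing n with
  | zero =>
    simp only [Nat.testBit_zero, not_lt_zero, false_imp_iff, implies_true, decide_true]
    rcases Nat.mod_two_eq_zero_or_one n with h | h <;> simp [Nat.add_mod, h]
  | succ i ih =>
    rw [Nat.testBit_succ, Nat.testBit_succ]
    rcases Nat.mod_two_eq_zero_or_one n with h | h
    · have h1 : (n + 1) / 2 = n / 2 := by omega
      have h2 : ¬ ∀ j < i + 1, n.testBit j = true := by
        intro h'
        have := h' 0 (by omega)
        simp [Nat.testBit_zero, h] at this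
      rw [h1, decide_eq_false h2, Bool.false_xor]
    · have h1 : (n + 1) / 2 = n / 2 + 1 := by omega
      rw [h1, ih]
      congr 2
      refine propext ⟨fun h' j hj => ?_, fun h' j hj => ?_⟩
      · rcases j with _ | j
        · simp [Nat.testBit_zero, h]
        · rw [Nat.testBit_succ]; exact h' j (by omega)
      · rw [← Nat.testBit_succ]; exact h' (j + 1) (by omega)

theorem all_testBit_iff {n L : ℕ} (h : n < 2 ^ L) :
    (∀ j < L, n.testBit j = true) ↔ n + 1 = 2 ^ L := by
  constructor
  · intro h'
    have : n = 2 ^ L - 1 := by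
      refine Nat.eq_of_testBit_eq fun i => ?_
      rw [Nat.testBit_two_pow_sub_one]
      by_cases hi : i < L
      · simp [hi, h' i hi]
      · simpa [hi] using Nat.testBit_lt_two_pow (h.trans_le (Nat.pow_le_pow_right (by omega)
          (not_lt.1 hi)))
    omega
  · intro h' j hj
    have : n = 2 ^ L - 1 := by omega
    rw [this, Nat.testBit_two_pow_sub_one]
    simpa using hj

/-- The state of the sweep is the carry; a carry left at the end becomes a new highest digit. -/
theorem realizes_inc (dec : ℕ → List Y) (r : Fin k) :
    Realizes dec (sweep (X := X) true (fun b v => (b && v r, Function.update v r (b ^^ v r)))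
      (fun b => if b then some (fun s => decide (s = r)) else none)) (.inc r) := by
  intro w B σ h σ' h' out hE hh L hL
  cases hE
  rename_i hB
  obtain ⟨hL1, hL2⟩ := hL
  set δ : Bool → (Fin k → Bool) → Bool × (Fin k → Bool) :=
    fun b v => (b && v r, Function.update v r (b ^^ v r)) with hδ
  have hcarry : ∀ i, sweepState true δ (digits σ) i =
      decide (∀ j < i, (σ r).testBit j = true) := by
    intro i
    induction i with
    | zero => simp [sweepState]
    | succ i ih =>
      rw [sweepState, ih]
      rw [Bool.eq_iff_iff]
      simp only [hδ, digits, Bool.and_eq_true, decide_eq_true_eq, Nat.forall_lt_succ_right]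
  have hcarry' := hcarry L
  simp only [all_testBit_iff (hL2 r).2] at hcarry'
  have hdig : ∀ i, digits (k := k) (Function.update σ r (σ r + 1)) i =
      sweepOut true δ (digits σ) i := by
    intro i
    funext t
    by_cases hs : t = r
    · subst hs
      rw [sweepOut, hcarry]
      simp only [digits, Function.update_self, testBit_succ_eq_xor, hδ]
    · have : (t : ℕ) ≠ r := fun h => hs (Fin.ext h)
      simp [sweepOut, digits, Function.update_of_ne this, Function.update_of_ne hs, hδ]
  -- The carry survives all digits exactly if they all are `1`.
  by_cases hov : σ r + 1 = 2 ^ L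
  · have hL3 : L + 1 ≤ Nat.log 2 B + 1 := by
      have := (Nat.le_log_iff_pow_le (b := 2) (by norm_num) (by omega)).2 (hov ▸ hB)
      omega
    refine ⟨L + 1, (true, sweepState true δ (digits σ) L), ⟨hL3, fun t => ?_⟩, hh, rfl,
      fun o => ?_⟩
    · by_cases hs : t = r
      · subst hs; simp only [Function.update_self, pow_succ]; omega
      · have := hL2 t
        rw [Function.update_of_ne hs, pow_succ]; omega
    · simp only [List.flatMap_nil, List.append_nil]
      refine sweep_spec true δ _ (digits σ) _ (L + 1) o hh (by omega) (by omega)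
        (fun i _ => hdig i) (Or.inr ⟨?_, rfl⟩)
      rw [hcarry']
      simp only [hov, decide_true, if_true, Option.some.injEq]
      funext t
      by_cases hs : t = r
      · subst hs; simp [digits, Nat.testBit_two_pow_self]
      · have : (t : ℕ) ≠ r := fun h => hs (Fin.ext h)
        simp [digits, Function.update_of_ne this, hs, Nat.testBit_lt_two_pow (hL2 t).2]
  · refine ⟨L, (true, sweepState true δ (digits σ) L), ⟨hL1, fun t => ?_⟩, hh, rfl,
      fun o => ?_⟩
    · by_cases hs : t = r
      · have := hL2 r
        subst hs; simp only [Function.update_self]; omega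
      · have := hL2 t
        rw [Function.update_of_ne hs]; omega
    · simp only [List.flatMap_nil, List.append_nil]
      refine sweep_spec true δ _ (digits σ) _ L o hh (by omega) (by omega)
        (fun i _ => hdig i) (Or.inl ⟨?_, rfl⟩)
      rw [hcarry']
      simp [hov]

/-- The state of the sweep tells whether the digits read so far agree. -/
theorem tests_eq (r s : Fin k) :
    Tests (sweep (X := X) (Y := Y) true (fun b v => (b && (v r == v s), v)) (fun _ => none))
      (fun q => q.2) (.eq r s) := by
  intro w B σ h hh L hL
  obtain ⟨hL1, hL2⟩ := hL
  set δ : Bool → (Fin k → Bool) → Bool × (Fin k → Bool) :=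
    fun b v => (b && (v r == v s), v) with hδ
  have hstate : ∀ i, sweepState true δ (digits σ) i =
      decide (∀ j < i, (σ r).testBit j = (σ s).testBit j) := by
    intro i
    induction i with
    | zero => simp [sweepState]
    | succ i ih =>
      rw [sweepState, ih]
      rw [Bool.eq_iff_iff]
      simp only [hδ, digits, Bool.and_eq_true, decide_eq_true_eq, beq_iff_eq,
        Nat.forall_lt_succ_right]
  refine ⟨(true, sweepState true δ (digits σ) L), rfl, ?_, fun o => ?_⟩
  · rw [hstate L, decide_eq_true_eq]
    refine ⟨fun h' => Nat.eq_of_testBit_eq fun i => ?_, fun h' j _ => by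
      rw [show σ r = σ s from h']⟩
    by_cases hi : i < L
    · exact h' i hi
    · have h2 : 2 ^ L ≤ 2 ^ i := Nat.pow_le_pow_right (by omega) (not_lt.1 hi)
      rw [Nat.testBit_lt_two_pow ((hL2 r).2.trans_le h2),
        Nat.testBit_lt_two_pow ((hL2 s).2.trans_le h2)]
  · exact sweep_spec true δ _ (digits σ) _ L o hh (by omega) (by omega) (fun i _ => rfl)
      (Or.inl ⟨rfl, rfl⟩)

/-- The control that records whether the current input symbol has the property `P`. -/
def testSym (P : InputSymbol X → Bool) : Control k X Y where
  State := Option Bool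
  finite := inferInstance
  start := none
  trans
    | none, s, a => some ⟨some (P s), a, .stay, .stay, []⟩
    | some _, _, _ => none

theorem tests_sym (P : InputSymbol X → Bool) :
    Tests (testSym (k := k) (Y := Y) P) (fun q : Option Bool => q == some true) (.sym P) := by
  intro w B σ h hh L hL
  refine ⟨some (P (Transducer.inputSymbol w h)), rfl, by simp [Cond.Holds], fun o => ?_⟩
  refine Leads.of_step (by simp) ⟨some (P (Transducer.inputSymbol w h)), some none, .stay, .stay,
    []⟩ rfl ?_
  have : (some none : Cell k) = tape L (digits σ) 0 := rfl
  simp [HeadMove.apply, this, hh]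

theorem Realizes.seq {dec : ℕ → List Y} {A B : Control k X Y} {p q : Prog X}
    (hA : Realizes dec A p) (hB : Realizes dec B q) :
    Realizes dec (link A B (fun _ => some (.inr B.start)) (fun _ => none)) (.seq p q) := by
  intro w n σ h σ' h' out hE hh L hL
  cases hE with | seq h1 h2 => ?_
  rename_i σ₁ h₁ o₁ o₂
  obtain ⟨L1, q1, hL1, hh1, ht1, hc1⟩ := hA _ _ _ _ _ _ _ h1 hh _ hL
  obtain ⟨L2, q2, hL2, hh2, ht2, hc2⟩ := hB _ _ _ _ _ _ _ h2 hh1 _ hL1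
  refine ⟨L2, .inr q2, hL2, hh2, by simp [link, ht2], fun o => ?_⟩
  refine (hc1 o).link_inl.trans (Leads.trans (Leads.link_jump (Nat.succ_pos _) hh1
    (Or.inl ⟨q1, rfl, ht1, rfl⟩)) ?_)
  have := (hc2 (o ++ List.flatMap dec o₁)).link_inr (A := A)
    (nA := fun _ => some (.inr B.start)) (nB := fun _ => none)
  rw [List.flatMap_append, ← List.append_assoc]
  exact this

theorem Realizes.ite {dec : ℕ → List Y} {T A B : Control k X Y} {res : T.State → Bool} {c : Cond X}
    {p q : Prog X} (hT : Tests T res c) (hA : Realizes dec A p) (hB : Realizes dec B q) :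
    Realizes dec
      (link (link T A (fun s => if res s then some (.inr A.start) else none) (fun _ => none)) B
        (Sum.elim (fun _ => some (.inr B.start)) (fun _ => none)) (fun _ => none))
      (.ite c p q) := by
  intro w n σ h σ' h' out hE hh L hL
  obtain ⟨s, hs, hres, hlead⟩ := hT w n σ h hh L hL
  set TA := link T A (fun s => if res s then some (.inr A.start) else none) (fun _ => none) with hTA
  cases hE with
  | iteTrue hc h1 =>
    obtain ⟨L1, q1, hL1, hh1, ht1, hc1⟩ := hA _ _ _ _ _ _ _ h1 hh _ hL
    refine ⟨L1, .inl (.inr q1), hL1, hh1, by simp [link, ht1], fun o => ?_⟩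
    have hl : TA.Leads w (Nat.log 2 n + 3) ⟨.inl T.start, h, tape L (digits σ), 0, o⟩
        ⟨.inr q1, h', tape L1 (digits σ'), 0, o ++ out.flatMap dec⟩ :=
      (hlead o).link_inl.trans (Leads.trans (Leads.link_jump (Nat.succ_pos _) hh
        (Or.inl ⟨s, rfl, hs, by simp [hres.2 hc]⟩)) (hc1 o).link_inr)
    exact hl.link_inl
  | iteFalse hc h1 =>
    obtain ⟨L1, q1, hL1, hh1, ht1, hc1⟩ := hB _ _ _ _ _ _ _ h1 hh _ hL
    have hr : res s = false := by simpa [hc] using hres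
    refine ⟨L1, .inr q1, hL1, hh1, by simp [link, ht1], fun o => ?_⟩
    refine Leads.trans ((hlead o).link_inl (B := A)
      (nA := fun s => if res s then some (.inr A.start) else none)
      (nB := fun _ => none)).link_inl
      (Leads.trans (Leads.link_jump (Nat.succ_pos _) hh (Or.inl ⟨.inl s, rfl, ?_, rfl⟩))
        (hc1 o).link_inr)
    have hs' : T.trans s (Transducer.inputSymbol w h) (tape L (digits σ) 0) = none := hs
    simp [link, hs', hr]

theorem Realizes.whileNot {dec : ℕ → List Y} {T A : Control k X Y} {res : T.State → Bool}
    {c : Cond X} {p : Prog X} (hT : Tests T res c) (hA : Realizes dec A p) :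
    Realizes dec (link T A (fun s => if res s then none else some (.inr A.start))
      (fun _ => some (.inl T.start))) (.whileNot c p) := by
  intro w n σ h σ' h' out hE
  generalize hq : Prog.whileNot c p = r at hE
  induction hE with
  | whileDone hc =>
    rename_i c' p' σ h
    cases hq
    intro hh L hL
    obtain ⟨s, hs, hres, hlead⟩ := hT w n σ h hh L hL
    refine ⟨L, .inl s, hL, hh, by simp [link, hs, hres.2 hc], fun o => ?_⟩
    have := (hlead o).link_inl (B := A) (nA := fun s => if res s then none else some (.inr A.start))
      (nB := fun _ => some (.inl T.start))
    rw [List.flatMap_nil, List.append_nil]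
    exact this
  | whileStep hc h1 h2 ih1 ih =>
    rename_i c' p' σ h σ₁ h₁ o₁ σ₂ h₂ o₂
    cases hq
    intro hh L hL
    obtain ⟨s, hs, hres, hlead⟩ := hT w n σ h hh L hL
    have hr : res s = false := by simpa [hc] using hres
    obtain ⟨L1, q1, hL1, hh1, ht1, hc1⟩ := hA _ _ _ _ _ _ _ h1 hh _ hL
    obtain ⟨L2, q2, hL2, hh2, ht2, hc2⟩ := ih rfl hh1 _ hL1
    refine ⟨L2, q2, hL2, hh2, ht2, fun o => ?_⟩
    refine (hlead o).link_inl.trans (Leads.trans (Leads.link_jump (Nat.succ_pos _) hh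
      (Or.inl ⟨s, rfl, hs, by simp [hr]⟩)) ((hc1 o).link_inr.trans
        (Leads.trans (Leads.link_jump (Nat.succ_pos _) hh1 (Or.inr ⟨q1, rfl, ht1, rfl⟩)) ?_)))
    have := hc2 (o ++ List.flatMap dec o₁)
    rw [List.flatMap_append, ← List.append_assoc]
    exact this
  | _ => cases hq

theorem exists_tests (Y : Type*) (c : Cond X) : ∃ k₀, ∀ k ≥ k₀, ∃ (A : Control k X Y) (res : _),
    Tests A res c := by
  cases c with
  | eq r s => exact ⟨max (r + 1) (s + 1), fun k hk =>
      ⟨_, _, tests_eq (⟨r, by omega⟩ : Fin k) (⟨s, by omega⟩ : Fin k)⟩⟩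
  | sym P => exact ⟨0, fun k _ => ⟨_, _, tests_sym P⟩⟩

/-- Every program is carried out by a finite control, for all sufficiently large numbers of
registers. -/
theorem exists_realizes (dec : ℕ → List Y) (p : Prog X) :
    ∃ k₀, ∀ k ≥ k₀, ∃ A : Control k X Y, Realizes dec A p := by
  induction p with
  | skip =>
    refine ⟨0, fun k _ => ⟨_, realizes_single .stay [] fun w B σ h σ' h' out hE hh => ?_⟩⟩
    cases hE; simp [HeadMove.apply, hh]
  | zero r => exact ⟨r + 1, fun k hk => ⟨_, realizes_zero dec (⟨r, by omega⟩ : Fin k)⟩⟩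
  | inc r => exact ⟨r + 1, fun k hk => ⟨_, realizes_inc dec (⟨r, by omega⟩ : Fin k)⟩⟩
  | copy r s => exact ⟨max (r + 1) (s + 1), fun k hk =>
      ⟨_, realizes_copy dec (⟨r, by omega⟩ : Fin k) (⟨s, by omega⟩ : Fin k)⟩⟩
  | left =>
    refine ⟨0, fun k _ => ⟨_, realizes_single .left [] fun w B σ h σ' h' out hE hh => ?_⟩⟩
    cases hE; simp [HeadMove.apply]; omega
  | right =>
    refine ⟨0, fun k _ => ⟨_, realizes_single .right [] fun w B σ h σ' h' out hE hh => ?_⟩⟩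
    cases hE; simp [HeadMove.apply]
  | emit c =>
    refine ⟨0, fun k _ => ⟨_, realizes_single .stay [c] fun w B σ h σ' h' out hE hh => ?_⟩⟩
    cases hE; simp [HeadMove.apply, hh]
  | seq p q hp hq =>
    obtain ⟨k1, h1⟩ := hp
    obtain ⟨k2, h2⟩ := hq
    refine ⟨max k1 k2, fun k hk => ?_⟩
    obtain ⟨A, hA⟩ := h1 k (by omega)
    obtain ⟨B, hB⟩ := h2 k (by omega)
    exact ⟨_, hA.seq hB⟩
  | ite c p q hp hq =>
    obtain ⟨k0, h0⟩ := exists_tests Y c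
    obtain ⟨k1, h1⟩ := hp
    obtain ⟨k2, h2⟩ := hq
    refine ⟨max k0 (max k1 k2), fun k hk => ?_⟩
    obtain ⟨T, res, hT⟩ := h0 k (by omega)
    obtain ⟨A, hA⟩ := h1 k (by omega)
    obtain ⟨B, hB⟩ := h2 k (by omega)
    exact ⟨_, Realizes.ite hT hA hB⟩
  | whileNot c p hp =>
    obtain ⟨k0, h0⟩ := exists_tests Y c
    obtain ⟨k1, h1⟩ := hp
    refine ⟨max k0 k1, fun k hk => ?_⟩
    obtain ⟨T, res, hT⟩ := h0 k (by omega)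
    obtain ⟨A, hA⟩ := h1 k (by omega)
    exact ⟨_, Realizes.whileNot hT hA⟩

/-- The control that writes the marker on square `0` before the program starts. -/
def mark : Control k X Y where
  State := Bool
  finite := inferInstance
  start := false
  trans
    | false, _, _ => some ⟨true, some none, .stay, .stay, []⟩
    | true, _, _ => none

/-- If a computation leads to a halt while using little space, so does all of it, since the machine
is deterministic. -/
theorem Leads.workPos_lt {A : Control k X Y} {w : List X} {S : ℕ} {c c' d : A.toTransducer.Config}
    (h : A.Leads w S c c') (hc' : A.toTransducer.step w c' = none) (hS : c'.workPos < S)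
    (hd : StateTransition.Reaches (A.toTransducer.step w) c d) : d.workPos < S := by
  induction h using Relation.ReflTransGen.head_induction_on with
  | refl =>
    rcases Relation.ReflTransGen.cases_head hd with rfl | ⟨e, he, _⟩
    · exact hS
    · simp [hc'] at he
  | head h1 _ ih =>
    rcases Relation.ReflTransGen.cases_head hd with rfl | ⟨e, he, hed⟩
    · exact h1.1
    · have : e = _ := Option.mem_unique he h1.2
      subst this
      exact ih hed

end Control

/-- Counters up to `(n + 2) ^ c` need `O(log n)` squares. -/
theorem Nat.log_pow_add_two_le (n c : ℕ) :
    Nat.log 2 ((n + 2) ^ c) + 3 ≤ (3 * c + 3) * (Nat.log 2 n + 1) := by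
  have h1 : Nat.log 2 (n + 2) ≤ Nat.log 2 n + 2 := by
    rcases Nat.eq_zero_or_pos n with rfl | hn
    · exact (Nat.log_lt_of_lt_pow (by norm_num) (by norm_num)).le
    · have : Nat.log 2 (n + 2) ≤ Nat.log 2 (n * 2 * 2) := Nat.log_mono_right (by omega)
      rwa [Nat.log_mul_base (by norm_num) (by omega), Nat.log_mul_base (by norm_num) (by omega)]
        at this
  have h2 : (n + 2) ^ c < 2 ^ ((Nat.log 2 n + 3) * c + 1) := by
    calc (n + 2) ^ c ≤ (2 ^ (Nat.log 2 n + 3)) ^ c := by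
          refine Nat.pow_le_pow_left ?_ c
          exact ((Nat.lt_pow_succ_log_self (by norm_num) _).le).trans
            (Nat.pow_le_pow_right (by norm_num) (by omega))
      _ = 2 ^ ((Nat.log 2 n + 3) * c) := by rw [pow_mul]
      _ < _ := Nat.pow_lt_pow_right (by norm_num) (by omega)
  have h3 : Nat.log 2 ((n + 2) ^ c) < (Nat.log 2 n + 3) * c + 1 :=
    Nat.log_lt_of_lt_pow (by positivity) h2
  nlinarith [Nat.zero_le (c * Nat.log 2 n)]

/-- A function computed by a program with polynomially bounded registers is logspace computable. -/
theorem LogspaceComputable.of_exec {X Y : Type*} {f : List X → List Y} (p : Prog X)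
    (dec : ℕ → List Y) (c : ℕ)
    (hp : ∀ w, ∃ σ h out, Exec w ((w.length + 2) ^ c) p (fun _ => 0) 0 σ h out ∧
      f w = out.flatMap dec) : LogspaceComputable f := by
  obtain ⟨k, hk⟩ := Control.exists_realizes dec p
  obtain ⟨A, hA⟩ := hk k le_rfl
  set M := Control.link Control.mark A (fun _ => some (.inr A.start)) (fun _ => none) with hM
  refine ⟨M.toTransducer, 3 * c + 3, fun w => ?_⟩
  obtain ⟨σ, h, out, hE, hf⟩ := hp w
  obtain ⟨L', q, hF, hh, ht, hl⟩ := hA w _ _ _ _ _ _ hE (by omega) 0 ⟨by omega, by simp⟩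
  set S := Nat.log 2 ((w.length + 2) ^ c) + 3 with hS
  have hS0 : 0 < S := by omega
  have h1 : Control.mark.Leads (k := k) (X := X) (Y := Y) w S
      ⟨false, 0, fun _ => none, 0, []⟩
      ⟨true, 0, Control.tape 0 (Control.digits fun _ => 0), 0, []⟩ := by
    refine Control.Leads.of_step hS0 ⟨true, some none, .stay, .stay, []⟩ rfl ?_
    simp only [HeadMove.apply, List.append_nil]
    congr 1
    funext j
    rcases j with _ | j <;> simp [Control.tape]
  have hlead : M.Leads w S M.toTransducer.init
      ⟨.inr q, h, Control.tape L' (Control.digits σ), 0, f w⟩ := by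
    rw [hf]
    exact h1.link_inl.trans (Control.Leads.trans (Control.Leads.link_jump hS0 (Nat.zero_le _)
      (Or.inl ⟨true, rfl, rfl, rfl⟩)) (hl []).link_inr)
  have hhalt :
      M.toTransducer.step w ⟨.inr q, h, Control.tape L' (Control.digits σ), 0, f w⟩ = none := by
    have ht' : A.trans q (Transducer.inputSymbol w h)
        (Control.tape L' (Control.digits σ) 0) = none := ht
    have ht'' : (Control.link Control.mark A (fun _ => some (.inr A.start)) (fun _ => none)).trans
        (.inr q) (Transducer.inputSymbol w h) (Control.tape L' (Control.digits σ) 0) = none := by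
      simp only [Control.link, ht', Option.map_none]
    exact congrArg (Option.map _) ht''
  refine ⟨⟨_, ?_, hhalt, rfl⟩, fun d hd => ?_⟩
  · exact Relation.ReflTransGen.mono (fun _ _ h => h.2) _ _ hlead
  · exact (hlead.workPos_lt hhalt hS0 hd).trans_le (Nat.log_pow_add_two_le _ _)

/-! ### Number functions computed with polynomially bounded registers -/

/-- A context over the alphabet `X`: its elements consist of an input word and finitely many
numbers, its variables. -/
class Ctx (X : outParam (Type*)) (Γ : Type*) where
  arity : ℕ
  var : Γ → Fin arity → ℕ
  inp : Γ → List X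

namespace Ctx

variable {X Γ : Type*}

instance instList : Ctx X (List X) := ⟨0, fun _ => Fin.elim0, id⟩

instance instProd [Ctx X Γ] : Ctx X (Γ × ℕ) :=
  ⟨arity Γ + 1, fun p => Fin.cons p.2 (var p.1), fun p => inp p.1⟩

variable [Ctx X Γ]

/-- The quantity in terms of which polynomial bounds are expressed; it is at least `2`, so that
every polynomial in the input length is bounded by a power of it. -/
def size (γ : Γ) : ℕ := (inp γ).length + 2

theorem size_pow_mono (γ : Γ) {c c' : ℕ} (h : c ≤ c') : size γ ^ c ≤ size γ ^ c' :=
  Nat.pow_le_pow_right (by simp [size]) h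

theorem forall_var_prod {P : ℕ → Prop} (p : Γ × ℕ) :
    (∀ i, P (var p i)) ↔ P p.2 ∧ ∀ i, P (var p.1 i) := by
  refine ⟨fun h => ⟨h 0, fun i => h i.succ⟩, fun h i => ?_⟩
  exact Fin.cases (motive := fun i => P (var p i)) h.1 h.2 i

end Ctx

open Ctx

section

variable {X Γ Δ : Type*} [Ctx X Γ] [Ctx X Δ]

/-- All variables are bounded by the `c`-th power of the size. -/
def VarsLE (c : ℕ) (γ : Γ) : Prop := ∀ i, var γ i ≤ size γ ^ c

theorem VarsLE.mono {c c' : ℕ} {γ : Γ} (h : VarsLE c γ) (hc : c ≤ c') : VarsLE c' γ :=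
  fun i => (h i).trans (size_pow_mono γ hc)

theorem varsLE_prod {c : ℕ} {p : Γ × ℕ} : VarsLE c p ↔ p.2 ≤ size p.1 ^ c ∧ VarsLE c p.1 :=
  forall_var_prod (P := fun n => n ≤ size p.1 ^ c) p

/-- The function is polynomially bounded as long as the variables are. -/
def PolyBounded (F : Γ → ℕ) : Prop := ∀ c, ∃ c', ∀ γ, VarsLE c γ → F γ ≤ size γ ^ c'

/-- The program writes `F γ` into the register `d` if it finds the variables of `γ` in the
registers `args i`; of the other registers, it changes none below `m`. -/
def Computes (p : Prog X) (m : ℕ) (args : Fin (arity Γ) → ℕ) (d : ℕ) (F : Γ → ℕ) (c c' : ℕ) :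
    Prop :=
  ∀ (γ : Γ) (σ : ℕ → ℕ) (h : ℕ), VarsLE c γ → (∀ i, σ (args i) = var γ i) →
    ∃ σ' h', Exec (inp γ) (size γ ^ c') p σ h σ' h' [] ∧ (∀ j < m, j ≠ d → σ' j = σ j) ∧ σ' d = F γ

/-- The function is computed by programs whose registers are polynomially bounded in the length of
the input word, as long as the variables are; for every choice of the registers for the variables
and the value there is such a program. -/
structure LS (F : Γ → ℕ) : Prop where
  bounded : PolyBounded F
  program : ∀ (m : ℕ) (args : Fin (arity Γ) → ℕ) (d : ℕ), (∀ i, args i < m) → d < m →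
    ∃ p : Prog X, ∀ c, ∃ c', Computes p m args d F c c'

/-- A map of contexts that keeps the input word and whose variables are given by functions in the
class `LS`. -/
def Subst (s : Δ → Γ) : Prop :=
  (∀ δ, inp (s δ) = inp δ) ∧ ∀ i, LS (fun δ => var (s δ) i)

theorem Exec.seq_nil {w : List X} {B : ℕ} {p q : Prog X} {σ σ₁ σ₂ : ℕ → ℕ} {h h₁ h₂ : ℕ}
    (hp : Exec w B p σ h σ₁ h₁ []) (hq : Exec w B q σ₁ h₁ σ₂ h₂ []) :
    Exec w B (.seq p q) σ h σ₂ h₂ [] :=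
  Exec.seq hp hq

theorem Exec.whileStep_nil {w : List X} {B : ℕ} {c : Cond X} {p : Prog X} {σ σ₁ σ₂ : ℕ → ℕ}
    {h h₁ h₂ : ℕ} (hc : ¬ c.Holds w σ h) (hp : Exec w B p σ h σ₁ h₁ [])
    (hq : Exec w B (.whileNot c p) σ₁ h₁ σ₂ h₂ []) : Exec w B (.whileNot c p) σ h σ₂ h₂ [] :=
  Exec.whileStep hc hp hq

theorem LS.congr {F G : Γ → ℕ} (hF : LS F) (h : ∀ γ, F γ = G γ) : LS G :=
  (funext h : F = G) ▸ hF

theorem PolyBounded.of_le {F G : Γ → ℕ} (hG : PolyBounded G) (h : ∀ γ, F γ ≤ G γ) :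
    PolyBounded F :=
  fun c => let ⟨c', hc'⟩ := hG c; ⟨c', fun γ hγ => (h γ).trans (hc' γ hγ)⟩

theorem LS.var (i : Fin (arity Γ)) : LS (fun γ : Γ => Ctx.var γ i) where
  bounded c := ⟨c, fun _ h => h i⟩
  program m args d _ _ := ⟨.copy (args i) d, fun c => ⟨c, fun γ σ h _ hσ =>
    ⟨_, _, .copy, fun j _ hj => by simp [hj], by simp [hσ]⟩⟩⟩

theorem LS.zero : LS (fun _ : Γ => 0) where
  bounded _ := ⟨0, fun _ _ => Nat.zero_le _⟩
  program m args d _ _ := ⟨.zero d, fun c => ⟨c, fun γ σ h _ hσ =>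
    ⟨_, _, .zero, fun j _ hj => by simp [hj], by simp⟩⟩⟩

theorem LS.succ {F : Γ → ℕ} (hF : LS F) : LS (fun γ => F γ + 1) where
  bounded c := by
    obtain ⟨c', h⟩ := hF.bounded c
    refine ⟨c' + 1, fun γ hγ => ?_⟩
    have h1 := h γ hγ
    have h2 : 1 ≤ size γ ^ c' := Nat.one_le_pow _ _ (by simp [size])
    have h3 : 2 ≤ size γ := by simp [size]
    rw [pow_succ]
    nlinarith
  program m args d ha hd := by
    obtain ⟨p, hp⟩ := hF.program m args d ha hd
    refine ⟨.seq p (.inc d), fun c => ?_⟩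
    obtain ⟨c1, h1⟩ := hp c
    obtain ⟨c2, h2⟩ := hF.bounded c
    refine ⟨max c1 (c2 + 1), fun γ σ h hγ hσ => ?_⟩
    obtain ⟨σ', h', hE, hj, hd'⟩ := h1 γ σ h hγ hσ
    refine ⟨_, _, .seq_nil (hE.mono (size_pow_mono γ (le_max_left _ _))) (.inc ?_), ?_, ?_⟩
    · rw [hd']
      refine le_trans ?_ (size_pow_mono γ (le_max_right _ _))
      have h1 := h2 γ hγ
      have h2 : 1 ≤ size γ ^ c2 := Nat.one_le_pow _ _ (by simp [size])
      have h3 : 2 ≤ size γ := by simp [size]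
      rw [pow_succ]
      nlinarith
    · intro j hjm hjd
      rw [Function.update_of_ne hjd, hj j hjm hjd]
    · simp [hd']

theorem LS.const (n : ℕ) : LS (fun _ : Γ => n) := by
  induction n with
  | zero => exact LS.zero
  | succ n ih => exact ih.succ

/-- Finitely many functions of the class `LS` are computed by one program, which writes the values
into the registers from `m` on. -/
theorem LS.exists_program_family {k : ℕ} {G : Fin k → Γ → ℕ} (hG : ∀ i, LS (G i)) (m : ℕ)
    (args : Fin (arity Γ) → ℕ) (ha : ∀ i, args i < m) :
    ∃ p : Prog X, ∀ c, ∃ c', ∀ (γ : Γ) (σ : ℕ → ℕ) (h : ℕ), VarsLE c γ →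
      (∀ i, σ (args i) = Ctx.var γ i) →
      ∃ σ' h', Exec (inp γ) (size γ ^ c') p σ h σ' h' [] ∧ (∀ j < m, σ' j = σ j) ∧
        ∀ i : Fin k, σ' (m + i) = G i γ := by
  induction k with
  | zero => exact ⟨.skip, fun c => ⟨0, fun γ σ h _ _ =>
      ⟨σ, h, .skip, fun _ _ => rfl, fun i => i.elim0⟩⟩⟩
  | succ k ih =>
    obtain ⟨p, hp⟩ := ih (G := fun i => G i.castSucc) fun i => hG _
    obtain ⟨q, hq⟩ := (hG (Fin.last k)).program (m + k + 1) args (m + k)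
      (fun i => by have := ha i; omega) (by omega)
    refine ⟨.seq p q, fun c => ?_⟩
    obtain ⟨c1, h1⟩ := hp c
    obtain ⟨c2, h2⟩ := hq c
    refine ⟨max c1 c2, fun γ σ h hγ hσ => ?_⟩
    obtain ⟨σ1, k1, hE1, hm1, hv1⟩ := h1 γ σ h hγ hσ
    obtain ⟨σ2, k2, hE2, hm2, hv2⟩ := h2 γ σ1 k1 hγ (fun i => by rw [hm1 _ (ha i), hσ])
    refine ⟨σ2, k2, .seq_nil (hE1.mono (size_pow_mono γ (le_max_left _ _)))
      (hE2.mono (size_pow_mono γ (le_max_right _ _))), fun j hj => ?_, fun i => ?_⟩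
    · rw [hm2 j (by omega) (by omega), hm1 j hj]
    · refine Fin.lastCases (motive := fun i => σ2 (m + i) = G i γ) hv2 (fun i => ?_) i
      have := i.2
      simp only [Fin.val_castSucc]
      rw [hm2 _ (by omega) (by omega)]
      exact hv1 i

theorem exists_forall_fin {k : ℕ} {P : Fin k → ℕ → Prop} (hP : ∀ i, ∃ c, P i c)
    (hm : ∀ i c c', c ≤ c' → P i c → P i c') : ∃ c, ∀ i, P i c := by
  choose f hf using hP
  exact ⟨Finset.univ.sup f, fun i => hm i _ _ (Finset.le_sup (Finset.mem_univ i)) (hf i)⟩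

theorem Subst.exists_varsLE {s : Δ → Γ} (hs : Subst s) (c : ℕ) :
    ∃ c', ∀ δ, VarsLE c δ → VarsLE c' (s δ) := by
  obtain ⟨c', hc'⟩ := exists_forall_fin
    (P := fun i c' => ∀ δ, VarsLE c δ → Ctx.var (s δ) i ≤ size δ ^ c')
    (fun i => (hs.2 i).bounded c)
    (fun i a b hab h δ hδ => (h δ hδ).trans (size_pow_mono δ hab))
  refine ⟨c', fun δ hδ i => ?_⟩
  have : size (s δ) = size δ := by simp [size, hs.1]
  rw [this]
  exact hc' i δ hδ

theorem LS.comp {F : Γ → ℕ} (hF : LS F) {s : Δ → Γ} (hs : Subst s) : LS (fun δ => F (s δ)) where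
  bounded c := by
    obtain ⟨c1, h1⟩ := hs.exists_varsLE c
    obtain ⟨c2, h2⟩ := hF.bounded c1
    refine ⟨c2, fun δ hδ => ?_⟩
    have : size (s δ) = size δ := by simp [size, hs.1]
    exact this ▸ h2 _ (h1 δ hδ)
  program m args d ha hd := by
    obtain ⟨p, hp⟩ := LS.exists_program_family hs.2 m args ha
    obtain ⟨q, hq⟩ := hF.program (m + arity Γ) (fun i => m + i) d
      (fun i => by have := i.2; omega) (by omega)
    refine ⟨.seq p q, fun c => ?_⟩
    obtain ⟨c1, h1⟩ := hp c
    obtain ⟨c2, h2⟩ := hs.exists_varsLE c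
    obtain ⟨c3, h3⟩ := hq c2
    refine ⟨max c1 c3, fun δ σ h hδ hσ => ?_⟩
    obtain ⟨σ1, k1, hE1, hm1, hv1⟩ := h1 δ σ h hδ hσ
    obtain ⟨σ2, k2, hE2, hm2, hv2⟩ := h3 (s δ) σ1 k1 (h2 δ hδ) hv1
    have : size (s δ) = size δ := by simp [size, hs.1]
    rw [this, hs.1] at hE2
    refine ⟨σ2, k2, .seq_nil (hE1.mono (size_pow_mono δ (le_max_left _ _)))
      (hE2.mono (size_pow_mono δ (le_max_right _ _))), fun j hj hjd => ?_, hv2⟩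
    rw [hm2 j (by omega) hjd, hm1 j hj]

theorem Subst.id : Subst (fun γ : Γ => γ) := ⟨fun _ => rfl, LS.var⟩

theorem Subst.pair {s : Δ → Γ} {A : Δ → ℕ} (hs : Subst s) (hA : LS A) :
    Subst (fun δ => (s δ, A δ)) :=
  ⟨hs.1, fun i => Fin.cases (motive := fun i => LS (fun δ => Ctx.var (s δ, A δ) i)) hA hs.2 i⟩

theorem Subst.fst : Subst (fun p : Γ × ℕ => p.1) :=
  ⟨fun _ => rfl, fun i => LS.var (Γ := Γ × ℕ) i.succ⟩

theorem LS.weaken {F : Γ → ℕ} (hF : LS F) : LS (fun p : Γ × ℕ => F p.1) := hF.comp Subst.fst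

theorem Subst.weaken {s : Δ → Γ} (hs : Subst s) : Subst (fun p : Δ × ℕ => s p.1) :=
  ⟨fun p => hs.1 p.1, fun i => (hs.2 i).weaken⟩

theorem LS.snd : LS (fun p : Γ × ℕ => p.2) := LS.var (Γ := Γ × ℕ) 0

theorem LS.bind {F : Γ → ℕ → ℕ} {A : Γ → ℕ} (hF : LS (fun p : Γ × ℕ => F p.1 p.2)) (hA : LS A) :
    LS (fun γ => F γ (A γ)) :=
  hF.comp (Subst.id.pair hA)

/-- Bounded primitive recursion: the recursion may be carried out by a loop if all its values are
polynomially bounded. -/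
theorem LS.primrec {F : Γ → ℕ} {G : Γ → ℕ → ℕ → ℕ} {R : Γ → ℕ → ℕ} (hF : LS F)
    (hG : LS (fun q : (Γ × ℕ) × ℕ => G q.1.1 q.1.2 q.2)) (h0 : ∀ γ, R γ 0 = F γ)
    (hs : ∀ γ i, R γ (i + 1) = G γ i (R γ i)) (hb : PolyBounded (fun p : Γ × ℕ => R p.1 p.2)) :
    LS (fun p : Γ × ℕ => R p.1 p.2) where
  bounded := hb
  program m args d ha hd := by
    obtain ⟨p, hp⟩ := hF.program (m + 2) (fun i => args i.succ) (m + 1)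
      (fun i => by have := ha i.succ; omega) (by omega)
    obtain ⟨q, hq⟩ := hG.program (m + 3)
      (Fin.cons (m + 1) (Fin.cons m fun i => args i.succ) : Fin (arity Γ + 1 + 1) → ℕ) (m + 2)
      (fun i => by
        refine Fin.cases ?_ (fun i => ?_) i
        · simp
        · refine Fin.cases ?_ (fun i => ?_) i
          · simp
          · have := ha i.succ
            simp only [Fin.cons_succ]; omega) (by omega)
    -- Register `m` holds the number of steps done, `m + 1` the value reached, and `m + 2` the next
    -- value; `n` is the register of the recursion variable.
    set n := args 0 with hn
    have hnm : n < m := ha 0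
    refine ⟨.seq p (.seq (.zero m) (.seq
      (.whileNot (.eq m n) (.seq q (.seq (.copy (m + 2) (m + 1)) (.inc m)))) (.copy (m + 1) d))),
      fun c => ?_⟩
    obtain ⟨c1, h1⟩ := hp c
    obtain ⟨c2, h2⟩ := hb c
    obtain ⟨c3, h3⟩ := hq (max c c2)
    set C := max c (max c1 c3) with hC
    refine ⟨C, fun ⟨γ, N⟩ σ h hγ hσ => ?_⟩
    obtain ⟨hN, hγ'⟩ := varsLE_prod.1 hγ
    simp only at hN hγ'
    have hσn : σ n = N := hσ 0
    have hσs : ∀ i, σ (args (Fin.succ i)) = Ctx.var γ i := fun i => hσ (Fin.succ i)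
    have hloop : ∀ t i, N = i + t → ∀ τ k, (∀ j < m, τ j = σ j) → τ m = i → τ (m + 1) = R γ i →
        ∃ τ' k', Exec (inp γ) (size γ ^ C)
          (.whileNot (.eq m n) (.seq q (.seq (.copy (m + 2) (m + 1)) (.inc m)))) τ k τ' k' [] ∧
          (∀ j < m, τ' j = σ j) ∧ τ' (m + 1) = R γ N := by
      intro t
      induction t with
      | zero =>
        rintro i rfl τ k hτ hi hr
        exact ⟨τ, k, .whileDone (by simp [Cond.Holds, hi, hτ _ hnm, hσn]), hτ, hr⟩
      | succ t ih =>
        intro i hi τ k hτ hm hr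
        have hV : VarsLE (max c c2) ((γ, i), R γ i) := by
          refine varsLE_prod.2 ⟨?_, varsLE_prod.2 ⟨?_, hγ'.mono (le_max_left c c2)⟩⟩
          · exact (h2 (γ, i) (varsLE_prod.2 ⟨le_trans (by simp only; omega) hN, hγ'⟩)).trans
              (size_pow_mono γ (le_max_right c c2))
          · exact le_trans (le_trans (by simp only; omega) hN)
              (size_pow_mono γ (le_max_left c c2))
        obtain ⟨τ1, k1, hE, hj, hv⟩ := h3 ((γ, i), R γ i) τ k hV (fun i' => by
          refine Fin.cases ?_ (fun i' => ?_) i'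
          · exact hr
          · refine Fin.cases ?_ (fun i' => ?_) i'
            · exact hm
            · exact (hτ _ (ha i'.succ)).trans (hσs i'))
        obtain ⟨τ2, k2, hE2, hj2, hv2⟩ := ih (i + 1) (by omega)
          (Function.update (Function.update τ1 (m + 1) (τ1 (m + 2))) m
            (Function.update τ1 (m + 1) (τ1 (m + 2)) m + 1)) k1
          (fun j hjm => by
            rw [Function.update_of_ne (by omega), Function.update_of_ne (by omega),
              hj j (by omega) (by omega), hτ j hjm])
          (by simp [hj m (by omega) (by omega), hm])
          (by simp [hv, hs])
        refine ⟨τ2, k2, .whileStep_nil ?_ (.seq_nil (hE.mono (size_pow_mono γ ?_))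
          (.seq_nil .copy (.inc ?_))) hE2, hj2, hv2⟩
        · simp only [Cond.Holds, hm, hτ _ hnm, hσn]; omega
        · omega
        · rw [Function.update_of_ne (by omega), hj m (by omega) (by omega), hm]
          exact le_trans (by omega) (hN.trans (size_pow_mono γ (by omega)))
    obtain ⟨σ1, k1, hE1, hj1, hv1⟩ := h1 γ σ h hγ' hσs
    obtain ⟨σ2, k2, hE2, hj2, hv2⟩ := hloop N 0 (by omega) (Function.update σ1 m 0) k1
      (fun j hj => by rw [Function.update_of_ne (by omega), hj1 j (by omega) (by omega)])
      (by simp) (by simp [hv1, h0])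
    refine ⟨_, _, .seq_nil (hE1.mono (size_pow_mono γ (by omega)))
      (.seq_nil .zero (.seq_nil hE2 .copy)), fun j hj hjd => ?_, by simp [hv2]⟩
    rw [Function.update_of_ne hjd, hj2 j hj]

/-- Moving the input head to square `0`. -/
def Prog.rewind : Prog X :=
  .whileNot (.sym fun s => match s with | .leftEnd => true | _ => false) .left

theorem Exec.rewind (w : List X) (B : ℕ) (σ : ℕ → ℕ) (h : ℕ) :
    Exec w B Prog.rewind σ h σ 0 [] := by
  induction h with
  | zero => exact .whileDone rfl
  | succ h ih =>
    refine .whileStep_nil ?_ .left ih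
    simp only [Cond.Holds, Transducer.inputSymbol]
    cases w[h]? <;> simp

theorem inputSymbol_min (w : List X) (p : ℕ) :
    Transducer.inputSymbol w (min p (w.length + 1)) = Transducer.inputSymbol w p := by
  rcases le_total p (w.length + 1) with h | h
  · rw [min_eq_left h]
  · rw [min_eq_right h]
    obtain ⟨p, rfl⟩ : ∃ q, p = q + 1 := ⟨p - 1, by omega⟩
    simp [Transducer.inputSymbol, List.getElem?_eq_none (show w.length ≤ p by omega)]

/-- Testing the input symbol on a computed square. -/
theorem LS.inputSymbol (P : InputSymbol X → Bool) {A : Γ → ℕ} (hA : LS A) :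
    LS (fun γ => if P (Transducer.inputSymbol (inp γ) (A γ)) then 1 else 0) where
  bounded _ := ⟨0, fun γ _ => by dsimp only; split <;> simp⟩
  program m args d ha hd := by
    obtain ⟨p, hp⟩ := hA.program (m + 1) args m (fun i => by have := ha i; omega) (by omega)
    -- The head goes to square `0` and then right as often as register `m` says, counted in `m + 1`.
    -- It stops at the right end, where the symbol is the same as on all squares beyond.
    refine ⟨.seq p (.seq .rewind (.seq (.zero (m + 1)) (.seq
      (.whileNot (.eq (m + 1) m) (.seq .right (.inc (m + 1))))
      (.ite (.sym P) (.seq (.zero d) (.inc d)) (.zero d))))), fun c => ?_⟩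
    obtain ⟨c1, h1⟩ := hp c
    obtain ⟨c2, h2⟩ := hA.bounded c
    refine ⟨max c1 c2, fun γ σ h hγ hσ => ?_⟩
    obtain ⟨σ1, k1, hE1, hj1, hv1⟩ := h1 γ σ h hγ hσ
    have hloop : ∀ t i, A γ = i + t → ∀ τ, (∀ j < m + 1, τ j = σ1 j) → τ (m + 1) = i →
        ∃ τ', Exec (inp γ) (size γ ^ max c1 c2)
          (.whileNot (.eq (m + 1) m) (.seq .right (.inc (m + 1)))) τ
            (min i ((inp γ).length + 1)) τ' (min (A γ) ((inp γ).length + 1)) [] ∧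
          (∀ j < m + 1, τ' j = σ1 j) := by
      intro t
      induction t with
      | zero =>
        rintro i hi τ hτ hm
        rw [show i = A γ by omega] at hm ⊢
        exact ⟨τ, .whileDone (by simp [Cond.Holds, hm, hτ m (by omega), hv1]), hτ⟩
      | succ t ih =>
        intro i hi τ hτ hm
        obtain ⟨τ2, hE2, hj2⟩ := ih (i + 1) (by omega)
          (Function.update τ (m + 1) (τ (m + 1) + 1))
          (fun j hjm => by rw [Function.update_of_ne (by omega), hτ j hjm]) (by simp [hm])
        refine ⟨τ2, .whileStep_nil ?_ (.seq_nil .right (.inc ?_)) ?_, hj2⟩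
        · simp only [Cond.Holds, hm, hτ m (by omega), hv1]; omega
        · rw [hm]
          have := (h2 γ hγ).trans (size_pow_mono γ (le_max_right c1 c2))
          omega
        · convert hE2 using 1
          omega
    obtain ⟨σ2, hE2, hj2⟩ := hloop (A γ) 0 (by omega) (Function.update σ1 (m + 1) 0)
      (fun j hj => by rw [Function.update_of_ne (by omega)]) (by simp)
    rw [Nat.zero_min] at hE2
    have hE := fun σ' k' (hlast : Exec (inp γ) (size γ ^ max c1 c2)
        (.ite (.sym P) (.seq (.zero d) (.inc d)) (.zero d)) σ2 _ σ' k' []) =>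
      Exec.seq_nil (hE1.mono (size_pow_mono γ (le_max_left c1 c2)))
        (.seq_nil (.rewind _ _ _ _) (.seq_nil .zero (.seq_nil hE2 hlast)))
    have hfix : ∀ j < m, j ≠ d → σ2 j = σ j := fun j hj hjd => by
      rw [hj2 j (by omega), hj1 j (by omega) (by omega)]
    by_cases hP : P (Transducer.inputSymbol (inp γ) (A γ)) = true
    · refine ⟨_, _, hE _ _ (.iteTrue ?_ (.seq_nil .zero (.inc ?_))), ?_, ?_⟩
      · simpa [Cond.Holds, inputSymbol_min] using hP
      · simpa using Nat.one_le_pow _ _ (by simp [size])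
      · intro j hj hjd
        rw [Function.update_of_ne hjd, Function.update_of_ne hjd, hfix j hj hjd]
      · simp [hP]
    · refine ⟨_, _, hE _ _ (.iteFalse ?_ .zero), ?_, ?_⟩
      · simpa [Cond.Holds, inputSymbol_min] using hP
      · intro j hj hjd
        rw [Function.update_of_ne hjd, hfix j hj hjd]
      · simp [hP]

/-- The length of the input word. -/
theorem LS.length_inp : LS (fun γ : Γ => (inp γ).length) where
  bounded _ := ⟨1, fun γ _ => by simp [size]⟩
  program m args d ha hd := by
    refine ⟨.seq .rewind (.seq (.zero d) (.seq .right (.whileNot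
      (.sym fun s => match s with | .rightEnd => true | _ => false) (.seq .right (.inc d))))),
      fun c => ⟨1, fun γ σ h _ _ => ?_⟩⟩
    have hloop : ∀ t i, (inp γ).length = i + t → ∀ τ, (∀ j < m, j ≠ d → τ j = σ j) → τ d = i →
        ∃ τ', Exec (inp γ) (size γ ^ 1) (.whileNot
            (.sym fun s => match s with | .rightEnd => true | _ => false) (.seq .right (.inc d))) τ
            (i + 1) τ' ((inp γ).length + 1) [] ∧
          (∀ j < m, j ≠ d → τ' j = σ j) ∧ τ' d = (inp γ).length := by
      intro t
      induction t with
      | zero =>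
        rintro i hi τ hτ hm
        rw [show i = (inp γ).length by omega] at hm ⊢
        refine ⟨τ, .whileDone ?_, hτ, hm⟩
        simp [Cond.Holds, Transducer.inputSymbol]
      | succ t ih =>
        intro i hi τ hτ hm
        obtain ⟨τ2, hE2, hj2⟩ := ih (i + 1) (by omega) (Function.update τ d (τ d + 1))
          (fun j hjm hjd => by rw [Function.update_of_ne hjd, hτ j hjm hjd]) (by simp [hm])
        refine ⟨τ2, .whileStep_nil ?_ (.seq_nil .right (.inc ?_)) ?_, hj2⟩
        · simp [Cond.Holds, Transducer.inputSymbol,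
            List.getElem?_eq_getElem (show i < (inp γ).length by omega)]
        · rw [hm, pow_one, size]; omega
        · convert hE2 using 1
          omega
    obtain ⟨τ, hE, hj, hv⟩ := hloop (inp γ).length 0 (by omega) (Function.update σ d 0)
      (fun j _ hjd => by rw [Function.update_of_ne hjd]) (by simp)
    refine ⟨τ, (inp γ).length + 1,
      .seq_nil (.rewind _ _ _ _) (.seq_nil .zero (.seq_nil .right ?_)), hj, hv⟩
    rwa [min_eq_left (show 0 + 1 ≤ (inp γ).length + 1 by omega)]

end

/-! ### Arithmetic -/

section

variable {X Γ Δ : Type*} [Ctx X Γ] [Ctx X Δ]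

theorem PolyBounded.mul {F G : Γ → ℕ} (hF : PolyBounded F) (hG : PolyBounded G) :
    PolyBounded (fun γ => F γ * G γ) := by
  intro c
  obtain ⟨a, ha⟩ := hF c
  obtain ⟨b, hb⟩ := hG c
  exact ⟨a + b, fun γ h => by rw [pow_add]; exact Nat.mul_le_mul (ha γ h) (hb γ h)⟩

theorem PolyBounded.add {F G : Γ → ℕ} (hF : PolyBounded F) (hG : PolyBounded G) :
    PolyBounded (fun γ => F γ + G γ) := by
  intro c
  obtain ⟨a, ha⟩ := hF c
  obtain ⟨b, hb⟩ := hG c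
  refine ⟨a + b + 1, fun γ h => ?_⟩
  have h1 := ha γ h
  have h2 := hb γ h
  have h3 : 2 ≤ size γ := by simp [size]
  have h4 := size_pow_mono γ (show a ≤ a + b by omega)
  have h5 := size_pow_mono γ (show b ≤ a + b by omega)
  rw [pow_succ]
  nlinarith

theorem PolyBounded.weaken {F : Γ → ℕ} (hF : PolyBounded F) :
    PolyBounded (fun p : Γ × ℕ => F p.1) := by
  intro c
  obtain ⟨a, ha⟩ := hF c
  exact ⟨a, fun γ h => ha _ (varsLE_prod.1 h).2⟩

theorem PolyBounded.sum {F : Γ → ℕ → ℕ} (hF : PolyBounded (fun p : Γ × ℕ => F p.1 p.2)) :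
    PolyBounded (fun p : Γ × ℕ => ∑ i ∈ Finset.range p.2, F p.1 i) := by
  intro c
  obtain ⟨a, ha⟩ := hF c
  refine ⟨c + a, fun p h => ?_⟩
  obtain ⟨h1, h2⟩ := varsLE_prod.1 h
  calc _ ≤ ∑ i ∈ Finset.range p.2, size p.1 ^ a := by
        refine Finset.sum_le_sum fun i hi => ?_
        exact ha (p.1, i) (varsLE_prod.2 ⟨(Finset.mem_range.1 hi).le.trans h1, h2⟩)
    _ = p.2 * size p.1 ^ a := by simp
    _ ≤ _ := by rw [pow_add]; exact Nat.mul_le_mul_right _ h1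

theorem LS.add {F G : Γ → ℕ} (hF : LS F) (hG : LS G) : LS (fun γ => F γ + G γ) := by
  refine LS.bind (F := fun γ n => F γ + n) ?_ hG
  exact LS.primrec (R := fun γ n => F γ + n) (G := fun _ _ r => r + 1) hF LS.snd.succ
    (fun _ => rfl) (fun _ _ => rfl) (hF.bounded.weaken.add LS.snd.bounded)

theorem LS.mul {F G : Γ → ℕ} (hF : LS F) (hG : LS G) : LS (fun γ => F γ * G γ) := by
  refine LS.bind (F := fun γ n => F γ * n) ?_ hG
  exact LS.primrec (R := fun γ n => F γ * n) (G := fun γ _ r => r + F γ) LS.zero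
    (LS.snd.add hF.weaken.weaken) (fun _ => rfl) (fun _ _ => rfl)
    (hF.bounded.weaken.mul LS.snd.bounded)

theorem LS.pow {F : Γ → ℕ} (hF : LS F) (n : ℕ) : LS (fun γ => F γ ^ n) := by
  induction n with
  | zero => exact (LS.const 1).congr fun _ => (pow_zero _).symm
  | succ n ih => exact (ih.mul hF).congr fun _ => (pow_succ _ _).symm

theorem LS.pred {F : Γ → ℕ} (hF : LS F) : LS (fun γ => F γ - 1) := by
  refine LS.bind (F := fun _ n => n - 1) ?_ hF
  exact LS.primrec (R := fun _ n => n - 1) (G := fun _ i _ => i) LS.zero LS.snd.weaken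
    (fun _ => rfl) (fun _ _ => rfl) (LS.snd.bounded.of_le fun _ => Nat.sub_le _ _)

theorem LS.sub {F G : Γ → ℕ} (hF : LS F) (hG : LS G) : LS (fun γ => F γ - G γ) := by
  refine LS.bind (F := fun γ n => F γ - n) ?_ hG
  exact LS.primrec (R := fun γ n => F γ - n) (G := fun _ _ r => r - 1) hF LS.snd.pred (fun _ => rfl)
    (fun _ _ => rfl) (hF.bounded.weaken.of_le fun _ => Nat.sub_le _ _)

theorem LS.sum {F : Γ → ℕ → ℕ} {N : Γ → ℕ} (hF : LS (fun p : Γ × ℕ => F p.1 p.2)) (hN : LS N) :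
    LS (fun γ => ∑ i ∈ Finset.range (N γ), F γ i) := by
  refine LS.bind (F := fun γ n => ∑ i ∈ Finset.range n, F γ i) ?_ hN
  exact LS.primrec (R := fun γ n => ∑ i ∈ Finset.range n, F γ i)
    (G := fun γ i r => r + F γ i) LS.zero (LS.snd.add hF.weaken)
    (fun _ => Finset.sum_range_zero _) (fun _ _ => Finset.sum_range_succ _ _) hF.bounded.sum

theorem LS.finsetSum {ι : Type*} {F : ι → Γ → ℕ} (hF : ∀ i, LS (F i)) (s : Finset ι) :
    LS (fun γ => ∑ i ∈ s, F i γ) := by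
  classical
  induction s using Finset.induction_on with
  | empty => exact LS.zero.congr fun _ => Finset.sum_empty.symm
  | insert a s ha ih => exact ((hF a).add ih).congr fun γ =>
      (Finset.sum_insert (f := fun i => F i γ) ha).symm

open Classical in
/-- The truth value of a proposition as a number. -/
noncomputable def ind (P : Prop) : ℕ := if P then 1 else 0

/-- The predicate is decided by a function in the class `LS`. -/
def LSP (P : Γ → Prop) : Prop := LS (fun γ => ind (P γ))

theorem ind_true {P : Prop} (h : P) : ind P = 1 := by simp [ind, h]

theorem ind_false {P : Prop} (h : ¬ P) : ind P = 0 := by simp [ind, h]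

theorem LSP.congr {P Q : Γ → Prop} (hP : LSP P) (h : ∀ γ, P γ ↔ Q γ) : LSP Q :=
  (funext fun γ => propext (h γ) : P = Q) ▸ hP

theorem LSP.comp {P : Γ → Prop} (hP : LSP P) {s : Δ → Γ} (hs : Subst s) :
    LSP (fun δ => P (s δ)) :=
  LS.comp hP hs

theorem LSP.weaken {P : Γ → Prop} (hP : LSP P) : LSP (fun p : Γ × ℕ => P p.1) := hP.comp Subst.fst

theorem LSP.lt {F G : Γ → ℕ} (hF : LS F) (hG : LS G) : LSP (fun γ => F γ < G γ) := by
  refine ((LS.const 1).sub ((LS.const 1).sub (hG.sub hF))).congr fun γ => ?_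
  by_cases h : F γ < G γ
  · rw [ind_true h]; omega
  · rw [ind_false h]; omega

theorem LSP.not {P : Γ → Prop} (hP : LSP P) : LSP (fun γ => ¬ P γ) := by
  refine ((LS.const 1).sub hP).congr fun γ => ?_
  by_cases h : P γ <;> simp [ind, h]

theorem LSP.and {P Q : Γ → Prop} (hP : LSP P) (hQ : LSP Q) : LSP (fun γ => P γ ∧ Q γ) := by
  refine (LS.mul hP hQ).congr fun γ => ?_
  by_cases h : P γ <;> by_cases h' : Q γ <;> simp [ind, h, h']

theorem LSP.or {P Q : Γ → Prop} (hP : LSP P) (hQ : LSP Q) : LSP (fun γ => P γ ∨ Q γ) :=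
  (hP.not.and hQ.not).not.congr fun _ => by tauto

theorem LSP.le {F G : Γ → ℕ} (hF : LS F) (hG : LS G) : LSP (fun γ => F γ ≤ G γ) :=
  (LSP.lt hG hF).not.congr fun _ => not_lt

theorem LSP.eq {F G : Γ → ℕ} (hF : LS F) (hG : LS G) : LSP (fun γ => F γ = G γ) :=
  ((LSP.le hF hG).and (LSP.le hG hF)).congr fun _ => le_antisymm_iff.symm

theorem LSP.const (P : Prop) : LSP (fun _ : Γ => P) := LS.const _

theorem LSP.exists_lt {P : Γ → ℕ → Prop} {N : Γ → ℕ} (hP : LSP (fun p : Γ × ℕ => P p.1 p.2))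
    (hN : LS N) : LSP (fun γ => ∃ i < N γ, P γ i) := by
  refine (LSP.lt LS.zero (LS.sum (F := fun γ i => ind (P γ i)) hP hN)).congr fun γ => ?_
  rw [Nat.pos_iff_ne_zero, Ne, Finset.sum_eq_zero_iff]
  constructor
  · intro h
    by_contra! h'
    exact h fun i hi => ind_false (h' i (Finset.mem_range.1 hi))
  · rintro ⟨i, hi, hP⟩ h
    have := h i (Finset.mem_range.2 hi)
    rw [ind_true hP] at this
    exact one_ne_zero this

theorem LSP.forall_lt {P : Γ → ℕ → Prop} {N : Γ → ℕ} (hP : LSP (fun p : Γ × ℕ => P p.1 p.2))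
    (hN : LS N) : LSP (fun γ => ∀ i < N γ, P γ i) :=
  (LSP.exists_lt (P := fun γ i => ¬ P γ i) hP.not hN).not.congr fun _ => by push Not; rfl

theorem LSP.exists_fintype {ι : Type*} [Finite ι] {P : ι → Γ → Prop} (hP : ∀ i, LSP (P i)) :
    LSP (fun γ => ∃ i, P i γ) := by
  have := Fintype.ofFinite ι
  refine (LSP.lt LS.zero (LS.finsetSum hP Finset.univ)).congr fun γ => ?_
  rw [Nat.pos_iff_ne_zero, Ne, Finset.sum_eq_zero_iff]
  constructor
  · intro h
    by_contra! h'
    exact h fun i _ => ind_false (h' i)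
  · rintro ⟨i, hP⟩ h
    have := h i (Finset.mem_univ i)
    rw [ind_true hP] at this
    exact one_ne_zero this

theorem LS.ite {P : Γ → Prop} [∀ γ, Decidable (P γ)] {F G : Γ → ℕ} (hP : LSP P) (hF : LS F)
    (hG : LS G) : LS (fun γ => if P γ then F γ else G γ) := by
  refine ((LS.mul hP hF).add (hP.not.mul hG)).congr fun γ => ?_
  by_cases h : P γ <;> simp [ind, h]

/-- A function with finite support may be arbitrary: it is given by a table. -/
theorem LS.table {h : ℕ → ℕ} (hh : ∃ N, ∀ n ≥ N, h n = 0) {A : Γ → ℕ} (hA : LS A) :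
    LS (fun γ => h (A γ)) := by
  obtain ⟨N, hN⟩ := hh
  refine (LS.finsetSum (F := fun i γ => if A γ = i then h i else 0)
    (fun i => LS.ite (LSP.eq hA (LS.const i)) (LS.const _) LS.zero) (Finset.range N)).congr
    fun γ => ?_
  rw [Finset.sum_ite_eq]
  split
  · rfl
  · exact (hN _ (by simp_all)).symm

/-- A bounded function is found by counting the numbers below it. -/
theorem LS.count {P : Γ → ℕ → Prop} {N : Γ → ℕ} (hP : LSP (fun p : Γ × ℕ => P p.1 p.2))
    (hN : LS N) (F : Γ → ℕ) (hF : ∀ γ, F γ ≤ N γ) (hPF : ∀ γ, ∀ i < N γ, P γ i ↔ i < F γ) :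
    LS F := by
  refine (LS.sum (F := fun γ i => ind (P γ i)) hP hN).congr fun γ => ?_
  calc ∑ i ∈ Finset.range (N γ), ind (P γ i)
      = ∑ i ∈ Finset.range (N γ), if i < F γ then 1 else 0 := by
        refine Finset.sum_congr rfl fun i hi => ?_
        have := hPF γ i (Finset.mem_range.1 hi)
        by_cases h : i < F γ <;> simp [ind, this, h]
    _ = F γ := by
        rw [← Finset.sum_filter, Finset.sum_const, smul_eq_mul, mul_one]
        have : (Finset.range (N γ)).filter (· < F γ) = Finset.range (F γ) := by
          ext i; simp; have := hF γ; omega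
        rw [this, Finset.card_range]

theorem LS.div {F G : Γ → ℕ} (hF : LS F) (hG : LS G) : LS (fun γ => F γ / G γ) := by
  refine LS.count (P := fun γ i => (i + 1) * G γ ≤ F γ ∧ 0 < G γ)
    ((LSP.le (LS.snd.succ.mul hG.weaken) hF.weaken).and (LSP.lt LS.zero hG.weaken)) hF _
    (fun γ => Nat.div_le_self _ _) fun γ i _ => ?_
  rcases Nat.eq_zero_or_pos (G γ) with h | h
  · simp [h]
  · rw [and_iff_left h, ← Nat.le_div_iff_mul_le h]; rfl

theorem LS.mod {F G : Γ → ℕ} (hF : LS F) (hG : LS G) : LS (fun γ => F γ % G γ) := by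
  refine (hF.sub (hG.mul (hF.div hG))).congr fun γ => ?_
  have := Nat.div_add_mod (F γ) (G γ)
  omega

theorem LS.sqrt {F : Γ → ℕ} (hF : LS F) : LS (fun γ => (F γ).sqrt) := by
  refine LS.count (P := fun γ i => (i + 1) * (i + 1) ≤ F γ)
    (LSP.le (LS.snd.succ.mul LS.snd.succ) hF.weaken) hF _ (fun γ => Nat.sqrt_le_self _)
    fun γ i _ => ?_
  rw [← Nat.le_sqrt]; rfl

theorem LS.pair {F G : Γ → ℕ} (hF : LS F) (hG : LS G) : LS (fun γ => Nat.pair (F γ) (G γ)) :=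
  LS.ite (LSP.lt hF hG) ((hG.mul hG).add hF) (((hF.mul hF).add hF).add hG)

theorem LS.unpair_fst {F : Γ → ℕ} (hF : LS F) : LS (fun γ => (F γ).unpair.1) := by
  refine (LS.ite (LSP.lt (hF.sub (hF.sqrt.mul hF.sqrt)) hF.sqrt)
    (hF.sub (hF.sqrt.mul hF.sqrt)) hF.sqrt).congr fun γ => ?_
  simp only [Nat.unpair]
  split <;> rfl

theorem LS.unpair_snd {F : Γ → ℕ} (hF : LS F) : LS (fun γ => (F γ).unpair.2) := by
  refine (LS.ite (LSP.lt (hF.sub (hF.sqrt.mul hF.sqrt)) hF.sqrt) hF.sqrt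
    ((hF.sub (hF.sqrt.mul hF.sqrt)).sub hF.sqrt)).congr fun γ => ?_
  simp only [Nat.unpair]
  split <;> rfl

theorem inputSymbol_succ_eq_letter {w : List X} {p : ℕ} {x : X} :
    Transducer.inputSymbol w (p + 1) = .letter x ↔ w[p]? = some x := by
  rw [Transducer.inputSymbol]
  cases w[p]? <;> simp

open Classical in
theorem LSP.getElem_inp {A : Γ → ℕ} (hA : LS A) (x : X) :
    LSP (fun γ => (inp γ)[A γ]? = some x) := by
  refine (LS.inputSymbol (fun s => decide (s = .letter x)) hA.succ).congr fun γ => ?_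
  by_cases h : (inp γ)[A γ]? = some x
  · rw [ind_true h, if_pos (decide_eq_true (inputSymbol_succ_eq_letter.2 h))]
  · rw [ind_false h, if_neg fun h' =>
      h (inputSymbol_succ_eq_letter.1 (of_decide_eq_true h'))]

end

/-! ### Word functions given by length and letters -/

section

variable {X Γ Δ Z Z' : Type*} [Ctx X Γ] [Ctx X Δ]

/-- The length of the word is a function in the class `LS`, and so is the test for each letter at a
given place. -/
structure LSList (g : Γ → List Z) : Prop where
  length : LS (fun γ => (g γ).length)
  letter : ∀ z, LSP (fun p : Γ × ℕ => (g p.1)[p.2]? = some z)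

namespace LSList

theorem congr {f g : Γ → List Z} (hf : LSList f) (h : ∀ γ, f γ = g γ) : LSList g :=
  (funext h : f = g) ▸ hf

theorem comp {g : Γ → List Z} (hg : LSList g) {s : Δ → Γ} (hs : Subst s) :
    LSList (fun δ => g (s δ)) :=
  ⟨hg.length.comp hs, fun z => (hg.letter z).comp (hs.weaken.pair LS.snd)⟩

theorem weaken {g : Γ → List Z} (hg : LSList g) : LSList (fun p : Γ × ℕ => g p.1) :=
  hg.comp Subst.fst

theorem letterAt {g : Γ → List Z} (hg : LSList g) {A : Γ → ℕ} (hA : LS A) (z : Z) :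
    LSP (fun γ => (g γ)[A γ]? = some z) :=
  (hg.letter z).comp (Subst.id.pair hA)

theorem inp : LSList (fun γ : Γ => Ctx.inp γ) :=
  ⟨LS.length_inp, fun x => LSP.getElem_inp LS.snd x⟩

theorem nil : LSList (fun _ : Γ => ([] : List Z)) :=
  ⟨LS.zero, fun z => (LSP.const False).congr fun _ => by simp⟩

theorem singleton (z : Z) : LSList (fun _ : Γ => [z]) :=
  ⟨LS.const 1, fun z' => ((LSP.eq LS.snd LS.zero).and (LSP.const (z = z'))).congr fun p => by
    rcases p.2 with _ | n <;> simp⟩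

theorem append {f g : Γ → List Z} (hf : LSList f) (hg : LSList g) :
    LSList (fun γ => f γ ++ g γ) := by
  refine ⟨(hf.length.add hg.length).congr fun _ => List.length_append.symm, fun z => ?_⟩
  refine (((LSP.lt LS.snd hf.length.weaken).and (hf.letter z)).or
    ((LSP.le hf.length.weaken LS.snd).and
      (hg.weaken.letterAt (LS.snd.sub hf.length.weaken) z))).congr fun p => ?_
  rcases lt_or_ge p.2 (f p.1).length with h | h
  · simp [List.getElem?_append_left h, h, not_le.2 h]
  · simp [List.getElem?_append_right h, h, not_lt.2 h]

theorem const (l : List Z) : LSList (fun _ : Γ => l) := by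
  induction l with
  | nil => exact nil
  | cons z l ih => exact (singleton z).append ih

theorem ite {P : Γ → Prop} [∀ γ, Decidable (P γ)] {f g : Γ → List Z} (hP : LSP P) (hf : LSList f)
    (hg : LSList g) : LSList (fun γ => if P γ then f γ else g γ) := by
  refine ⟨(LS.ite hP hf.length hg.length).congr fun _ => by split <;> rfl, fun z => ?_⟩
  refine ((hP.weaken.and (hf.letter z)).or (hP.weaken.not.and (hg.letter z))).congr fun p => ?_
  by_cases h : P p.1 <;> simp [h]

theorem length_flatMap_range (f : ℕ → List Z) (n : ℕ) :
    ((List.range n).flatMap f).length = ∑ i ∈ Finset.range n, (f i).length := by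
  induction n with
  | zero => rfl
  | succ n ih => rw [List.range_succ, List.flatMap_append, List.length_append, ih,
      Finset.sum_range_succ]; simp

theorem getElem?_flatMap_range (f : ℕ → List Z) (n j : ℕ) (z : Z) :
    ((List.range n).flatMap f)[j]? = some z ↔
      ∃ i < n, ∑ k ∈ Finset.range i, (f k).length ≤ j ∧
        (f i)[j - ∑ k ∈ Finset.range i, (f k).length]? = some z := by
  induction n with
  | zero => simp
  | succ n ih =>
    rw [List.range_succ, List.flatMap_append, List.flatMap_singleton, Nat.exists_lt_succ_right,
      ← ih]
    rcases lt_or_ge j ((List.range n).flatMap f).length with h | h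
    · rw [List.getElem?_append_left h]
      rw [length_flatMap_range] at h
      simp [not_le.2 h]
    · rw [List.getElem?_append_right h, List.getElem?_eq_none h, length_flatMap_range]
      rw [length_flatMap_range] at h
      simp [h]

/-- A concatenation of a computed number of words. A place in it is found by summing up the lengths
of the words, none of which is stored. -/
theorem flatMapRange {f : Γ → ℕ → List Z} {N : Γ → ℕ}
    (hf : LSList (fun p : Γ × ℕ => f p.1 p.2)) (hN : LS N) :
    LSList (fun γ => (List.range (N γ)).flatMap (f γ)) := by
  have hS : LS (fun p : Γ × ℕ => ∑ k ∈ Finset.range p.2, (f p.1 k).length) :=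
    LS.sum (Γ := Γ × ℕ) (F := fun p k => (f p.1 k).length)
      (hf.length.comp (Subst.fst.weaken.pair LS.snd)) LS.snd
  refine ⟨(LS.sum (F := fun γ i => (f γ i).length) hf.length hN).congr fun γ =>
    (length_flatMap_range _ _).symm, fun z => ?_⟩
  have hS' : LS (fun q : (Γ × ℕ) × ℕ => ∑ k ∈ Finset.range q.2, (f q.1.1 k).length) :=
    hS.comp (Subst.fst.weaken.pair LS.snd)
  refine (LSP.exists_lt (Γ := Γ × ℕ) (P := fun p i =>
      ∑ k ∈ Finset.range i, (f p.1 k).length ≤ p.2 ∧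
        (f p.1 i)[p.2 - ∑ k ∈ Finset.range i, (f p.1 k).length]? = some z)
    (LSP.and (LSP.le hS' LS.snd.weaken) ?_) hN.weaken).congr fun p =>
      (getElem?_flatMap_range _ _ _ _).symm
  exact (hf.comp (s := fun q : (Γ × ℕ) × ℕ => (q.1.1, q.2)) (Subst.fst.weaken.pair LS.snd)).letterAt
    (LS.snd.weaken.sub hS') z

/-- Case distinction on the letter at a computed place. -/
theorem letterCases [Finite Z] {g : Γ → List Z} {A : Γ → ℕ} {h : Z → Γ → List Z'} (hg : LSList g)
    (hA : LS A) (hh : ∀ z, LSList (h z)) :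
    LSList (fun γ => (g γ)[A γ]?.elim [] (fun z => h z γ)) := by
  classical
  have := Fintype.ofFinite Z
  refine ⟨(LS.finsetSum (fun z => LS.ite (hg.letterAt hA z) (hh z).length LS.zero)
    Finset.univ).congr fun γ => ?_, fun z' => (LSP.exists_fintype fun z =>
      (hg.letterAt hA z).weaken.and ((hh z).letter z')).congr fun p => ?_⟩
  · rcases (g γ)[A γ]? with _ | z <;> simp
  · rcases (g p.1)[A p.1]? with _ | z <;> simp

theorem list_eq_flatMap_range (l : List Z) (h : Z → List Z') :
    l.flatMap h = (List.range l.length).flatMap fun i => l[i]?.elim [] h := by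
  induction l using List.reverseRecOn with
  | nil => rfl
  | append_singleton l z ih =>
    rw [List.flatMap_append, ih, List.length_append, List.length_singleton, List.range_succ,
      List.flatMap_append]
    congr 1
    · simp only [List.flatMap]
      congr 1
      refine List.map_congr_left fun i hi => ?_
      rw [List.getElem?_append_left (List.mem_range.1 hi)]
    · simp

theorem flatMap [Finite Z] {g : Γ → List Z} (hg : LSList g) (h : Z → List Z') :
    LSList (fun γ => (g γ).flatMap h) :=
  (flatMapRange (f := fun γ i => (g γ)[i]?.elim [] h)
    (letterCases hg.weaken LS.snd fun z => const (h z)) hg.length).congr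
    fun _ => (list_eq_flatMap_range _ _).symm

theorem map [Finite Z] {g : Γ → List Z} (hg : LSList g) (h : Z → Z') :
    LSList (fun γ => (g γ).map h) :=
  (hg.flatMap fun z => [h z]).congr fun γ => by
    induction g γ with
    | nil => rfl
    | cons a l ih => simp_all

theorem filterMap [Finite Z] {g : Γ → List Z} (hg : LSList g) (h : Z → Option Z') :
    LSList (fun γ => (g γ).filterMap h) :=
  (hg.flatMap fun z => (h z).toList).congr fun γ => by
    induction g γ with
    | nil => rfl
    | cons a l ih => cases ha : h a <;> simp_all

theorem take {g : Γ → List Z} (hg : LSList g) {A : Γ → ℕ} (hA : LS A) :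
    LSList (fun γ => (g γ).take (A γ)) := by
  refine ⟨(LS.ite (LSP.le hA hg.length) hA hg.length).congr fun γ => ?_, fun z =>
    ((LSP.lt LS.snd hA.weaken).and (hg.letter z)).congr fun p => ?_⟩
  · rw [List.length_take]; split <;> omega
  · rw [List.getElem?_take]; split <;> simp_all

theorem reverse {g : Γ → List Z} (hg : LSList g) : LSList (fun γ => (g γ).reverse) := by
  refine ⟨hg.length.congr fun γ => List.length_reverse.symm, fun z =>
    ((LSP.lt LS.snd hg.length.weaken).and
      (hg.weaken.letterAt ((hg.length.weaken.sub (LS.const 1)).sub LS.snd) z)).congr fun p => ?_⟩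
  rcases lt_or_ge p.2 (g p.1).length with h | h
  · rw [List.getElem?_reverse h]
    exact and_iff_right h
  · simp [not_lt.2 h]

theorem eq [Finite Z] {f g : Γ → List Z} (hf : LSList f) (hg : LSList g) :
    LSP (fun γ => f γ = g γ) := by
  refine ((LSP.eq hf.length hg.length).and (LSP.forall_lt
    (P := fun γ i => ∃ z, (f γ)[i]? = some z ∧ (g γ)[i]? = some z)
    (LSP.exists_fintype fun z => (hf.letter z).and (hg.letter z)) hf.length)).congr fun γ => ?_
  constructor
  · rintro ⟨h1, h2⟩
    refine List.ext_getElem? fun i => ?_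
    rcases lt_or_ge i (f γ).length with h | h
    · obtain ⟨z, h3, h4⟩ := h2 i h
      rw [h3, h4]
    · rw [List.getElem?_eq_none h, List.getElem?_eq_none (h1 ▸ h)]
  · intro h
    rw [h]
    exact ⟨rfl, fun i hi => ⟨(g γ)[i], by simp [hi]⟩⟩

/-- Between words of equal length, the lexicographic order is decided at the first difference. -/
theorem lex_iff_of_length_eq {r : Z → Z → Prop} {a b : List Z} (h : a.length = b.length) :
    List.Lex r a b ↔ ∃ i < a.length, (∀ j < i, a[j]? = b[j]?) ∧
      ∃ x y, r x y ∧ a[i]? = some x ∧ b[i]? = some y := by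
  induction a generalizing b with
  | nil =>
    obtain rfl := List.length_eq_zero_iff.1 h.symm
    simp
  | cons x a ih =>
    obtain _ | ⟨y, b⟩ := b
    · simp at h
    · simp only [List.length_cons, add_left_inj] at h
      constructor
      · intro hl
        cases hl with
        | cons hl =>
          obtain ⟨i, hi, h1, h2⟩ := (ih h).1 hl
          refine ⟨i + 1, by simpa using hi, fun j hj => ?_, by simpa using h2⟩
          rcases j with _ | j
          · simp
          · simpa using h1 j (by omega)
        | rel hr => exact ⟨0, by simp, by simp, x, y, hr, by simp, by simp⟩
      · rintro ⟨i, hi, h1, h2⟩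
        rcases i with _ | i
        · obtain ⟨x', y', hr, hx, hy⟩ := h2
          simp only [List.getElem?_cons_zero, Option.some.injEq] at hx hy
          subst hx hy
          exact .rel hr
        · have := h1 0 (by omega)
          simp only [List.getElem?_cons_zero, Option.some.injEq] at this
          subst this
          refine .cons ((ih h).2 ⟨i, by simpa using hi, fun j hj => ?_, by simpa using h2⟩)
          simpa using h1 (j + 1) (by omega)

theorem shortlex [Finite Z] (r : Z → Z → Prop) {f g : Γ → List Z} (hf : LSList f)
    (hg : LSList g) : LSP (fun γ => List.Shortlex r (f γ) (g γ)) := by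
  have hlex : LSP (fun γ => ∃ i < (f γ).length,
      (∀ j < i, ∃ z, (f γ)[j]? = some z ∧ (g γ)[j]? = some z) ∧
      ∃ xy : Z × Z, r xy.1 xy.2 ∧ (f γ)[i]? = some xy.1 ∧ (g γ)[i]? = some xy.2) := by
    refine LSP.exists_lt (LSP.and ?_ ?_) hf.length
    · exact LSP.forall_lt (Γ := Γ × ℕ) (P := fun p j =>
        ∃ z, (f p.1)[j]? = some z ∧ (g p.1)[j]? = some z)
        (LSP.exists_fintype fun z => (hf.weaken.letter z).and (hg.weaken.letter z)) LS.snd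
    · exact LSP.exists_fintype fun xy => (LSP.const _).and ((hf.letter _).and (hg.letter _))
  refine ((LSP.lt hf.length hg.length).or ((LSP.eq hf.length hg.length).and hlex)).congr
    fun γ => ?_
  rw [List.shortlex_def]
  refine or_congr Iff.rfl (and_congr_right fun h => ?_)
  rw [lex_iff_of_length_eq h]
  refine exists_congr fun i => and_congr_right fun hi => and_congr ?_ ?_
  · refine forall₂_congr fun j hj => ⟨fun ⟨z, h1, h2⟩ => h1.trans h2.symm, fun h' => ?_⟩
    exact ⟨(f γ)[j], by simp, by rw [← h']; simp⟩
  · simp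

end LSList

/-- The code of a letter that a program emits. -/
noncomputable def letterCode [Finite Z] (z : Z) : ℕ := Finite.equivFin Z z

theorem letterCode_injective [Finite Z] : Function.Injective (letterCode : Z → ℕ) :=
  Fin.val_injective.comp (Finite.equivFin Z).injective

open Classical in
/-- The word of length one given by the code of a letter. -/
noncomputable def letterDecode (Z : Type*) [Finite Z] (c : ℕ) : List Z :=
  if h : ∃ z : Z, letterCode z = c then [h.choose] else []

theorem letterDecode_letterCode [Finite Z] (z : Z) : letterDecode Z (letterCode z) = [z] := by
  have h : ∃ z' : Z, letterCode z' = letterCode z := ⟨z, rfl⟩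
  rw [letterDecode, dif_pos h, letterCode_injective h.choose_spec]

/-- There is a program that emits the letter of `f w` at the place given by register `1`, provided
that register `3` has the value `1` and that the letter is in the list `l`. -/
theorem LSList.exists_emit_program [Finite Z] {f : List X → List Z} (hf : LSList f) (c₀ : ℕ)
    (l : List Z) : ∃ (p : Prog X) (c : ℕ), ∀ (w : List X) (σ : ℕ → ℕ) (h : ℕ) (z : Z), z ∈ l →
      (f w)[σ 1]? = some z → σ 1 ≤ size w ^ c₀ → σ 3 = 1 →
      ∃ σ' h', Exec w (size w ^ c) p σ h σ' h' [letterCode z] ∧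
        ∀ j < 4, j ≠ 2 → σ' j = σ j := by
  induction l with
  | nil => exact ⟨.skip, 0, by simp⟩
  | cons x l ih =>
    obtain ⟨p, c, hp⟩ := ih
    obtain ⟨q, hq⟩ := LS.program (hf.letter x) 4 (fun _ => 1) 2 (fun _ => by omega) (by omega)
    obtain ⟨c', hq⟩ := hq c₀
    refine ⟨.seq q (.ite (.eq 2 3) (.emit (letterCode x)) p), max c c',
      fun w σ h z hz hfz hb h3 => ?_⟩
    obtain ⟨σ1, h1, hE, hj, hd⟩ := hq (w, σ 1) σ h
      (varsLE_prod.2 ⟨hb, fun i => i.elim0⟩)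
      (Fin.cases rfl fun i => i.elim0)
    have hE := hE.mono (size_pow_mono w (le_max_right c c'))
    have hσ3 : σ1 3 = 1 := (hj 3 (by omega) (by omega)).trans h3
    by_cases hx : z = x
    · subst hx
      refine ⟨σ1, h1, Exec.seq hE (.iteTrue ?_ .emit), hj⟩
      rw [Cond.Holds, hd, hσ3]
      exact ind_true hfz
    · have hσ1 : σ1 1 = σ 1 := hj 1 (by omega) (by omega)
      obtain ⟨σ2, h2, hE2, hj2⟩ := hp w σ1 h1 z (by simpa [hx] using hz) (by rw [hσ1, hfz])
        (by rw [hσ1]; exact hb) hσ3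
      refine ⟨σ2, h2, Exec.seq hE (.iteFalse ?_ (hE2.mono (size_pow_mono w (le_max_left c c')))),
        fun j h4 h5 => (hj2 j h4 h5).trans (hj j h4 h5)⟩
      rw [Cond.Holds, hd, hσ3]
      have : ¬ (f w)[σ 1]? = some x := by rw [hfz]; simpa using hx
      exact (ind_false this).trans_ne zero_ne_one

/-- A word given by its length and letters can be written out letter by letter. -/
theorem LSList.logspaceComputable [Finite Z] {f : List X → List Z} (hf : LSList f) :
    LogspaceComputable f := by
  have := Fintype.ofFinite Z
  obtain ⟨c₀, hc₀⟩ := hf.length.bounded 0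
  replace hc₀ : ∀ w, (f w).length ≤ size w ^ c₀ := fun w => hc₀ w fun i => i.elim0
  obtain ⟨p, hp⟩ := hf.length.program 4 (fun _ => 1) 0 (fun _ => by omega) (by omega)
  obtain ⟨c₁, hp⟩ := hp 0
  obtain ⟨q, c₂, hq⟩ := hf.exists_emit_program c₀ Finset.univ.toList
  set C := max c₀ (max c₁ c₂) with hC
  -- Register `0` holds the length, `1` the place of the next letter, `2` the result of the test for
  -- a letter, and `3` the value `1`.
  refine LogspaceComputable.of_exec (.seq p (.seq (.zero 1) (.seq (.zero 3) (.seq (.inc 3)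
    (.whileNot (.eq 1 0) (.seq q (.inc 1))))))) (letterDecode Z) C fun w => ?_
  have hloop : ∀ t i, (f w).length = i + t → ∀ σ h, σ 0 = (f w).length → σ 1 = i → σ 3 = 1 →
      ∃ σ' h' out, Exec w (size w ^ C) (.whileNot (.eq 1 0) (.seq q (.inc 1))) σ h σ' h' out ∧
        (f w).drop i = out.flatMap (letterDecode Z) := by
    intro t
    induction t with
    | zero =>
      intro i hi σ h h0 h1 h3
      refine ⟨σ, h, [], .whileDone (by simp [Cond.Holds, h0, h1, hi]), ?_⟩
      simp [hi]
    | succ t ih =>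
      intro i hi σ h h0 h1 h3
      have hlt : i < (f w).length := by omega
      obtain ⟨σ1, k1, hE, hj⟩ := hq w σ h ((f w)[i]) (by simp) (by simp [h1, hlt])
        (by rw [h1]; exact hlt.le.trans (hc₀ w)) h3
      have hσ1 : σ1 1 = i := (hj 1 (by omega) (by omega)).trans h1
      obtain ⟨σ2, k2, out, hE2, ho⟩ := ih (i + 1) (by omega)
        (Function.update σ1 1 (σ1 1 + 1)) k1
        (by rw [Function.update_of_ne (by omega), hj 0 (by omega) (by omega), h0])
        (by simp [hσ1])
        (by rw [Function.update_of_ne (by omega), hj 3 (by omega) (by omega), h3])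
      refine ⟨σ2, k2, _, .whileStep ?_ (.seq (hE.mono (size_pow_mono w (by omega))) (.inc ?_)) hE2,
        ?_⟩
      · rw [Cond.Holds]; omega
      · rw [hσ1]
        exact hlt.trans_le ((hc₀ w).trans (size_pow_mono w (by omega)))
      · rw [List.append_nil, List.flatMap_append, ← ho]
        simp [letterDecode_letterCode]
  obtain ⟨σ1, k1, hE1, -, hv1⟩ := hp w (fun _ => 0) 0 (fun i => i.elim0) (fun i => i.elim0)
  obtain ⟨σ2, k2, out, hE2, ho⟩ := hloop (f w).length 0 (by omega)
    (Function.update (Function.update (Function.update σ1 1 0) 3 0) 3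
      (Function.update (Function.update σ1 1 0) 3 0 3 + 1)) k1 (by simpa using hv1) (by simp)
    (by simp)
  refine ⟨σ2, k2, _, .seq (hE1.mono (size_pow_mono w (by omega)))
    (.seq .zero (.seq .zero (.seq (.inc ?_) hE2))), by simpa using ho⟩
  simpa using Nat.one_le_pow _ _ (by simp)

end

/-! ### Simulation of logspace transducers -/

instance InputSymbol.instFinite {Z : Type*} [Finite Z] : Finite (InputSymbol Z) := by
  refine Finite.of_injective (β := Option (Option Z))
    (fun | .leftEnd => none | .rightEnd => some none | .letter z => some (some z)) ?_
  rintro (_ | _ | _) (_ | _ | _) h <;> simp_all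

/-- Every function on a finite type is given by a finite table, for any numbering of the type. -/
theorem exists_table {α β : Type*} [Finite α] (b : β) {e : α → ℕ} (he : Function.Injective e)
    (φ : α → β) : ∃ h : ℕ → β, (∃ N, ∀ n ≥ N, h n = b) ∧ ∀ x, h (e x) = φ x := by
  refine ⟨Function.extend e φ fun _ => b, ?_, fun x => he.extend_apply _ _ _⟩
  obtain ⟨M, hM⟩ := (Set.finite_range e).bddAbove
  refine ⟨M + 1, fun n hn => Function.extend_apply' _ _ _ ?_⟩
  rintro ⟨x, rfl⟩
  have := hM ⟨x, rfl⟩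
  omega

section

variable {X Γ Z Z' : Type*} [Ctx X Γ]

/-- The word version of `LS.table`. -/
theorem LSList.table {h : ℕ → List Z} (hh : ∃ N, ∀ n ≥ N, h n = []) {A : Γ → ℕ} (hA : LS A) :
    LSList (fun γ => h (A γ)) := by
  obtain ⟨N, hN⟩ := hh
  have key : ∀ N, LSList (fun γ => if A γ < N then h (A γ) else []) := by
    intro N
    induction N with
    | zero => exact LSList.nil.congr fun _ => by simp
    | succ N ih =>
      refine (LSList.ite (LSP.eq hA (LS.const N)) (LSList.const (h N)) ih).congr fun γ => ?_
      rcases lt_trichotomy (A γ) N with h1 | h1 | h1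
      · simp [h1, h1.ne, h1.trans (Nat.lt_succ_self N)]
      · simp [h1]
      · simp [h1.ne', not_lt.2 h1.le, not_lt.2 (Nat.succ_le_of_lt h1)]
  refine (key N).congr fun γ => ?_
  split
  · rfl
  · exact (hN _ (by omega)).symm

theorem LSList.letterCode_inputSymbol [Finite Z] {g : Γ → List Z} (hg : LSList g) {A : Γ → ℕ}
    (hA : LS A) : LS (fun γ => letterCode (Transducer.inputSymbol (g γ) (A γ))) := by
  classical
  have := Fintype.ofFinite Z
  refine (LS.ite (LSP.eq hA LS.zero) (LS.const (letterCode (InputSymbol.leftEnd : InputSymbol Z)))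
    (LS.ite (LSP.lt hA.pred hg.length)
      (LS.finsetSum (F := fun z γ => if (g γ)[A γ - 1]? = some z then
          letterCode (InputSymbol.letter z) else 0)
        (fun z => LS.ite (hg.letterAt hA.pred z) (LS.const _) LS.zero) Finset.univ)
      (LS.const (letterCode (InputSymbol.rightEnd : InputSymbol Z))))).congr fun γ => ?_
  rcases A γ with _ | p
  · simp [Transducer.inputSymbol]
  · rw [Transducer.inputSymbol]
    by_cases h : p < (g γ).length <;> simp [h]

end

/-- In base `b`, the digit at the place `p` can be read off by division. -/
theorem digit_of_sum {b : ℕ} (d : ℕ → ℕ) (hd : ∀ i, d i < b) (S p : ℕ) (hp : p < S) :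
    (∑ i ∈ Finset.range S, d i * b ^ i) / b ^ p % b = d p := by
  induction p generalizing S d with
  | zero =>
    obtain ⟨S, rfl⟩ : ∃ S', S = S' + 1 := ⟨S - 1, by omega⟩
    rw [Finset.sum_range_succ']
    have : ∑ k ∈ Finset.range S, d (k + 1) * b ^ (k + 1) =
        b * ∑ k ∈ Finset.range S, d (k + 1) * b ^ k := by
      rw [Finset.mul_sum]
      exact Finset.sum_congr rfl fun i _ => by ring
    rw [this]
    simp [Nat.mod_eq_of_lt (hd 0)]
  | succ p ih =>
    obtain ⟨S, rfl⟩ : ∃ S', S = S' + 1 := ⟨S - 1, by omega⟩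
    rw [Finset.sum_range_succ']
    have : ∑ k ∈ Finset.range S, d (k + 1) * b ^ (k + 1) =
        b * ∑ k ∈ Finset.range S, d (k + 1) * b ^ k := by
      rw [Finset.mul_sum]
      exact Finset.sum_congr rfl fun i _ => by ring
    have hb : 0 < b := (Nat.zero_le _).trans_lt (hd 0)
    rw [this, pow_succ', ← Nat.div_div_eq_div_mul, pow_zero, mul_one, Nat.mul_add_div hb,
      Nat.div_eq_of_lt (hd 0), add_zero]
    exact ih (fun i => d (i + 1)) (fun i => hd _) S (by omega)

theorem sum_digits_lt {b : ℕ} (d : ℕ → ℕ) (hd : ∀ i, d i < b) (S : ℕ) :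
    ∑ i ∈ Finset.range S, d i * b ^ i < b ^ S := by
  induction S with
  | zero => simp
  | succ S ih =>
    rw [Finset.sum_range_succ, pow_succ]
    have := hd S
    have : (d S + 1) * b ^ S ≤ b * b ^ S := Nat.mul_le_mul_right _ this
    nlinarith

/-- Tapes of logarithmic length have polynomially bounded codes. -/
theorem pow_logspace_le (b c n : ℕ) : b ^ (c * (Nat.log 2 n + 1)) ≤ (n + 2) ^ (2 * (b * c)) := by
  have h1 : 2 ^ (Nat.log 2 n + 1) ≤ (n + 2) ^ 2 := by
    rcases Nat.eq_zero_or_pos n with rfl | hn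
    · simp
    · have := Nat.pow_log_le_self 2 hn.ne'
      rw [pow_succ]
      nlinarith
  calc b ^ (c * (Nat.log 2 n + 1)) ≤ (2 ^ b) ^ (c * (Nat.log 2 n + 1)) :=
        Nat.pow_le_pow_left Nat.lt_two_pow_self.le _
    _ = (2 ^ (Nat.log 2 n + 1)) ^ (b * c) := by rw [← pow_mul, ← pow_mul]; ring_nf
    _ ≤ ((n + 2) ^ 2) ^ (b * c) := Nat.pow_le_pow_left h1 _
    _ = _ := by rw [← pow_mul]

theorem Nat.pair_mono {a a' b b' : ℕ} (ha : a ≤ a') (hb : b ≤ b') :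
    Nat.pair a b ≤ Nat.pair a' b' := by
  have h1 : Nat.pair a b ≤ Nat.pair a' b := by
    rcases ha.eq_or_lt with rfl | h
    exacts [le_rfl, (Nat.pair_lt_pair_left b h).le]
  have h2 : Nat.pair a' b ≤ Nat.pair a' b' := by
    rcases hb.eq_or_lt with rfl | h
    exacts [le_rfl, (Nat.pair_lt_pair_right a' h).le]
  exact h1.trans h2

namespace Transducer

variable {Z Z' : Type*} (M : Transducer Z Z')

/-- The configuration after `t` transitions, or the last one if the machine has halted before. -/
def conf (u : List Z) (t : ℕ) : M.Config := (fun c => (M.step u c).getD c)^[t] M.init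

/-- What the machine emits in its next transition; nothing if it halts. -/
def emission (u : List Z) (c : M.Config) : List Z' :=
  ((M.trans c.state (inputSymbol u c.inputPos) (c.work c.workPos)).map
    TransducerAction.emit).getD []

theorem conf_succ (u : List Z) (t : ℕ) :
    M.conf u (t + 1) = (M.step u (M.conf u t)).getD (M.conf u t) :=
  Function.iterate_succ_apply' _ _ _

theorem conf_reachable (u : List Z) (t : ℕ) : M.Reachable u (M.conf u t) := by
  induction t with
  | zero => exact Relation.ReflTransGen.refl
  | succ t ih =>
    rw [conf_succ]
    rcases h : M.step u (M.conf u t) with _ | c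
    · exact ih
    · exact Relation.ReflTransGen.tail ih h

theorem Reachable.exists_conf {u : List Z} {c : M.Config} (h : M.Reachable u c) :
    ∃ t, M.conf u t = c := by
  induction h with
  | refl => exact ⟨0, rfl⟩
  | tail _ h ih =>
    obtain ⟨t, rfl⟩ := ih
    refine ⟨t + 1, ?_⟩
    rw [conf_succ, show M.step u (M.conf u t) = some _ from h, Option.getD_some]

theorem conf_inputPos_le (u : List Z) (t : ℕ) : (M.conf u t).inputPos ≤ u.length + 1 := by
  induction t with
  | zero => exact Nat.zero_le _
  | succ t ih =>
    rw [conf_succ]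
    rcases h : M.step u (M.conf u t) with _ | c
    · exact ih
    · obtain ⟨a, -, rfl⟩ := Option.map_eq_some_iff.1 h
      exact min_le_right _ _

theorem conf_output (u : List Z) (t : ℕ) :
    (M.conf u t).output = (List.range t).flatMap fun s => M.emission u (M.conf u s) := by
  induction t with
  | zero => rfl
  | succ t ih =>
    rw [conf_succ, List.range_succ, List.flatMap_append, ← ih, List.flatMap_singleton, emission,
      step]
    rcases M.trans (M.conf u t).state (inputSymbol u (M.conf u t).inputPos)
      ((M.conf u t).work (M.conf u t).workPos) with _ | a <;> simp

theorem conf_of_halt {u : List Z} {T : ℕ} (h : M.step u (M.conf u T) = none) (t : ℕ) (ht : T ≤ t) :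
    M.conf u t = M.conf u T := by
  induction t, ht using Nat.le_induction with
  | base => rfl
  | succ t _ ih => rw [conf_succ, ih, h, Option.getD_none]

/-! ### Codes of configurations -/

/-- The base for the code of the work tape; it is at least `2`. -/
noncomputable def base : ℕ := Nat.card M.Work + 1

open Classical in
/-- The code of a work symbol; blank has the code `0`. -/
noncomputable def workCode (a : M.Work) : ℕ :=
  have := M.finiteWork
  if a = M.blank then 0 else letterCode a + 1

theorem workCode_lt (a : M.Work) : M.workCode a < M.base := by
  have := M.finiteWork
  unfold workCode base letterCode
  have := (Finite.equivFin M.Work a).2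
  dsimp only
  split <;> omega

theorem two_le_base : 2 ≤ M.base := by
  have := M.finiteWork
  have : Nonempty M.Work := ⟨M.blank⟩
  have := Nat.card_pos (α := M.Work)
  unfold base
  omega

theorem workCode_blank : M.workCode M.blank = 0 := by simp [workCode]

theorem workCode_injective : Function.Injective M.workCode := by
  have := M.finiteWork
  intro a a' h
  unfold workCode at h
  dsimp only at h
  split at h <;> split at h
  · simp_all
  · omega
  · omega
  · exact letterCode_injective (by omega)

/-- The code of a state. -/
noncomputable def stateCode (q : M.State) : ℕ :=
  have := M.finiteState
  letterCode q

theorem stateCode_injective : Function.Injective M.stateCode := by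
  have := M.finiteState
  exact letterCode_injective

/-- The code of the work tape restricted to its first `S` squares: a number whose digits in base
`base M` are the codes of the symbols. -/
noncomputable def tapeCode (S : ℕ) (T : ℕ → M.Work) : ℕ :=
  ∑ i ∈ Finset.range S, M.workCode (T i) * M.base ^ i

/-- The code of a configuration with its work head within the first `S` squares. The position `p` of
the work head is represented by the power `base M ^ p`, by which the scanned digit can be read off.
The output is left out. -/
noncomputable def code (S : ℕ) (c : M.Config) : ℕ :=
  Nat.pair (M.stateCode c.state) (Nat.pair c.inputPos
    (Nat.pair (M.tapeCode S c.work) (M.base ^ c.workPos)))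

theorem tapeCode_update {S p : ℕ} (T : ℕ → M.Work) (a : M.Work) (hp : p < S) :
    M.tapeCode S (Function.update T p a) =
      M.tapeCode S T + M.workCode a * M.base ^ p - M.workCode (T p) * M.base ^ p := by
  have h1 : ∀ T : ℕ → M.Work, M.tapeCode S T = M.workCode (T p) * M.base ^ p +
      ∑ i ∈ (Finset.range S).erase p, M.workCode (T i) * M.base ^ i := fun T =>
    (Finset.add_sum_erase _ _ (Finset.mem_range.2 hp)).symm
  have h2 : ∑ i ∈ (Finset.range S).erase p, M.workCode (Function.update T p a i) * M.base ^ i =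
      ∑ i ∈ (Finset.range S).erase p, M.workCode (T i) * M.base ^ i :=
    Finset.sum_congr rfl fun i hi => by rw [Function.update_of_ne (Finset.ne_of_mem_erase hi)]
  rw [h1 T, h1, h2, Function.update_self]
  omega

theorem halts_iff (u : List Z) (c : M.Config) : M.step u c = none ↔
    M.trans c.state (inputSymbol u c.inputPos) (c.work c.workPos) = none := by
  simp [step]

/-- A bound for the codes of configurations in terms of the length of the input. -/
noncomputable def codeBound (k n : ℕ) : ℕ :=
  Nat.pair (Nat.card M.State) (Nat.pair (n + 1) (Nat.pair ((n + 2) ^ k) ((n + 2) ^ k)))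

theorem code_le_codeBound {c : ℕ} {u : List Z} {d : M.Config} (h1 : d.inputPos ≤ u.length + 1)
    (h2 : d.workPos < c * (Nat.log 2 u.length + 1)) :
    M.code (c * (Nat.log 2 u.length + 1)) d ≤ M.codeBound (2 * (M.base * c)) u.length := by
  have := M.finiteState
  have h3 := pow_logspace_le M.base c u.length
  have h4 := M.two_le_base
  refine Nat.pair_mono (Finite.equivFin M.State d.state).2.le (Nat.pair_mono h1
    (Nat.pair_mono ?_ ?_))
  · exact (sum_digits_lt (fun i => M.workCode (d.work i)) (fun _ => M.workCode_lt _) _).le.trans h3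
  · exact (Nat.pow_le_pow_right (by omega) h2.le).trans h3

variable [Finite Z]

/-- The code of the arguments of the transition function. -/
noncomputable def argCode (x : M.State × InputSymbol Z × M.Work) : ℕ :=
  Nat.pair (M.stateCode x.1) (Nat.pair (letterCode x.2.1) (M.workCode x.2.2))

theorem argCode_injective : Function.Injective M.argCode := by
  rintro ⟨q, s, a⟩ ⟨q', s', a'⟩ h
  simp only [argCode, Nat.pair_eq_pair] at h
  obtain ⟨h1, h2, h3⟩ := h
  rw [M.stateCode_injective h1, letterCode_injective h2, M.workCode_injective h3]

/-- The arguments of the transition function, coded, as read off from the code `n` of a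
configuration. -/
noncomputable def scan (u : List Z) (n : ℕ) : ℕ :=
  Nat.pair n.unpair.1 (Nat.pair (letterCode (inputSymbol u n.unpair.2.unpair.1))
    (n.unpair.2.unpair.2.unpair.1 / n.unpair.2.unpair.2.unpair.2 % M.base))

theorem scan_code (u : List Z) {S : ℕ} (c : M.Config) (hc : c.workPos < S) :
    M.scan u (M.code S c) = M.argCode (c.state, inputSymbol u c.inputPos, c.work c.workPos) := by
  simp only [scan, code, Nat.unpair_pair, argCode, tapeCode]
  rw [digit_of_sum (fun i => M.workCode (c.work i)) (fun _ => M.workCode_lt _) _ _ hc]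

theorem LS_scan {X Γ : Type*} [Ctx X Γ] {g : Γ → List Z} {A : Γ → ℕ} (hg : LSList g)
    (hA : LS A) : LS (fun γ => M.scan (g γ) (A γ)) :=
  hA.unpair_fst.pair ((hg.letterCode_inputSymbol hA.unpair_snd.unpair_fst).pair
    ((hA.unpair_snd.unpair_snd.unpair_fst.div hA.unpair_snd.unpair_snd.unpair_snd).mod
      (LS.const _)))

/-- The code of a head move. -/
def moveCode : HeadMove → ℕ
  | .left => 0
  | .stay => 1
  | .right => 2

/-- A head move in terms of the position of the head. -/
theorem HeadMove_apply_eq (m : HeadMove) (p : ℕ) :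
    m.apply p = if moveCode m = 0 then p - 1 else if moveCode m = 1 then p else p + 1 := by
  cases m <;> rfl

/-- A head move in terms of the power of `b` that represents the position. -/
theorem pow_HeadMove_apply {b : ℕ} (hb : 2 ≤ b) (m : HeadMove) (p : ℕ) :
    b ^ m.apply p = if moveCode m = 0 then (if b ^ p = 1 then 1 else b ^ p / b) else
      if moveCode m = 1 then b ^ p else b ^ p * b := by
  cases m
  · rcases p with _ | p
    · simp [moveCode, HeadMove.apply]
    · have h1 : b ^ (p + 1) ≠ 1 := (Nat.one_lt_pow (by omega) (by omega)).ne'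
      rw [HeadMove.apply, moveCode, if_pos rfl, if_neg h1, Nat.add_sub_cancel, pow_succ,
        Nat.mul_div_cancel _ (show 0 < b by omega)]
  · simp [moveCode, HeadMove.apply]
  · simp [moveCode, HeadMove.apply, pow_succ]

/-! ### Runs on codes -/

/-- The transition function in terms of codes is in the class `LS`. -/
theorem exists_codeStep {X : Type*} {Z : Type*} {Z' : Type*} [Finite Z] (M : Transducer Z Z') :
    ∃ F : List Z → ℕ → ℕ,
      (∀ (u : List Z) (S : ℕ) (c : M.Config), c.inputPos ≤ u.length + 1 → c.workPos < S →
        F u (M.code S c) = M.code S ((M.step u c).getD c)) ∧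
      ∀ {Γ : Type*} [Ctx X Γ] {g : Γ → List Z} {A : Γ → ℕ}, LSList g → LS A →
        LS (fun γ => F (g γ) (A γ)) := by
  have := M.finiteState
  have := M.finiteWork
  have htab := fun v : TransducerAction M.State M.Work Z' → ℕ =>
    exists_table 0 M.argCode_injective fun x => ((M.trans x.1 x.2.1 x.2.2).map v).getD 0
  obtain ⟨hH, sH, eH⟩ := htab fun _ => 1
  obtain ⟨hQ, sQ, eQ⟩ := htab fun t => M.stateCode t.state
  obtain ⟨hA, sA, eA⟩ := htab fun t => M.workCode t.write
  obtain ⟨hI, sI, eI⟩ := htab fun t => moveCode t.inputMove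
  obtain ⟨hW, sW, eW⟩ := htab fun t => moveCode t.workMove
  refine ⟨fun u n =>
    if hH (M.scan u n) = 0 then n else Nat.pair (hQ (M.scan u n)) (Nat.pair
      (if u.length + 1 ≤ (if hI (M.scan u n) = 0 then n.unpair.2.unpair.1 - 1 else
          if hI (M.scan u n) = 1 then n.unpair.2.unpair.1 else n.unpair.2.unpair.1 + 1)
        then u.length + 1 else (if hI (M.scan u n) = 0 then n.unpair.2.unpair.1 - 1 else
          if hI (M.scan u n) = 1 then n.unpair.2.unpair.1 else n.unpair.2.unpair.1 + 1))
      (Nat.pair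
        (n.unpair.2.unpair.2.unpair.1 + hA (M.scan u n) * n.unpair.2.unpair.2.unpair.2 -
          n.unpair.2.unpair.2.unpair.1 / n.unpair.2.unpair.2.unpair.2 % M.base *
            n.unpair.2.unpair.2.unpair.2)
        (if hW (M.scan u n) = 0 then (if n.unpair.2.unpair.2.unpair.2 = 1 then 1 else
            n.unpair.2.unpair.2.unpair.2 / M.base) else
          if hW (M.scan u n) = 1 then n.unpair.2.unpair.2.unpair.2 else
            n.unpair.2.unpair.2.unpair.2 * M.base))), ?_, ?_⟩
  · intro u S c hpos hS
    simp only [M.scan_code u c hS, eH, eQ, eA, eI, eW]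
    rcases h : M.trans c.state (inputSymbol u c.inputPos) (c.work c.workPos) with _ | a
    · rw [(M.halts_iff u c).2 h]
      simp
    · simp only [step, h, Option.map_some, Option.getD_some, one_ne_zero, if_false]
      simp only [code, Nat.unpair_pair, ← HeadMove_apply_eq, ← pow_HeadMove_apply M.two_le_base,
        M.tapeCode_update _ _ hS]
      rw [show M.tapeCode S c.work / M.base ^ c.workPos % M.base = M.workCode (c.work c.workPos)
        from digit_of_sum (fun i => M.workCode (c.work i)) (fun _ => M.workCode_lt _) _ _ hS]
      congr 2
      split <;> omega
  · intro Γ _ g A hg hA'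
    have hx := M.LS_scan hg hA'
    have h1 := hA'.unpair_snd.unpair_fst
    have h2 := hA'.unpair_snd.unpair_snd.unpair_fst
    have h3 := hA'.unpair_snd.unpair_snd.unpair_snd
    have hp := LS.ite (LSP.eq (LS.table sI hx) LS.zero) h1.pred
      (LS.ite (LSP.eq (LS.table sI hx) (LS.const 1)) h1 h1.succ)
    exact LS.ite (LSP.eq (LS.table sH hx) LS.zero) hA' ((LS.table sQ hx).pair
      ((LS.ite (LSP.le hg.length.succ hp) hg.length.succ hp).pair
        (((h2.add ((LS.table sA hx).mul h3)).sub (((h2.div h3).mod (LS.const _)).mul h3)).pair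
          (LS.ite (LSP.eq (LS.table sW hx) LS.zero)
            (LS.ite (LSP.eq h3 (LS.const 1)) (LS.const 1) (h3.div (LS.const _)))
            (LS.ite (LSP.eq (LS.table sW hx) (LS.const 1)) h3 (h3.mul (LS.const _)))))))

/-- The machine halts in polynomial time, because a configuration that recurs before the halt would
recur forever. -/
theorem exists_halt_le {c : ℕ} {u : List Z} {z : List Z'} (hout : M.Outputs u z)
    (hsp : M.UsesSpace u (c * (Nat.log 2 u.length + 1))) :
    ∃ T ≤ M.codeBound (2 * (M.base * c)) u.length,
      M.step u (M.conf u T) = none ∧ (M.conf u T).output = z := by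
  classical
  obtain ⟨F, hF, -⟩ := exists_codeStep.{_, _, _, 0} (X := Z) M
  obtain ⟨e, he, hhalt, rfl⟩ := hout
  obtain ⟨T₀, rfl⟩ := he.exists_conf
  have hex : ∃ T, M.step u (M.conf u T) = none := ⟨T₀, hhalt⟩
  set S := c * (Nat.log 2 u.length + 1) with hS
  have hlt : ∀ t, (M.conf u t).workPos < S := fun t => hsp _ (M.conf_reachable u t)
  have hstep : ∀ t, F u (M.code S (M.conf u t)) = M.code S (M.conf u (t + 1)) := fun t => by
    rw [conf_succ, hF u S _ (M.conf_inputPos_le u t) (hlt t)]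
  have hhalts : ∀ s t, M.code S (M.conf u s) = M.code S (M.conf u t) →
      M.step u (M.conf u s) = none → M.step u (M.conf u t) = none := by
    intro s t hst
    have := M.argCode_injective
      ((M.scan_code u _ (hlt s)).symm.trans ((congrArg (M.scan u) hst).trans
        (M.scan_code u _ (hlt t))))
    simp only [Prod.mk.injEq] at this
    rw [halts_iff, halts_iff, this.1, this.2.1, this.2.2]
    exact id
  refine ⟨Nat.find hex, ?_, Nat.find_spec hex, ?_⟩
  · have hinj : ∀ i j, i < j → j ≤ Nat.find hex →
        M.code S (M.conf u i) ≠ M.code S (M.conf u j) := by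
      intro i j hij hj h
      have hm : ∀ m, M.code S (M.conf u (i + m)) = M.code S (M.conf u (j + m)) := by
        intro m
        induction m with
        | zero => exact h
        | succ m ih => rw [← Nat.add_assoc, ← Nat.add_assoc, ← hstep, ← hstep, ih]
      have := hm (Nat.find hex - j)
      rw [show j + (Nat.find hex - j) = Nat.find hex by omega] at this
      exact Nat.find_min hex (show i + (Nat.find hex - j) < Nat.find hex by omega)
        (hhalts _ _ this.symm (Nat.find_spec hex))
    have := Finset.card_le_card_of_injOn (s := Finset.range (Nat.find hex + 1))
      (t := Finset.range (M.codeBound (2 * (M.base * c)) u.length + 1))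
      (fun t => M.code S (M.conf u t))
      (fun t _ => by
        simpa [Nat.lt_succ_iff] using M.code_le_codeBound (M.conf_inputPos_le u t) (hlt t))
      (fun i hi j hj h => by
        simp only [Finset.coe_range, Set.mem_Iio] at hi hj
        by_contra hne
        rcases Nat.lt_or_gt_of_ne hne with h' | h'
        · exact hinj i j h' (by omega) h
        · exact hinj j i h' (by omega) h.symm)
    simpa using this
  · rw [M.conf_of_halt (Nat.find_spec hex) T₀ (Nat.find_le hhalt)]

end Transducer

/-- A logspace computable function may be applied to a word that is itself given by length and
letters in the class `LS`. -/
theorem LogspaceComputable.comp_LSList {X Γ Z Z' : Type*} [Ctx X Γ] [Finite Z]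
    {f : List Z → List Z'} (hf : LogspaceComputable f) {g : Γ → List Z} (hg : LSList g) :
    LSList (fun γ => f (g γ)) := by
  obtain ⟨M, c, hM⟩ := hf
  obtain ⟨F, hF, hFLS⟩ := Transducer.exists_codeStep (X := X) M
  set k := 2 * (M.base * c) with hk
  set S : List Z → ℕ := fun u => c * (Nat.log 2 u.length + 1) with hS
  have hlt : ∀ u t, (M.conf u t).workPos < S u := fun u t => (hM u).2 _ (M.conf_reachable u t)
  have := M.finiteState
  have := M.finiteWork
  obtain ⟨E, sE, hE⟩ := exists_table [] M.argCode_injective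
    fun x => ((M.trans x.1 x.2.1 x.2.2).map TransducerAction.emit).getD []
  have hemit : ∀ u t, E (M.scan u (M.code (S u) (M.conf u t))) = M.emission u (M.conf u t) :=
    fun u t => by rw [M.scan_code u _ (hlt u t), hE]; rfl
  have hbound : LS (fun γ => M.codeBound k (g γ).length) :=
    (LS.const _).pair (hg.length.succ.pair
      ((hg.length.succ.succ.pow k).pair (hg.length.succ.succ.pow k)))
  have hcode : LS (fun p : Γ × ℕ => M.code (S (g p.1)) (M.conf (g p.1) p.2)) := by
    refine LS.primrec (F := fun _ => Nat.pair (M.stateCode M.start) (Nat.pair 0 (Nat.pair 0 1)))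
      (G := fun γ _ r => F (g γ) r) (R := fun γ t => M.code (S (g γ)) (M.conf (g γ) t))
      (LS.const _) (hFLS hg.weaken.weaken LS.snd) (fun γ => ?_) (fun γ t => ?_) ?_
    · have : M.tapeCode (S (g γ)) (fun _ => M.blank) = 0 := by
        simp [Transducer.tapeCode, M.workCode_blank]
      simp [Transducer.conf, Transducer.code, Transducer.init, this]
    · rw [hF _ _ _ (M.conf_inputPos_le _ _) (hlt _ _), Transducer.conf_succ]
    · exact hbound.bounded.weaken.of_le fun p =>
        M.code_le_codeBound (M.conf_inputPos_le _ _) (hlt _ _)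
  refine (LSList.flatMapRange (f := fun γ t => M.emission (g γ) (M.conf (g γ) t)) ?_ hbound).congr
    fun γ => ?_
  · exact (LSList.table sE (M.LS_scan hg.weaken hcode)).congr fun p => hemit _ _
  · obtain ⟨T, hT, hhalt, hout⟩ := M.exists_halt_le (hM (g γ)).1 (hM (g γ)).2
    rw [← M.conf_output, M.conf_of_halt hhalt _ hT, hout]

/-! ### Words and normal form functions -/

section

variable {X G : Type*} [Group G] {π : X → G}

@[simp] theorem evalWord_nil (π : X → G) : evalWord π [] = 1 := rfl

@[simp] theorem evalWord_append (π : X → G) (u v : List X) :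
    evalWord π (u ++ v) = evalWord π u * evalWord π v := by simp [evalWord]

@[simp] theorem evalWord_cons (π : X → G) (x : X) (v : List X) :
    evalWord π (x :: v) = π x * evalWord π v := by simp [evalWord]

theorem evalWord_reverse_map {i : X → X} (hi : ∀ x, π (i x) = (π x)⁻¹) (w : List X) :
    evalWord π (w.reverse.map i) = (evalWord π w)⁻¹ := by
  induction w with
  | nil => simp
  | cons x w ih =>
    rw [List.reverse_cons, List.map_append, evalWord_append, ih]
    simp [hi]

theorem IsSymmetricGenerating.evalWord_surjective (h : IsSymmetricGenerating π) :
    Function.Surjective (evalWord π) := by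
  choose i hi using h.1
  intro g
  have hg : g ∈ Subgroup.closure (Set.range π) := h.2 ▸ Subgroup.mem_top g
  induction hg using Subgroup.closure_induction with
  | mem g hg =>
    obtain ⟨x, rfl⟩ := hg
    exact ⟨[x], by simp⟩
  | one => exact ⟨[], rfl⟩
  | mul g g' _ _ h1 h2 =>
    obtain ⟨w, rfl⟩ := h1
    obtain ⟨w', rfl⟩ := h2
    exact ⟨w ++ w', by simp⟩
  | inv g _ h1 =>
    obtain ⟨w, rfl⟩ := h1
    exact ⟨_, evalWord_reverse_map hi w⟩

theorem IsSymmetricGenerating.of_surjective (h1 : ∀ x, ∃ y, π y = (π x)⁻¹)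
    (h2 : Function.Surjective (evalWord π)) : IsSymmetricGenerating π := by
  refine ⟨h1, (Subgroup.eq_top_iff' _).2 fun g => ?_⟩
  obtain ⟨w, rfl⟩ := h2 g
  refine Subgroup.list_prod_mem _ fun a ha => ?_
  obtain ⟨x, -, rfl⟩ := List.mem_map.1 ha
  exact Subgroup.subset_closure ⟨x, rfl⟩

namespace IsNormalFormFunction

variable {f : List X → List X}

theorem evalWord_eq (h : IsNormalFormFunction π f) (w : List X) :
    evalWord π (f w) = evalWord π w := by
  obtain ⟨L, -, h⟩ := h
  exact (h w).2

theorem eq_iff (h : IsNormalFormFunction π f) {u w : List X} :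
    f u = f w ↔ evalWord π u = evalWord π w := by
  refine ⟨fun h' => by rw [← h.evalWord_eq u, h', h.evalWord_eq], fun h' => ?_⟩
  have h1 := h.evalWord_eq
  obtain ⟨L, hL, h⟩ := h
  exact hL.injOn (h u).1 (h w).1 (by rw [h1, h1, h'])

theorem eq_of_mem_range (h : IsNormalFormFunction π f) {u v : List X} (hu : u ∈ Set.range f)
    (hv : v ∈ Set.range f) (huv : evalWord π u = evalWord π v) : u = v := by
  obtain ⟨u, rfl⟩ := hu
  obtain ⟨v, rfl⟩ := hv
  rwa [h.evalWord_eq, h.evalWord_eq, ← h.eq_iff] at huv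

theorem of_surjective (hs : Function.Surjective (evalWord π))
    (h1 : ∀ w, evalWord π (f w) = evalWord π w)
    (h2 : ∀ u w, evalWord π u = evalWord π w → f u = f w) : IsNormalFormFunction π f := by
  refine ⟨Set.range f, ⟨fun _ _ => Set.mem_univ _, ?_, fun g _ => ?_⟩, fun w => ⟨⟨w, rfl⟩, h1 w⟩⟩
  · rintro _ ⟨u, rfl⟩ _ ⟨w, rfl⟩ h
    rw [h1, h1] at h
    exact h2 u w h
  · obtain ⟨w, rfl⟩ := hs g
    exact ⟨f w, ⟨w, rfl⟩, h1 w⟩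

end IsNormalFormFunction

end

/-! ### Evaluation in the wreath product -/

theorem List.prod_map_ite_eq_one {ι K G : Type*} [DecidableEq K] [Monoid G] (key : ι → K)
    (val : ι → G) (l : List ι) (k : K) (h : ∀ b ∈ l, key b ≠ k) :
    (l.map fun c => if key c = k then val c else 1).prod = 1 := by
  refine List.prod_eq_one fun a ha => ?_
  obtain ⟨b, hb, rfl⟩ := List.mem_map.1 ha
  simp [h b hb]

/-- If the keys are distinct, only one factor of the product is selected. -/
theorem List.prod_map_ite_eq_of_mem {ι K G : Type*} [DecidableEq K] [Monoid G] (key : ι → K)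
    (val : ι → G) {l : List ι} (hl : l.Pairwise fun a b => key a ≠ key b) {b : ι} (hb : b ∈ l) :
    (l.map fun c => if key c = key b then val c else 1).prod = val b := by
  induction l with
  | nil => simp at hb
  | cons a l ih =>
    rw [List.pairwise_cons] at hl
    rw [List.map_cons, List.prod_cons]
    rcases List.mem_cons.1 hb with rfl | hb
    · rw [if_pos rfl, List.prod_map_ite_eq_one _ _ _ _ fun c hc => (hl.1 c hc).symm, mul_one]
    · rw [if_neg (hl.1 b hb), one_mul, ih hl.2 hb]

namespace RestrictedWreathProduct

variable {X Y G H : Type*} [Group G] [Group H] {π : X → G} {ρ : Y → H}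

theorem ext {a b : RestrictedWreathProduct G H} (h1 : ∀ h, a.1.left h = b.1.left h)
    (h2 : a.1.right = b.1.right) : a = b :=
  Subtype.ext (RegularWreathProduct.ext (funext h1) h2)

theorem mul_left (a b : RestrictedWreathProduct G H) (h : H) :
    (a * b).1.left h = a.1.left h * b.1.left (a.1.right⁻¹ * h) := rfl

theorem mul_right (a b : RestrictedWreathProduct G H) :
    (a * b).1.right = a.1.right * b.1.right := rfl

theorem base_left [DecidableEq H] (g : G) (h : H) :
    (base g : RestrictedWreathProduct G H).1.left h = if h = 1 then g else 1 := by
  by_cases hh : h = 1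
  · subst hh; simp [base]
  · simp [base, hh]

theorem base_mul (g g' : G) : (base (g * g') : RestrictedWreathProduct G H) = base g * base g' := by
  classical
  refine ext (fun h => ?_) (one_mul (1 : H)).symm
  rw [mul_left, base_left, base_left, base_left]
  by_cases hh : h = 1 <;> simp [base, hh]

theorem base_one : (base 1 : RestrictedWreathProduct G H) = 1 := by
  classical
  refine ext (fun h => ?_) rfl
  rw [base_left, ite_self]
  rfl

theorem top_mul (h h' : H) : (top (h * h') : RestrictedWreathProduct G H) = top h * top h' :=
  ext (fun _ => (one_mul (1 : G)).symm) rfl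

theorem base_inv (g : G) : (base g⁻¹ : RestrictedWreathProduct G H) = (base g)⁻¹ := by
  rw [eq_inv_iff_mul_eq_one, ← base_mul, inv_mul_cancel, base_one]

theorem top_inv (h : H) : (top h⁻¹ : RestrictedWreathProduct G H) = (top h)⁻¹ := by
  rw [eq_inv_iff_mul_eq_one, ← top_mul, inv_mul_cancel]; rfl

theorem evalWord_map_inl (u : List X) :
    evalWord (letters π ρ) (u.map Sum.inl) = base (evalWord π u) := by
  induction u with
  | nil => exact base_one.symm
  | cons x u ih => rw [List.map_cons, evalWord_cons, evalWord_cons, base_mul, ih]; rfl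

theorem evalWord_map_inr (v : List Y) :
    evalWord (letters π ρ) (v.map Sum.inr) = top (evalWord ρ v) := by
  induction v with
  | nil => rfl
  | cons x u ih => rw [List.map_cons, evalWord_cons, evalWord_cons, top_mul, ih]; rfl

/-- A block represents the function supported at the element of `v`, with value that of `u`. -/
theorem evalWord_block_left [DecidableEq H] (b : Block X Y) (h : H) :
    (evalWord (letters π ρ) b.word).1.left h =
      if evalWord ρ b.v = h then evalWord π b.u else 1 := by
  rw [Block.word, evalWord_append, evalWord_append, evalWord_map_inl, evalWord_map_inr,
    evalWord_map_inr, mul_left, mul_left, base_left]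
  simp [top, inv_mul_eq_one]

theorem evalWord_block_right {b : Block X Y} (hb : evalWord ρ b.v' = (evalWord ρ b.v)⁻¹) :
    (evalWord (letters π ρ) b.word).1.right = 1 := by
  rw [Block.word, evalWord_append, evalWord_append, evalWord_map_inl, evalWord_map_inr,
    evalWord_map_inr, mul_right, mul_right, hb]
  simp [top, base]

theorem evalWord_blocks_right {l : List (Block X Y)}
    (hl : ∀ b ∈ l, evalWord ρ b.v' = (evalWord ρ b.v)⁻¹) :
    (evalWord (letters π ρ) (l.flatMap Block.word)).1.right = 1 := by
  induction l with
  | nil => rfl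
  | cons b l ih =>
    rw [List.flatMap_cons, evalWord_append, mul_right, evalWord_block_right (hl b (by simp)),
      ih fun b hb => hl b (by simp [hb]), one_mul]

theorem evalWord_blocks_left [DecidableEq H] {l : List (Block X Y)}
    (hl : ∀ b ∈ l, evalWord ρ b.v' = (evalWord ρ b.v)⁻¹) (h : H) :
    (evalWord (letters π ρ) (l.flatMap Block.word)).1.left h =
      (l.map fun b => if evalWord ρ b.v = h then evalWord π b.u else 1).prod := by
  induction l with
  | nil => rfl
  | cons b l ih =>
    rw [List.flatMap_cons, evalWord_append, mul_left, evalWord_block_right (hl b (by simp)),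
      inv_one, one_mul, ih fun b hb => hl b (by simp [hb]), evalWord_block_left, List.map_cons,
      List.prod_cons]

/-- The union of the two alphabets is a symmetric generating set. Every element is the product of
finitely many blocks, one for each element of the support, and an element of `H`. -/
theorem isSymmetricGenerating_letters (hπ : IsSymmetricGenerating π)
    (hρ : IsSymmetricGenerating ρ) : IsSymmetricGenerating (letters π ρ) := by
  classical
  refine .of_surjective ?_ fun a => ?_
  · rintro (x | y)
    · obtain ⟨x', h⟩ := hπ.1 x
      exact ⟨.inl x', by simp [letters, h, base_inv]⟩
    · obtain ⟨y', h⟩ := hρ.1 y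
      exact ⟨.inr y', by simp [letters, h, top_inv]⟩
  · choose u hu using hπ.evalWord_surjective
    choose v hv using hρ.evalWord_surjective
    have hfin : (Function.mulSupport a.1.left).Finite := a.2
    set B : H → Block X Y := fun h => ⟨v h, u (a.1.left h), v h⁻¹⟩ with hB
    set l := hfin.toFinset.toList.map B with hl
    have hinv : ∀ b ∈ l, evalWord ρ b.v' = (evalWord ρ b.v)⁻¹ := by
      intro b hb
      obtain ⟨h, -, rfl⟩ := List.mem_map.1 hb
      simp [hB, hv]
    have hpw : l.Pairwise fun b c => evalWord ρ b.v ≠ evalWord ρ c.v := by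
      rw [hl, List.pairwise_map]
      simp only [hB, hv]
      exact Finset.nodup_toList _
    refine ⟨l.flatMap Block.word ++ (v a.1.right).map Sum.inr, ext (fun h => ?_) ?_⟩
    · rw [evalWord_append, mul_left, evalWord_blocks_left hinv, evalWord_map_inr]
      simp only [top, Pi.one_apply, mul_one]
      by_cases h1 : a.1.left h = 1
      · rw [h1]
        refine List.prod_map_ite_eq_one _ _ _ _ fun b hb => ?_
        obtain ⟨k, hk, rfl⟩ := List.mem_map.1 hb
        rintro rfl
        simp [hB, hv] at hk h1
        exact hk h1
      · have hmem : B h ∈ l := List.mem_map.2 ⟨h, by simpa using h1, rfl⟩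
        have := List.prod_map_ite_eq_of_mem (fun b : Block X Y => evalWord ρ b.v)
          (fun b => evalWord π b.u) hpw hmem
        simpa [hB, hv, hu] using this
    · rw [evalWord_append, mul_right, evalWord_blocks_right hinv, evalWord_map_inr]
      simp [top, hv]

/-- The subword of the letters in `Y`. -/
def yPart (w : List (X ⊕ Y)) : List Y := w.filterMap Sum.getRight?

theorem evalWord_letters_right (w : List (X ⊕ Y)) :
    (evalWord (letters π ρ) w).1.right = evalWord ρ (yPart w) := by
  induction w with
  | nil => rfl
  | cons a w ih =>
    rw [evalWord_cons, mul_right, ih]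
    cases a <;> simp [letters, base, top, yPart, List.filterMap_cons]

open Classical in
/-- The subword of those letters in `X` that occur after a prefix whose letters in `Y` represent
`h`; it represents the value at `h`. -/
noncomputable def lampWord (ρ : Y → H) (w : List (X ⊕ Y)) (h : H) : List X :=
  (List.range w.length).flatMap fun i => w[i]?.elim [] (Sum.elim
    (fun x => if evalWord ρ (yPart (w.take i)) = h then [x] else []) (fun _ => []))

open Classical in
theorem lampWord_append_singleton (w : List (X ⊕ Y)) (a : X ⊕ Y) (h : H) :
    lampWord ρ (w ++ [a]) h = lampWord ρ w h ++
      Sum.elim (fun x => if evalWord ρ (yPart w) = h then [x] else []) (fun _ => []) a := by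
  rw [lampWord, List.length_append, List.length_singleton, List.range_succ, List.flatMap_append]
  congr 1
  · rw [lampWord]
    simp only [List.flatMap]
    congr 1
    refine List.map_congr_left fun i hi => ?_
    have hi := List.mem_range.1 hi
    rw [List.getElem?_append_left hi, List.take_append_of_le_length hi.le]
  · simp

/-- The value at `h` is the product of the letters in `X` read while the letters in `Y` read so far
represent `h`. -/
theorem evalWord_letters_left (w : List (X ⊕ Y)) (h : H) :
    (evalWord (letters π ρ) w).1.left h = evalWord π (lampWord ρ w h) := by
  classical
  induction w using List.reverseRecOn with
  | nil => rfl
  | append_singleton w a ih =>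
    rw [lampWord_append_singleton, evalWord_append, evalWord_append, mul_left, ih,
      evalWord_letters_right]
    congr 1
    cases a with
    | inl x =>
      rw [evalWord_cons, evalWord_nil, mul_one]
      simp only [letters, Sum.elim_inl, base_left, inv_mul_eq_one]
      split <;> simp
    | inr y => simp [letters, top]

end RestrictedWreathProduct

/-! ### The normal form of the wreath product -/

theorem List.Shortlex.trans {α : Type*} [Preorder α] {a b c : List α}
    (h1 : List.Shortlex (· < ·) a b) (h2 : List.Shortlex (· < ·) b c) :
    List.Shortlex (· < ·) a c := by
  rw [List.shortlex_def] at *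
  rcases h1 with h1 | ⟨h1, h1'⟩ <;> rcases h2 with h2 | ⟨h2, h2'⟩
  · exact .inl (h1.trans h2)
  · exact .inl (h2 ▸ h1)
  · exact .inl (h1 ▸ h2)
  · exact .inr ⟨h1.trans h2, List.lex_trans (fun h h' => lt_trans h h') h1' h2'⟩

namespace RestrictedWreathProduct

variable {X Y G H : Type*} [Group G] [Group H] {π : X → G} {ρ : Y → H}
  {fX : List X → List X} {fY : List Y → List Y}

variable (ρ fX fY)

/-- The normal form word over `Y` of the prefix of length `i`. -/
def posWord (w : List (X ⊕ Y)) (i : ℕ) : List Y := fY (yPart (w.take i))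

/-- The normal form word over `X` for the value at the element represented by the prefix of
length `i`. -/
noncomputable def valueWord (w : List (X ⊕ Y)) (i : ℕ) : List X :=
  fX (lampWord ρ w (evalWord ρ (yPart (w.take i))))

/-- The place `i` is the first one at which the represented element of `H` occurs, and the value
there is not trivial. -/
def IsStart (w : List (X ⊕ Y)) (i : ℕ) : Prop :=
  (∀ j < i, posWord fY w j ≠ posWord fY w i) ∧ valueWord ρ fX w i ≠ []

/-- The block for the place `i`; the map `inv` gives inverses of the letters. -/
noncomputable def blockAt (inv : Y → Y) (w : List (X ⊕ Y)) (i : ℕ) : Block X Y :=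
  ⟨posWord fY w i, valueWord ρ fX w i, fY ((yPart (w.take i)).reverse.map inv)⟩

variable {ρ fX fY}

theorem blockAt_isNormal (hY : IsNormalFormFunction ρ fY) {inv : Y → Y}
    (hinv : ∀ y, ρ (inv y) = (ρ y)⁻¹) {w : List (X ⊕ Y)} {i : ℕ} (hi : IsStart ρ fX fY w i) :
    (blockAt ρ fX fY inv w i).IsNormal ρ fX fY where
  v_mem := ⟨_, rfl⟩
  u_mem := ⟨_, rfl⟩
  u_ne := hi.2
  v'_mem := ⟨_, rfl⟩
  v'_inv := by
    simp only [blockAt, posWord]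
    rw [hY.evalWord_eq, hY.evalWord_eq, evalWord_reverse_map hinv]

theorem exists_of_lampWord_ne_nil {w : List (X ⊕ Y)} {h : H} (hw : lampWord ρ w h ≠ []) :
    ∃ i < w.length, evalWord ρ (yPart (w.take i)) = h := by
  classical
  by_contra! h'
  refine hw ?_
  rw [lampWord, List.flatMap_eq_nil_iff]
  intro i hi
  have := h' i (List.mem_range.1 hi)
  rcases w[i]? with _ | (x | y) <;> simp [this]

section

variable {Z Γ : Type*} [Ctx Z Γ] [Finite X] [Finite Y]

theorem LSList_yPart {g : Γ → List (X ⊕ Y)} (hg : LSList g) : LSList (fun γ => yPart (g γ)) :=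
  hg.filterMap _

theorem LSList_posWord (hfY : LogspaceComputable fY) {g : Γ → List (X ⊕ Y)} (hg : LSList g)
    {A : Γ → ℕ} (hA : LS A) : LSList (fun γ => posWord fY (g γ) (A γ)) :=
  hfY.comp_LSList (LSList_yPart (hg.take hA))

theorem LSList_valueWord (hY : IsNormalFormFunction ρ fY) (hfX : LogspaceComputable fX)
    (hfY : LogspaceComputable fY) {g : Γ → List (X ⊕ Y)} (hg : LSList g)
    {A : Γ → ℕ} (hA : LS A) : LSList (fun γ => valueWord ρ fX (g γ) (A γ)) := by
  classical
  refine hfX.comp_LSList ?_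
  -- Equality in `H` is decided by comparing normal forms.
  have hP : LSP (fun p : Γ × ℕ => posWord fY (g p.1) p.2 = posWord fY (g p.1) (A p.1)) :=
    (LSList_posWord hfY hg.weaken LS.snd).eq (LSList_posWord hfY hg hA).weaken
  have := LSList.flatMapRange (f := fun γ i => (g γ)[i]?.elim [] (fun a =>
      Sum.elim (fun x => if evalWord ρ (yPart ((g γ).take i)) =
        evalWord ρ (yPart ((g γ).take (A γ))) then [x] else []) (fun _ => []) a))
    (hg.weaken.letterCases LS.snd (h := fun a p => Sum.elim (fun x =>
      if evalWord ρ (yPart ((g p.1).take p.2)) = evalWord ρ (yPart ((g p.1).take (A p.1)))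
        then [x] else []) (fun _ => []) a) ?_) hg.length
  · exact this.congr fun γ => rfl
  · rintro (x | y)
    · exact LSList.ite (hP.congr fun p => hY.eq_iff) (LSList.singleton x) LSList.nil
    · exact LSList.nil

theorem LSP_isStart (hY : IsNormalFormFunction ρ fY) (hfX : LogspaceComputable fX)
    (hfY : LogspaceComputable fY) {g : Γ → List (X ⊕ Y)} (hg : LSList g)
    {A : Γ → ℕ} (hA : LS A) : LSP (fun γ => IsStart ρ fX fY (g γ) (A γ)) :=
  (LSP.forall_lt (P := fun γ j => posWord fY (g γ) j ≠ posWord fY (g γ) (A γ))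
    ((LSList_posWord hfY hg.weaken LS.snd).eq (LSList_posWord hfY hg hA).weaken).not hA).and
    ((LSList_valueWord hY hfX hfY hg hA).eq LSList.nil).not

theorem LSList_block_word (hY : IsNormalFormFunction ρ fY) (hfX : LogspaceComputable fX)
    (hfY : LogspaceComputable fY) (inv : Y → Y) {g : Γ → List (X ⊕ Y)} (hg : LSList g)
    {A : Γ → ℕ} (hA : LS A) : LSList (fun γ => (blockAt ρ fX fY inv (g γ) (A γ)).word) :=
  (((LSList_posWord hfY hg hA).map _).append ((LSList_valueWord hY hfX hfY hg hA).map _)).append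
    ((hfY.comp_LSList ((LSList_yPart (hg.take hA)).reverse.map inv)).map _)

end

variable [LinearOrder Y]

/-- A sorted list of normal blocks is determined by the function `H → G` that it represents: its
blocks correspond to the elements of the support. -/
theorem blocks_unique (hX : IsNormalFormFunction π fX) (hY : IsNormalFormFunction ρ fY)
    (hX0 : fX [] = []) {l l' : List (Block X Y)} (hl : ∀ b ∈ l, b.IsNormal ρ fX fY)
    (hl' : ∀ b ∈ l', b.IsNormal ρ fX fY)
    (hs : (l.map Block.v).Pairwise (List.Shortlex (· < ·)))
    (hs' : (l'.map Block.v).Pairwise (List.Shortlex (· < ·)))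
    (h : ∀ k, (evalWord (letters π ρ) (l.flatMap Block.word)).1.left k =
      (evalWord (letters π ρ) (l'.flatMap Block.word)).1.left k) : l = l' := by
  classical
  have irr : ∀ v : List Y, ¬ List.Shortlex (· < ·) v v := fun v => Std.Irrefl.irrefl v
  have key : ∀ {l : List (Block X Y)}, (∀ b ∈ l, b.IsNormal ρ fX fY) →
      (l.map Block.v).Pairwise (List.Shortlex (· < ·)) →
      l.Pairwise fun b c => evalWord ρ b.v ≠ evalWord ρ c.v := by
    intro l hl hs
    rw [List.pairwise_map] at hs
    refine hs.imp_of_mem fun {b c} hb hc hbc h => ?_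
    rw [hY.eq_of_mem_range (hl b hb).v_mem (hl c hc).v_mem h] at hbc
    exact irr _ hbc
  have sub : ∀ {l l' : List (Block X Y)}, (∀ b ∈ l, b.IsNormal ρ fX fY) →
      (∀ b ∈ l', b.IsNormal ρ fX fY) →
      (l.map Block.v).Pairwise (List.Shortlex (· < ·)) →
      (l'.map Block.v).Pairwise (List.Shortlex (· < ·)) →
      (∀ k, (evalWord (letters π ρ) (l.flatMap Block.word)).1.left k =
        (evalWord (letters π ρ) (l'.flatMap Block.word)).1.left k) → ∀ b ∈ l, b ∈ l' := by
    intro l l' hl hl' hs hs' h b hb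
    have hb1 := h (evalWord ρ b.v)
    rw [evalWord_blocks_left fun b hb => (hl b hb).v'_inv,
      evalWord_blocks_left fun b hb => (hl' b hb).v'_inv,
      List.prod_map_ite_eq_of_mem (fun b : Block X Y => evalWord ρ b.v) (fun b => evalWord π b.u)
        (key hl hs) hb] at hb1
    by_cases hex : ∃ c ∈ l', evalWord ρ c.v = evalWord ρ b.v
    · obtain ⟨c, hc, hcb⟩ := hex
      rw [← hcb, List.prod_map_ite_eq_of_mem (fun b : Block X Y => evalWord ρ b.v)
        (fun b => evalWord π b.u) (key hl' hs') hc] at hb1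
      have nb := hl b hb
      have nc := hl' c hc
      have e1 := hY.eq_of_mem_range nb.v_mem nc.v_mem hcb.symm
      have e2 := hX.eq_of_mem_range nb.u_mem nc.u_mem hb1
      have e3 := hY.eq_of_mem_range nb.v'_mem nc.v'_mem (by rw [nb.v'_inv, nc.v'_inv, hcb])
      have : b = c := by
        cases b; cases c; simp_all
      rwa [this]
    · push Not at hex
      rw [List.prod_map_ite_eq_one _ _ _ _ hex] at hb1
      refine absurd (hX.eq_of_mem_range (hl b hb).u_mem ⟨[], hX0⟩ ?_) (hl b hb).u_ne
      rw [hb1, evalWord_nil]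
  have hnd : ∀ {l : List (Block X Y)}, (l.map Block.v).Pairwise (List.Shortlex (· < ·)) →
      l.Nodup := by
    intro l hs
    rw [List.pairwise_map] at hs
    exact hs.imp (S := (· ≠ ·)) fun {b c} hbc (h : b = c) => by subst h; exact irr _ hbc
  have hperm : l.Perm l' := (List.perm_ext_iff_of_nodup (hnd hs) (hnd hs')).2 fun b =>
    ⟨sub hl hl' hs hs' h b, sub hl' hl hs' hs (fun k => (h k).symm) b⟩
  rw [List.pairwise_map] at hs hs'
  refine hperm.eq_of_pairwise (le := fun b c => List.Shortlex (· < ·) b.v c.v) ?_ hs hs'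
  intro b c _ _ h1 h2
  exact absurd (h1.trans h2) (irr _)

/-- At most one word of the given shape represents a given element. -/
theorem HasShape.unique (hX : IsNormalFormFunction π fX) (hY : IsNormalFormFunction ρ fY)
    (hX0 : fX [] = []) {w w' z z' : List (X ⊕ Y)} (hz : HasShape ρ fX fY w z)
    (hz' : HasShape ρ fX fY w' z') (hw : evalWord (letters π ρ) w = evalWord (letters π ρ) w')
    (h : evalWord (letters π ρ) z = evalWord (letters π ρ) z') : z = z' := by
  obtain ⟨l, hl, hs, rfl⟩ := hz
  obtain ⟨l', hl', hs', rfl⟩ := hz'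
  have hw : fY (yPart w) = fY (yPart w') := by
    rw [hY.eq_iff, ← evalWord_letters_right (π := π), ← evalWord_letters_right (π := π), hw]
  change _ ++ (fY (yPart w)).map _ = _ ++ (fY (yPart w')).map _
  have h : evalWord (letters π ρ) (_ ++ (fY (yPart w)).map _) =
    evalWord (letters π ρ) (_ ++ (fY (yPart w')).map _) := h
  rw [hw, evalWord_append, evalWord_append] at h
  rw [hw, blocks_unique hX hY hX0 hl hl' hs hs' fun k => by rw [mul_right_cancel h]]

variable (ρ fX fY)

/-- The number of blocks before the block for the place `i`. -/
noncomputable def rank (w : List (X ⊕ Y)) (i : ℕ) : ℕ :=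
  ∑ j ∈ Finset.range w.length,
    ind (IsStart ρ fX fY w j ∧ List.Shortlex (· < ·) (posWord fY w j) (posWord fY w i))

open Classical in
/-- The sorted list of the blocks of `w`: for each rank `t` the block of that rank, if there is
one. -/
noncomputable def blocks (inv : Y → Y) (w : List (X ⊕ Y)) : List (Block X Y) :=
  (List.range w.length).flatMap fun t => (List.range w.length).flatMap fun i =>
    if IsStart ρ fX fY w i ∧ rank ρ fX fY w i = t then [blockAt ρ fX fY inv w i] else []

/-- The normal form of `w`. -/
noncomputable def nf (inv : Y → Y) (w : List (X ⊕ Y)) : List (X ⊕ Y) :=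
  (blocks ρ fX fY inv w).flatMap Block.word ++ (fY (yPart w)).map Sum.inr

variable {ρ fX fY}

/-- The block of the place `i` itself is counted in the rank of `j`, but not in that of `i`. -/
theorem rank_lt {w : List (X ⊕ Y)} {i j : ℕ} (hi : i < w.length) (h : IsStart ρ fX fY w i)
    (hij : List.Shortlex (· < ·) (posWord fY w i) (posWord fY w j)) :
    rank ρ fX fY w i < rank ρ fX fY w j := by
  refine Finset.sum_lt_sum (fun k _ => ?_) ⟨i, Finset.mem_range.2 hi, ?_⟩
  · by_cases h1 : IsStart ρ fX fY w k ∧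
      List.Shortlex (· < ·) (posWord fY w k) (posWord fY w i)
    · rw [ind_true h1, ind_true ⟨h1.1, h1.2.trans hij⟩]
    · rw [ind_false h1]
      exact Nat.zero_le _
  · rw [ind_false (P := IsStart ρ fX fY w i ∧
        List.Shortlex (· < ·) (posWord fY w i) (posWord fY w i))
      (fun h1 => Std.Irrefl.irrefl _ h1.2), ind_true ⟨h, hij⟩]
    exact one_pos

theorem rank_lt_length {w : List (X ⊕ Y)} {i : ℕ} (hi : i < w.length) :
    rank ρ fX fY w i < w.length := by
  calc rank ρ fX fY w i < ∑ j ∈ Finset.range w.length, 1 := by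
        refine Finset.sum_lt_sum (fun k _ => ?_) ⟨i, Finset.mem_range.2 hi, ?_⟩
        · unfold ind; split <;> simp
        · rw [ind_false fun h1 => Std.Irrefl.irrefl _ h1.2]
          exact one_pos
    _ = w.length := by simp

theorem mem_blocks {inv : Y → Y} {w : List (X ⊕ Y)} {b : Block X Y} :
    b ∈ blocks ρ fX fY inv w ↔
      ∃ i < w.length, IsStart ρ fX fY w i ∧ b = blockAt ρ fX fY inv w i := by
  classical
  simp only [blocks, List.mem_flatMap, List.mem_range]
  constructor
  · rintro ⟨t, -, i, hi, hb⟩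
    split at hb
    · exact ⟨i, hi, ‹_ ∧ _›.1, by simpa using hb⟩
    · simp at hb
  · rintro ⟨i, hi, hs, rfl⟩
    exact ⟨rank ρ fX fY w i, rank_lt_length hi, i, hi, by simp [hs]⟩

theorem blocks_sorted (inv : Y → Y) (w : List (X ⊕ Y)) :
    ((blocks ρ fX fY inv w).map Block.v).Pairwise (List.Shortlex (· < ·)) := by
  classical
  have tri : ∀ a b : List Y, ¬ List.Shortlex (· < ·) a b → ¬ List.Shortlex (· < ·) b a → a = b :=
    fun a b => Std.Trichotomous.trichotomous a b
  have hrank : ∀ i j, posWord fY w i = posWord fY w j →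
      rank ρ fX fY w i = rank ρ fX fY w j := by
    intro i j h
    rw [rank, rank, h]
  rw [List.pairwise_map, blocks, List.pairwise_flatMap]
  refine ⟨fun t _ => ?_, ?_⟩
  · rw [List.pairwise_flatMap]
    refine ⟨fun i _ => by split <;> simp, ?_⟩
    refine List.pairwise_lt_range.imp_of_mem fun {i j} hi hj hij b hb c hc => ?_
    split at hb
    · split at hc
      · rename_i h1 h2
        by_contra h
        simp only [List.mem_singleton] at hb hc
        subst hb hc
        refine h2.1.1 i hij (tri _ _ h fun h' => ?_)
        have := rank_lt (List.mem_range.1 hj) h2.1 h'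
        omega
      · simp at hc
    · simp at hb
  · refine List.pairwise_lt_range.imp_of_mem fun {t t'} _ _ htt b hb c hc => ?_
    simp only [List.mem_flatMap, List.mem_range] at hb hc
    obtain ⟨i, hi, hb⟩ := hb
    obtain ⟨j, hj, hc⟩ := hc
    split at hb
    · split at hc
      · rename_i h1 h2
        simp only [List.mem_singleton] at hb hc
        subst hb hc
        by_contra h
        have h3 : ¬ List.Shortlex (· < ·) (posWord fY w j) (posWord fY w i) := fun h' => by
          have := rank_lt hj h2.1 h'
          omega
        have := hrank _ _ (tri _ _ h h3)
        omega
      · simp at hc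
    · simp at hb

theorem blocks_isNormal (hY : IsNormalFormFunction ρ fY) {inv : Y → Y}
    (hinv : ∀ y, ρ (inv y) = (ρ y)⁻¹) (w : List (X ⊕ Y)) :
    ∀ b ∈ blocks ρ fX fY inv w, b.IsNormal ρ fX fY := by
  intro b hb
  obtain ⟨i, -, hi, rfl⟩ := mem_blocks.1 hb
  exact blockAt_isNormal hY hinv hi

theorem nf_hasShape (hY : IsNormalFormFunction ρ fY) {inv : Y → Y}
    (hinv : ∀ y, ρ (inv y) = (ρ y)⁻¹) (w : List (X ⊕ Y)) :
    HasShape ρ fX fY w (nf ρ fX fY inv w) :=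
  ⟨blocks ρ fX fY inv w, blocks_isNormal hY hinv w, blocks_sorted inv w, rfl⟩

/-- An element of the support has a first prefix that represents it, so its block is in the list. -/
theorem evalWord_nf (hX : IsNormalFormFunction π fX) (hY : IsNormalFormFunction ρ fY)
    (hX0 : fX [] = []) {inv : Y → Y} (hinv : ∀ y, ρ (inv y) = (ρ y)⁻¹) (w : List (X ⊕ Y)) :
    evalWord (letters π ρ) (nf ρ fX fY inv w) = evalWord (letters π ρ) w := by
  classical
  have hb := fun b hb => (blocks_isNormal (fX := fX) hY hinv w b hb).v'_inv
  refine ext (fun h => ?_) ?_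
  · rw [nf, evalWord_append, mul_left, evalWord_map_inr,
      evalWord_letters_left w]
    simp only [top, Pi.one_apply, mul_one]
    by_cases hex : ∃ i < w.length, IsStart ρ fX fY w i ∧ evalWord ρ (yPart (w.take i)) = h
    · obtain ⟨i, hi, hs, rfl⟩ := hex
      have hmem : blockAt ρ fX fY inv w i ∈ blocks ρ fX fY inv w := mem_blocks.2 ⟨i, hi, hs, rfl⟩
      have hpw : (blocks ρ fX fY inv w).Pairwise fun b c => evalWord ρ b.v ≠ evalWord ρ c.v := by
        have hs := blocks_sorted (ρ := ρ) (fX := fX) (fY := fY) inv w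
        rw [List.pairwise_map] at hs
        refine hs.imp_of_mem fun {b c} hb hc hbc h => ?_
        rw [hY.eq_of_mem_range (blocks_isNormal hY hinv w b hb).v_mem
          (blocks_isNormal hY hinv w c hc).v_mem h] at hbc
        exact Std.Irrefl.irrefl _ hbc
      have := List.prod_map_ite_eq_of_mem (fun b : Block X Y => evalWord ρ b.v)
          (fun b => evalWord π b.u) hpw hmem
      rw [evalWord_blocks_left hb]
      simp only [blockAt, posWord, valueWord, hY.evalWord_eq, hX.evalWord_eq] at this
      exact this
    · have hval : fX (lampWord ρ w h) = [] := by
        by_contra hne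
        have hlamp : lampWord ρ w h ≠ [] := fun h0 => hne (by rw [h0, hX0])
        have hfirst := exists_of_lampWord_ne_nil hlamp
        obtain ⟨hlt, heq⟩ := Nat.find_spec hfirst
        refine hex ⟨Nat.find hfirst, hlt, ⟨fun j hj h' => ?_, ?_⟩, heq⟩
        · exact Nat.find_min hfirst hj ⟨hj.trans hlt, (hY.eq_iff.1 h').trans heq⟩
        · rwa [valueWord, heq]
      rw [evalWord_blocks_left hb, List.prod_map_ite_eq_one, ← hX.evalWord_eq, hval, evalWord_nil]
      rintro b hb' rfl
      obtain ⟨i, hi, hs, rfl⟩ := mem_blocks.1 hb'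
      exact hex ⟨i, hi, hs, (hY.evalWord_eq _).symm⟩
  · rw [nf, evalWord_append, mul_right, evalWord_blocks_right hb, evalWord_map_inr,
      evalWord_letters_right w]
    simp [top, hY.evalWord_eq]

/-! ### The normal form is computable in logarithmic space -/

section

variable {Z Γ : Type*} [Ctx Z Γ] [Finite X] [Finite Y]

theorem LS_rank (hY : IsNormalFormFunction ρ fY) (hfX : LogspaceComputable fX)
    (hfY : LogspaceComputable fY) {g : Γ → List (X ⊕ Y)} (hg : LSList g)
    {A : Γ → ℕ} (hA : LS A) : LS (fun γ => rank ρ fX fY (g γ) (A γ)) :=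
  LS.sum (F := fun γ j => ind (IsStart ρ fX fY (g γ) j ∧
      List.Shortlex (· < ·) (posWord fY (g γ) j) (posWord fY (g γ) (A γ))))
    ((LSP_isStart hY hfX hfY hg.weaken LS.snd).and
      ((LSList_posWord hfY hg.weaken LS.snd).shortlex _ (LSList_posWord hfY hg hA).weaken))
    hg.length

theorem LSList_nf (hY : IsNormalFormFunction ρ fY) (hfX : LogspaceComputable fX)
    (hfY : LogspaceComputable fY) (inv : Y → Y) {g : Γ → List (X ⊕ Y)} (hg : LSList g) :
    LSList (fun γ => nf ρ fX fY inv (g γ)) := by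
  classical
  refine LSList.append (LSList.congr (LSList.flatMapRange
    (f := fun γ t => (List.range (g γ).length).flatMap fun i =>
      if IsStart ρ fX fY (g γ) i ∧ rank ρ fX fY (g γ) i = t
        then (blockAt ρ fX fY inv (g γ) i).word else []) ?_ hg.length) fun γ => ?_)
    ((hfY.comp_LSList (LSList_yPart hg)).map _)
  · have hg2 : LSList (fun p : (Γ × ℕ) × ℕ => g p.1.1) := hg.weaken.weaken
    exact LSList.flatMapRange (Γ := Γ × ℕ) (f := fun p i =>
      if IsStart ρ fX fY (g p.1) i ∧ rank ρ fX fY (g p.1) i = p.2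
        then (blockAt ρ fX fY inv (g p.1) i).word else [])
      (LSList.ite ((LSP_isStart hY hfX hfY hg2 LS.snd).and
        (LSP.eq (LS_rank hY hfX hfY hg2 LS.snd) LS.snd.weaken))
        (LSList_block_word hY hfX hfY inv hg2 LS.snd) LSList.nil) hg.length.weaken
  · rw [blocks, List.flatMap_assoc]
    refine List.flatMap_congr fun t _ => ?_
    rw [List.flatMap_assoc]
    refine List.flatMap_congr fun i _ => ?_
    split <;> simp

end

/-- The normal form function of the wreath product, characterized by the shape of its values. -/
theorem exists_normal_form_function (hX : IsLogspaceNormalFormFunction π fX)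
    (hY : IsLogspaceNormalFormFunction ρ fY) (hX0 : fX [] = []) :
    ∃ f : List (X ⊕ Y) → List (X ⊕ Y), IsLogspaceNormalFormFunction (letters π ρ) f ∧
      ∀ w z : List (X ⊕ Y), (HasShape ρ fX fY w z ∧
        evalWord (letters π ρ) z = evalWord (letters π ρ) w) ↔ z = f w := by
  have := hX.finite
  have := hY.finite
  choose inv hinv using hY.generating.1
  have hgen := isSymmetricGenerating_letters hX.generating hY.generating
  have heval := evalWord_nf hX.normalForm hY.normalForm hX0 hinv
  have hshape := nf_hasShape (X := X) (fX := fX) hY.normalForm hinv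
  refine ⟨nf ρ fX fY inv, ⟨inferInstance, hgen, ?_, ?_⟩, fun w z => ⟨?_, ?_⟩⟩
  · refine .of_surjective hgen.evalWord_surjective heval fun u w h => ?_
    exact (hshape u).unique hX.normalForm hY.normalForm hX0 (hshape w) h
      (by rw [heval, heval, h])
  · exact LSList.logspaceComputable (LSList_nf hY.normalForm hX.logspace hY.logspace inv
      LSList.inp)
  · rintro ⟨h1, h2⟩
    exact h1.unique hX.normalForm hY.normalForm hX0 (hshape w) rfl (h2.trans (heval w).symm)
  · rintro rfl
    exact ⟨hshape w, heval w⟩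

end RestrictedWreathProduct

/-! ### Closure properties of the groups with a logspace normal form -/

section

variable {X Y G H : Type*} [Group G] [Group H] {π : X → G} {ρ : Y → H}
  {f : List X → List X} {g : List Y → List Y}

/-- A function `f` in the class `LSList` is a logspace normal form function if `f w` represents the
same element as `w` and depends only on that element. -/
theorem IsLogspaceNormalFormFunction.of_LSList [Finite X] (hinv : ∀ x, ∃ y, π y = (π x)⁻¹)
    (hs : Function.Surjective (evalWord π)) (hf : ∀ w, evalWord π (f w) = evalWord π w)
    (hf' : ∀ u w, evalWord π u = evalWord π w → f u = f w) (hL : LSList f) :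
    IsLogspaceNormalFormFunction π f where
  finite := inferInstance
  generating := .of_surjective hinv hs
  normalForm := .of_surjective hs hf hf'
  logspace := hL.logspaceComputable

/-- The alphabet may be replaced by the set of group elements that it represents. -/
theorem IsLogspaceNormalFormFunction.hasLogspaceNormalForm
    (h : IsLogspaceNormalFormFunction π f) : HasLogspaceNormalForm G := by
  have := h.finite
  let S : Finset G := (Set.finite_range π).toFinset
  let r : X → S := fun x => ⟨π x, by simp [S]⟩
  have hex : ∀ a : S, ∃ x, π x = a := fun a =>
    (Set.finite_range π).mem_toFinset.1 a.2
  choose s hs using hex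
  have hr : ∀ u : List X, evalWord (Subtype.val : S → G) (u.map r) = evalWord π u := fun u => by
    simp [evalWord, Function.comp_def, r]
  have hs' : ∀ u : List S, evalWord π (u.map s) = evalWord (Subtype.val : S → G) u := fun u => by
    simp [evalWord, Function.comp_def, hs]
  -- Words over `S` are lifted along the section `s` of `r`, which keeps the represented element
  -- unchanged.
  refine ⟨S, fun w => (f (w.map s)).map r, .of_LSList (fun a => ?_) (fun a => ?_) (fun w => ?_)
    (fun u w huw => ?_) ((h.logspace.comp_LSList (LSList.inp.map s)).map r)⟩
  · obtain ⟨y, hy⟩ := h.generating.1 (s a)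
    exact ⟨r y, by rw [← hs a, ← hy]⟩
  · obtain ⟨u, rfl⟩ := h.generating.evalWord_surjective a
    exact ⟨u.map r, hr u⟩
  · rw [hr, h.normalForm.evalWord_eq, hs']
  · rw [h.normalForm.eq_iff.2 (((hs' u).trans huw).trans (hs' w).symm)]

/-- A normal form function may be changed so that the empty word is a normal form. -/
theorem IsLogspaceNormalFormFunction.exists_map_nil (h : IsLogspaceNormalFormFunction π f) :
    ∃ f' : List X → List X, IsLogspaceNormalFormFunction π f' ∧ f' [] = [] := by
  classical
  have := h.finite
  have key : ∀ w, f w = f [] ↔ evalWord π w = 1 := fun w => h.normalForm.eq_iff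
  have hL : LSList f := (h.logspace.comp_LSList LSList.inp).congr fun _ => rfl
  refine ⟨fun w => if f w = f [] then [] else f w, .of_LSList h.generating.1
    h.generating.evalWord_surjective (fun w => ?_) (fun u w huw => ?_)
    (.ite (hL.eq (.const (f []))) .nil hL), if_pos rfl⟩
  · split
    · rw [(key w).1 ‹_›, evalWord_nil]
    · exact h.normalForm.evalWord_eq w
  · rw [h.normalForm.eq_iff.2 huw]

theorem IsLogspaceNormalFormFunction.comp_mulEquiv (h : IsLogspaceNormalFormFunction π f)
    (e : G ≃* H) : IsLogspaceNormalFormFunction (fun x => e (π x)) f := by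
  have := h.finite
  have he : ∀ w, evalWord (fun x => e (π x)) w = e (evalWord π w) := fun w => by
    simp [evalWord, map_list_prod, Function.comp_def]
  refine .of_LSList (fun x => ?_) (fun a => ?_) (fun w => ?_) (fun u w huw => ?_)
    ((h.logspace.comp_LSList LSList.inp).congr fun _ => rfl)
  · obtain ⟨y, hy⟩ := h.generating.1 x
    exact ⟨y, by rw [hy, map_inv]⟩
  · obtain ⟨w, hw⟩ := h.generating.evalWord_surjective (e.symm a)
    exact ⟨w, by rw [he, hw, e.apply_symm_apply]⟩
  · rw [he, he, h.normalForm.evalWord_eq]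
  · rw [he, he, e.apply_eq_iff_eq] at huw
    exact h.normalForm.eq_iff.2 huw

theorem HasLogspaceNormalForm.of_mulEquiv (h : HasLogspaceNormalForm G) (e : G ≃* H) :
    HasLogspaceNormalForm H := by
  obtain ⟨X, f, h⟩ := h
  exact (h.comp_mulEquiv e).hasLogspaceNormalForm

theorem HasLogspaceNormalForm.restrictedWreathProduct (hG : HasLogspaceNormalForm G)
    (hH : HasLogspaceNormalForm H) : HasLogspaceNormalForm (RestrictedWreathProduct G H) := by
  obtain ⟨X, f₀, h₀⟩ := hG
  obtain ⟨Y, g, hg⟩ := hH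
  obtain ⟨f, hf, hf0⟩ := h₀.exists_map_nil
  let : LinearOrder Y := LinearOrder.lift' (Finite.equivFin Y) (Finite.equivFin Y).injective
  obtain ⟨k, hk, -⟩ := RestrictedWreathProduct.exists_normal_form_function hf hg hf0
  exact hk.hasLogspaceNormalForm

/-- In a direct product the two coordinates of a word are brought to normal form separately. -/
theorem HasLogspaceNormalForm.prod (hG : HasLogspaceNormalForm G)
    (hH : HasLogspaceNormalForm H) : HasLogspaceNormalForm (G × H) := by
  obtain ⟨X, f, hf⟩ := hG
  obtain ⟨Y, g, hg⟩ := hH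
  let π : X ⊕ Y → G × H := Sum.elim (fun x => (x, 1)) (fun y => (1, y))
  let l : List (X ⊕ Y) → List X := List.filterMap Sum.getLeft?
  let r : List (X ⊕ Y) → List Y := List.filterMap Sum.getRight?
  have hπ : ∀ w, evalWord π w = (evalWord Subtype.val (l w), evalWord Subtype.val (r w)) := by
    intro w
    induction w with
    | nil => rfl
    | cons a w ih =>
      rw [evalWord_cons, ih]
      rcases a with x | y <;> simp [π, l, r, List.filterMap_cons]
  have hl : ∀ u v, l (List.map Sum.inl u ++ List.map Sum.inr v) = u := fun u v => by
    simp [l, List.filterMap_map, Function.comp_def]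
  have hr : ∀ u v, r (List.map Sum.inl u ++ List.map Sum.inr v) = v := fun u v => by
    simp [r, List.filterMap_map, Function.comp_def]
  refine (IsLogspaceNormalFormFunction.of_LSList (π := π)
    (f := fun w => (f (l w)).map Sum.inl ++ (g (r w)).map Sum.inr) ?_ (fun a => ?_) (fun w => ?_)
    (fun u w huw => ?_) (((hf.logspace.comp_LSList (LSList.inp.filterMap _)).map _).append
      ((hg.logspace.comp_LSList (LSList.inp.filterMap _)).map _))).hasLogspaceNormalForm
  · rintro (x | y)
    · obtain ⟨z, hz⟩ := hf.generating.1 x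
      exact ⟨.inl z, by simp [π, hz]⟩
    · obtain ⟨z, hz⟩ := hg.generating.1 y
      exact ⟨.inr z, by simp [π, hz]⟩
  · obtain ⟨u, hu⟩ := hf.generating.evalWord_surjective a.1
    obtain ⟨v, hv⟩ := hg.generating.evalWord_surjective a.2
    exact ⟨u.map Sum.inl ++ v.map Sum.inr, by rw [hπ, hl, hr, hu, hv]⟩
  · rw [hπ, hπ, hl, hr, hf.normalForm.evalWord_eq, hg.normalForm.evalWord_eq]
  · rw [hπ, hπ, Prod.ext_iff] at huw
    rw [hf.normalForm.eq_iff.2 huw.1, hg.normalForm.eq_iff.2 huw.2]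

end

/-! ### Cyclic groups -/

section

variable {Z Z' Γ : Type*} [Ctx Z Γ]

theorem LSList.replicate {N : Γ → ℕ} (hN : LS N) (z : Z') :
    LSList (fun γ => List.replicate (N γ) z) :=
  (LSList.flatMapRange (f := fun _ _ => [z]) (LSList.singleton z) hN).congr fun γ => by
    rw [List.flatMap_def, List.map_const', List.length_range]
    simp

theorem LS.count_letter [Finite Z'] [DecidableEq Z'] {g : Γ → List Z'} (hg : LSList g) (z : Z') :
    LS (fun γ => (g γ).count z) :=
  (hg.filterMap (Option.guard (· == z))).length.congr fun γ => by
    rw [List.filterMap_eq_filter, List.count_eq_length_filter]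

end

/-- The two letters stand for the generator `a` and its inverse. -/
def signed {G : Type*} [Group G] (a : G) (b : Bool) : G := if b then a else a⁻¹

theorem exists_signed_eq_inv {G : Type*} [Group G] (a : G) (b : Bool) :
    ∃ c, signed a c = (signed a b)⁻¹ :=
  ⟨!b, by cases b <;> simp [signed]⟩

theorem evalWord_signed {G : Type*} [Group G] (a : G) (w : List Bool) :
    evalWord (signed a) w = a ^ ((w.count true : ℤ) - w.count false) := by
  induction w with
  | nil => simp
  | cons b w ih =>
    rw [evalWord_cons, ih]
    cases b
    · rw [signed, if_neg Bool.false_ne_true, ← zpow_neg_one, ← zpow_add]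
      simp
      ring_nf
    · rw [signed, if_pos rfl, ← zpow_one_add]
      simp
      ring_nf

/-- The normal forms are the words in which only one of the two letters occurs. -/
theorem hasLogspaceNormalForm_multiplicative_int :
    HasLogspaceNormalForm (Multiplicative ℤ) := by
  have hev : ∀ w, evalWord (signed (Multiplicative.ofAdd (1 : ℤ))) w =
      Multiplicative.ofAdd ((w.count true : ℤ) - w.count false) := fun w => by
    rw [evalWord_signed, ← ofAdd_zsmul]
    simp
  refine (IsLogspaceNormalFormFunction.of_LSList (π := signed (Multiplicative.ofAdd (1 : ℤ)))
    (f := fun w => List.replicate (w.count true - w.count false) true ++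
      List.replicate (w.count false - w.count true) false)
    (exists_signed_eq_inv _) (fun a => ?_) (fun w => ?_) (fun u w huw => ?_)
    ?_).hasLogspaceNormalForm
  · refine ⟨List.replicate (a.toAdd).toNat true ++ List.replicate (-a.toAdd).toNat false, ?_⟩
    rw [hev]
    simp [List.count_replicate]
  · rw [hev, hev]
    refine congrArg _ ?_
    simp only [List.count_append, List.count_replicate]
    simp
    omega
  · rw [hev, hev, Multiplicative.ofAdd.apply_eq_iff_eq] at huw
    have h1 : u.count true - u.count false = w.count true - w.count false := by omega
    have h2 : u.count false - u.count true = w.count false - w.count true := by omega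
    simp only [h1, h2]
  · have h := fun b => LS.count_letter (Γ := List Bool) LSList.inp b
    exact (LSList.replicate ((h true).sub (h false)) true).append
      (LSList.replicate ((h false).sub (h true)) false)

/-- The inverse of the generator is replaced by its power `m - 1`, so that the normal forms are the
powers of the generator with exponents below `m`. -/
theorem hasLogspaceNormalForm_multiplicative_zmod {m : ℕ} (hm : 1 ≤ m) :
    HasLogspaceNormalForm (Multiplicative (ZMod m)) := by
  have : NeZero m := ⟨by omega⟩
  have hev : ∀ w, evalWord (signed (Multiplicative.ofAdd (1 : ZMod m))) w =
      Multiplicative.ofAdd ((w.count true + (m - 1) * w.count false : ℕ) : ZMod m) := fun w => by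
    rw [evalWord_signed, ← ofAdd_zsmul]
    simp [Nat.cast_sub hm, sub_eq_add_neg]
  refine (IsLogspaceNormalFormFunction.of_LSList (π := signed (Multiplicative.ofAdd (1 : ZMod m)))
    (f := fun w => List.replicate ((w.count true + (m - 1) * w.count false) % m) true)
    (exists_signed_eq_inv _) (fun a => ?_) (fun w => ?_) (fun u w huw => ?_)
    ?_).hasLogspaceNormalForm
  · refine ⟨List.replicate (a.toAdd).val true, ?_⟩
    rw [hev]
    simp [List.count_replicate]
  · rw [hev, hev]
    simp [List.count_replicate]
  · rw [hev, hev, Multiplicative.ofAdd.apply_eq_iff_eq, ZMod.natCast_eq_natCast_iff'] at huw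
    simp only [huw]
  · have h := fun b => LS.count_letter (Γ := List Bool) LSList.inp b
    exact LSList.replicate (((h true).add ((LS.const (m - 1)).mul (h false))).mod (LS.const m)) true

theorem mainTheorem1 :
    -- the explicit normal form
    (∀ (G H X Y : Type*) [Group G] [Group H] [LinearOrder Y] (π : X → G) (ρ : Y → H)
        (fX : List X → List X) (fY : List Y → List Y),
      IsLogspaceNormalFormFunction π fX → IsLogspaceNormalFormFunction ρ fY →
      fX [] = [] → fY [] = [] →
      ∃ f : List (X ⊕ Y) → List (X ⊕ Y),
        IsLogspaceNormalFormFunction (RestrictedWreathProduct.letters π ρ) f ∧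
        ∀ w z : List (X ⊕ Y),
          (RestrictedWreathProduct.HasShape ρ fX fY w z ∧
            evalWord (RestrictedWreathProduct.letters π ρ) z =
              evalWord (RestrictedWreathProduct.letters π ρ) w) ↔ z = f w) ∧
    -- closure under restricted wreath products
    (∀ (G H : Type*) [Group G] [Group H], HasLogspaceNormalForm G → HasLogspaceNormalForm H →
      HasLogspaceNormalForm (RestrictedWreathProduct G H)) ∧
    -- the lamplighter groups
    (∀ m : ℕ, 2 ≤ m → HasLogspaceNormalForm
      (RestrictedWreathProduct (Multiplicative (ZMod m)) (Multiplicative ℤ))) ∧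
    -- the wreath product of ℤ and ℤ²
    HasLogspaceNormalForm
      (RestrictedWreathProduct (Multiplicative ℤ) (Multiplicative (ℤ × ℤ))) := by
  refine ⟨fun G H X Y _ _ _ π ρ fX fY hX hY hX0 _ =>
      RestrictedWreathProduct.exists_normal_form_function hX hY hX0,
    fun G H _ _ hG hH => hG.restrictedWreathProduct hH, fun m hm => ?_, ?_⟩
  · exact (hasLogspaceNormalForm_multiplicative_zmod (by omega)).restrictedWreathProduct
      hasLogspaceNormalForm_multiplicative_int
  · exact hasLogspaceNormalForm_multiplicative_int.restrictedWreathProduct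
      ((hasLogspaceNormalForm_multiplicative_int.prod
        hasLogspaceNormalForm_multiplicative_int).of_mulEquiv
          (MulEquiv.prodMultiplicative ℤ ℤ).symm)
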